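/- A (finite normal-form) game $\Gamma$ consists of players $\mathcal N=\{1,\dots,N\}$, a finite non-empty action set $A^i$ for each player $i$, and payoffs $u^i : A \to \mathbb Q$ on the set $A = \prod_i A^i$ of action profiles. A symmetry of $\Gamma$ is a bijection $\phi$ of the disjoint union $\mathcal A=\bigsqcup_i A^i$ onto itself that maps the actions of each player $i$ to actions of one player $\pi(i)$ and satisfies $u^i(\mathbf a) = u^{\pi(i)}(\phi(\mathbf a))$ for all $i\in\mathcal N$ and $\mathbf a \in A$, where $\phi(\mathbf a)=\big(\phi(\mathbf a_{\pi^{-1}(j)})\big)_{j\in\mathcal N}$; the permutation $\pi$ of $\mathcal N$ is said to be induced by $\phi$. Games are given in explicit form, as the table of all payoffs written in binary; graphs are given by adjacency matrices. $\mathsf{GI}$ is the class of decision problems that are polynomial-time many-one reducible to the graph isomorphism problem; a problem is $\mathsf{GI}$-hard if every problem in $\mathsf{GI}$ is polynomial-time many-one reducible to it, and $\mathsf{GI}$-complete if it is in $\mathsf{GI}$ and $\mathsf{GI}$-hard. An instance of restricted graph isomorphism consists of two finite simple graphs $G,H$ and pairs $(u_1,v_1),\dots,(u_k,v_k)\in V_G\times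 V_H$, and asks whether there is an isomorphism $\psi:G\to H$ with $\psi(u_l)=v_l$ for all $l$. (1) The problem of deciding, given a game $\Gamma$, whether every permutation of the players is induced by some symmetry of $\Gamma$ is $\mathsf{GI}$-complete. (2) Its restriction to two-player zero-sum games is still $\mathsf{GI}$-hard. (3) There is a polynomial-time algorithm that maps a game $\Gamma$ to a list of instances $R_{ij}$ of restricted graph isomorphism, one for each transposition $(i\,j)$ of players, $i<j$, such that $R_{ij}$ is a yes-instance if and only if $(i\,j)$ is induced by some symmetry of $\Gamma$, and such that every permutation of the players is induced by some symmetry of $\Gamma$ if and only if all the instances $R_{ij}$ are yes-instances. -/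

import Mathlib

noncomputable section

namespace GameSym

open Computability

/-! ## Decision problems, polynomial-time many-one reductions -/

/-- A decision problem: a type of instances, an encoding of the instances as strings over a finite
alphabet, and the set of yes-instances. -/
structure DecisionProblem where
  Instance : Type
  Symbol : Type
  symbolFintype : Fintype Symbol
  encode : Instance → List Symbol
  encode_injective : Function.Injective encode
  Yes : Instance → Prop

/-- `f` is computed by a (multi-stack) Turing machine whose number of steps is bounded by a
polynomial in the length of the encoded input. -/
def PolyTimeComputable {α β S T : Type} (ea : α → List S) (eb : β → List T) (f : α → β) : Prop :=
  Nonempty (Turing.TM2ComputableInPolyTime ea eb f)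

/-- Polynomial-time many-one (Karp) reducibility. -/
def PolyTimeReduces (P Q : DecisionProblem) : Prop :=
  ∃ f : P.Instance → Q.Instance,
    PolyTimeComputable P.encode Q.encode f ∧ ∀ x, P.Yes x ↔ Q.Yes (f x)

/-! ## Encodings over the alphabet `Γ'` -/

/-- A self-delimiting code: it can be read off the front of any longer string. -/
def SelfDelimiting {α : Type*} (enc : α → List Γ') : Prop :=
  ∀ x y s t, enc x ++ s = enc y ++ t → x = y ∧ s = t

theorem SelfDelimiting.injective {α : Type*} {enc : α → List Γ'} (h : SelfDelimiting enc) :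
    Function.Injective enc := fun x y hxy => (h x y [] [] (by rw [hxy])).1

/-- A bit string, terminated by a comma. -/
def encodeBits (l : List Bool) : List Γ' := l.map Γ'.bit ++ [Γ'.comma]

/-- A natural number in unary. -/
def encodeUnary (n : ℕ) : List Γ' := encodeBits (List.replicate n true)

/-- A natural number in binary. -/
def encodeBinary (n : ℕ) : List Γ' := encodeBits (encodeNat n)

/-- A rational number: sign bit, then numerator and denominator (in lowest terms) in binary. -/
def encodeRat (q : ℚ) : List Γ' :=
  Γ'.bit (decide (q.num < 0)) :: (encodeBinary q.num.natAbs ++ encodeBinary q.den)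

/-- A list of objects, given a code for its members. -/
def encodeList {α : Type*} (enc : α → List Γ') (l : List α) : List Γ' :=
  l.flatMap (fun x => Γ'.bra :: enc x) ++ [Γ'.ket]

theorem encodeBits_selfDelimiting : SelfDelimiting encodeBits := by
  intro x
  induction x with
  | nil =>
    intro y s t h
    cases y with
    | nil => simpa [encodeBits] using h
    | cons b y => simp [encodeBits] at h
  | cons a x ih =>
    intro y s t h
    cases y with
    | nil => simp [encodeBits] at h
    | cons b y =>
      simp only [encodeBits, List.map_cons, List.cons_append, List.cons.injEq,
        Γ'.bit.injEq] at h
      obtain ⟨h1, h2⟩ := ih y s t h.2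
      exact ⟨by rw [h.1, h1], h2⟩

theorem encodeUnary_selfDelimiting : SelfDelimiting encodeUnary := by
  intro x y s t h
  obtain ⟨h1, h2⟩ := encodeBits_selfDelimiting _ _ _ _ h
  exact ⟨by simpa using congrArg List.length h1, h2⟩

theorem encodeBinary_selfDelimiting : SelfDelimiting encodeBinary := by
  intro x y s t h
  obtain ⟨h1, h2⟩ := encodeBits_selfDelimiting _ _ _ _ h
  exact ⟨encodingNatBool.encode_injective h1, h2⟩

theorem encodeRat_selfDelimiting : SelfDelimiting encodeRat := by
  intro x y s t h
  simp only [encodeRat, List.cons_append, List.append_assoc, List.cons.injEq, Γ'.bit.injEq,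
    decide_eq_decide] at h
  obtain ⟨hs, h⟩ := h
  obtain ⟨h1, h⟩ := encodeBinary_selfDelimiting _ _ _ _ h
  obtain ⟨h2, h⟩ := encodeBinary_selfDelimiting _ _ _ _ h
  exact ⟨Rat.ext (by omega) h2, h⟩

theorem encodeList_selfDelimiting {α : Type*} {enc : α → List Γ'} (he : SelfDelimiting enc) :
    SelfDelimiting (encodeList enc) := by
  intro x
  induction x with
  | nil =>
    intro y s t h
    cases y with
    | nil => simpa [encodeList] using h
    | cons b y => simp [encodeList] at h
  | cons a x ih =>
    intro y s t h
    cases y with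
    | nil => simp [encodeList] at h
    | cons b y =>
      simp only [encodeList, List.flatMap_cons, List.cons_append, List.append_assoc,
        List.cons.injEq, true_and] at h
      obtain ⟨h1, h2⟩ := he _ _ _ _ h
      obtain ⟨h3, h4⟩ := ih y s t (by simpa [encodeList] using h2)
      exact ⟨by rw [h1, h3], h4⟩

/-- Tables indexed by the same list. -/
theorem flatMap_selfDelimiting {ι α : Type*} {enc : α → List Γ'} (he : SelfDelimiting enc)
    (f g : ι → α) : ∀ (l : List ι) (s t : List Γ'),
    l.flatMap (fun i => enc (f i)) ++ s = l.flatMap (fun i => enc (g i)) ++ t →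
      (∀ i ∈ l, f i = g i) ∧ s = t := by
  intro l
  induction l with
  | nil => intro s t h; simpa using h
  | cons a l ih =>
    intro s t h
    simp only [List.flatMap_cons, List.append_assoc] at h
    obtain ⟨h1, h2⟩ := he _ _ _ _ h
    obtain ⟨h3, h4⟩ := ih s t h2
    exact ⟨by simpa [h1] using h3, h4⟩

/-! ## Graph isomorphism -/

/-- A finite simple graph on the vertices `0, …, order - 1`. -/
structure FinGraph where
  order : ℕ
  graph : SimpleGraph (Fin order)

open Classical in
/-- The number of vertices in unary, then the adjacency matrix row by row. -/
def FinGraph.encode (G : FinGraph) : List Γ' :=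
  encodeUnary G.order ++
    (List.finRange G.order).flatMap fun u =>
      (List.finRange G.order).flatMap fun v => [Γ'.bit (decide (G.graph.Adj u v))]

theorem bit_selfDelimiting : SelfDelimiting (fun b : Bool => [Γ'.bit b]) := by
  intro x y s t h
  simpa using h

theorem row_selfDelimiting (n : ℕ) : SelfDelimiting (fun r : Fin n → Bool =>
    (List.finRange n).flatMap fun v => [Γ'.bit (r v)]) := by
  intro x y s t h
  obtain ⟨h1, h2⟩ := flatMap_selfDelimiting bit_selfDelimiting x y _ s t h
  exact ⟨funext fun i => h1 i (List.mem_finRange i), h2⟩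

theorem FinGraph.encode_selfDelimiting : SelfDelimiting FinGraph.encode := by
  classical
  rintro ⟨n, G⟩ ⟨m, H⟩ s t h
  simp only [FinGraph.encode, List.append_assoc] at h
  obtain ⟨h1, h⟩ := encodeUnary_selfDelimiting _ _ _ _ h
  subst h1
  obtain ⟨h1, h2⟩ := flatMap_selfDelimiting (row_selfDelimiting n)
    (fun u v => decide (G.Adj u v)) (fun u v => decide (H.Adj u v)) _ s t (by convert h)
  refine ⟨?_, h2⟩
  congr 1
  ext u v
  simpa using congrFun (h1 u (List.mem_finRange u)) v

/-- The graph isomorphism problem. -/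
def graphIsomorphism : DecisionProblem where
  Instance := FinGraph × FinGraph
  Symbol := Γ'
  symbolFintype := inferInstance
  encode p := p.1.encode ++ p.2.encode
  encode_injective := by
    rintro ⟨G, H⟩ ⟨G', H'⟩ h
    obtain ⟨h1, h2⟩ := FinGraph.encode_selfDelimiting _ _ _ _ h
    exact Prod.ext h1 (FinGraph.encode_selfDelimiting.injective h2)
  Yes p := Nonempty (p.1.graph ≃g p.2.graph)

/-- The complexity class GI: the decision problems that reduce to graph isomorphism. -/
def GI : Set DecisionProblem := {P | PolyTimeReduces P graphIsomorphism}

/-- Every problem in GI reduces to `P`. -/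
def GIHard (P : DecisionProblem) : Prop := ∀ Q ∈ GI, PolyTimeReduces Q P

def GIComplete (P : DecisionProblem) : Prop := P ∈ GI ∧ GIHard P

/-- An instance of restricted graph isomorphism: two graphs, and a list of pairs `(u, v)` of a
vertex of the first and a vertex of the second. -/
structure RestrictedInstance where
  source : FinGraph
  target : FinGraph
  constraints : List (Fin source.order × Fin target.order)

/-- Some isomorphism maps `u` to `v` for each of the listed pairs `(u, v)`. -/
def RestrictedInstance.Yes (R : RestrictedInstance) : Prop :=
  ∃ e : R.source.graph ≃g R.target.graph, ∀ p ∈ R.constraints, e p.1 = p.2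

def RestrictedInstance.encode (R : RestrictedInstance) : List Γ' :=
  R.source.encode ++ R.target.encode ++
    encodeList (fun p => encodeUnary p.1.val ++ encodeUnary p.2.val) R.constraints

theorem RestrictedInstance.encode_selfDelimiting : SelfDelimiting RestrictedInstance.encode := by
  rintro ⟨G, H, l⟩ ⟨G', H', l'⟩ s t h
  simp only [RestrictedInstance.encode, List.append_assoc] at h
  obtain ⟨h1, h⟩ := FinGraph.encode_selfDelimiting _ _ _ _ h
  obtain ⟨h2, h⟩ := FinGraph.encode_selfDelimiting _ _ _ _ h
  subst h1 h2
  have hp : SelfDelimiting (fun p : Fin G.order × Fin H.order =>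
      encodeUnary p.1.val ++ encodeUnary p.2.val) := by
    rintro ⟨u, v⟩ ⟨u', v'⟩ s t h
    simp only [List.append_assoc] at h
    obtain ⟨h1, h⟩ := encodeUnary_selfDelimiting _ _ _ _ h
    obtain ⟨h2, h⟩ := encodeUnary_selfDelimiting _ _ _ _ h
    exact ⟨Prod.ext (Fin.ext h1) (Fin.ext h2), h⟩
  obtain ⟨h1, h2⟩ := encodeList_selfDelimiting hp _ _ _ _ h
  exact ⟨by rw [h1], h2⟩

/-! ## Games -/

/-- A finite normal-form game with rational payoffs. -/
structure Game where
  numPlayers : ℕ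
  numActions : Fin numPlayers → ℕ
  numActions_pos : ∀ i, 0 < numActions i
  payoff : Fin numPlayers → (∀ i, Fin (numActions i)) → ℚ

namespace Game

/-- The set of players. -/
abbrev Player (Γ : Game) : Type := Fin Γ.numPlayers

/-- Action profiles. -/
abbrev Profile (Γ : Game) : Type := ∀ i : Γ.Player, Fin (Γ.numActions i)

/-- The disjoint union of the action sets of all players. -/
abbrev Action (Γ : Game) : Type := Σ i : Γ.Player, Fin (Γ.numActions i)

/-- `φ` maps the actions of each player `i` to actions of the player `π i`. -/
def MapsPlayers (Γ : Game) (φ : Equiv.Perm Γ.Action) (π : Equiv.Perm Γ.Player) : Prop :=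
  ∀ a : Γ.Action, (φ a).1 = π a.1

/-- The image of a profile `s`: player `j` plays `φ (s (π⁻¹ j))`. -/
def mapProfile (Γ : Game) {φ : Equiv.Perm Γ.Action} {π : Equiv.Perm Γ.Player}
    (h : Γ.MapsPlayers φ π) (s : Γ.Profile) : Γ.Profile := fun j =>
  Fin.cast (congrArg Γ.numActions ((h ⟨π.symm j, s (π.symm j)⟩).trans (π.apply_symm_apply j)))
    (φ ⟨π.symm j, s (π.symm j)⟩).2

theorem mapProfile_spec (Γ : Game) {φ : Equiv.Perm Γ.Action} {π : Equiv.Perm Γ.Player}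
    (h : Γ.MapsPlayers φ π) (s : Γ.Profile) (j : Γ.Player) :
    (⟨j, Γ.mapProfile h s j⟩ : Γ.Action) = φ ⟨π.symm j, s (π.symm j)⟩ := by
  have e : (φ ⟨π.symm j, s (π.symm j)⟩).1 = j :=
    (h ⟨π.symm j, s (π.symm j)⟩).trans (π.apply_symm_apply j)
  refine Sigma.ext e.symm ?_
  simp only [mapProfile]
  exact (Fin.heq_ext_iff (congrArg Γ.numActions e.symm)).2 rfl

/-- `φ` is a symmetry of the game, and `π` is the player permutation it induces. -/
def IsSymmetryInducing (Γ : Game) (φ : Equiv.Perm Γ.Action) (π : Equiv.Perm Γ.Player) : Prop :=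
  ∃ h : Γ.MapsPlayers φ π,
    ∀ (i : Γ.Player) (s : Γ.Profile), Γ.payoff i s = Γ.payoff (π i) (Γ.mapProfile h s)

/-- The player permutation `π` is induced by some symmetry of the game. -/
def Induced (Γ : Game) (π : Equiv.Perm Γ.Player) : Prop :=
  ∃ φ : Equiv.Perm Γ.Action, Γ.IsSymmetryInducing φ π

def AllPlayerPermsInduced (Γ : Game) : Prop := ∀ π : Equiv.Perm Γ.Player, Γ.Induced π

def IsTwoPlayerZeroSum (Γ : Game) : Prop :=
  Γ.numPlayers = 2 ∧ ∀ s : Γ.Profile, ∑ i, Γ.payoff i s = 0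

/-- The pairs `(i, j)` of players with `i < j`, that is, the transpositions of the player set. -/
def transpositions (Γ : Game) : List (Γ.Player × Γ.Player) :=
  (List.finRange Γ.numPlayers).flatMap fun i =>
    ((List.finRange Γ.numPlayers).filter fun j => i < j).map fun j => (i, j)

/-- All profiles for the given numbers of actions, in lexicographic order. -/
def allProfiles : (N : ℕ) → (m : Fin N → ℕ) → List (∀ i, Fin (m i))
  | 0, _ => [fun i => i.elim0]
  | N + 1, m => (List.finRange (m 0)).flatMap fun a =>
      (allProfiles N fun i => m i.succ).map fun s => Fin.cons a s

theorem mem_allProfiles : ∀ (N : ℕ) (m : Fin N → ℕ) (s : ∀ i, Fin (m i)), s ∈ allProfiles N m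
  | 0, m, s => by
      simp only [allProfiles, List.mem_singleton]
      exact funext fun i => i.elim0
  | N + 1, m, s => by
      simp only [allProfiles, List.mem_flatMap, List.mem_map]
      exact ⟨s 0, List.mem_finRange _, Fin.tail s, mem_allProfiles N _ _, Fin.cons_self_tail s⟩

/-- The game in explicit form: the number of players and their numbers of actions, then the table
of the payoffs of all players at all profiles. -/
def encode (Γ : Game) : List Γ' :=
  encodeUnary Γ.numPlayers ++
    (List.finRange Γ.numPlayers).flatMap (fun i => encodeUnary (Γ.numActions i)) ++
    (allProfiles Γ.numPlayers Γ.numActions).flatMap fun s =>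
      (List.finRange Γ.numPlayers).flatMap fun i => encodeRat (Γ.payoff i s)

theorem encode_injective : Function.Injective encode := by
  rintro ⟨N, m, hm, u⟩ ⟨N', m', hm', u'⟩ h
  simp only [encode, List.append_assoc] at h
  obtain ⟨h1, h⟩ := encodeUnary_selfDelimiting _ _ _ _ h
  subst h1
  obtain ⟨h1, h⟩ := flatMap_selfDelimiting encodeUnary_selfDelimiting m m' _ _ _ h
  have h1 : m = m' := funext fun i => h1 i (List.mem_finRange i)
  subst h1
  have hr : SelfDelimiting (fun r : Fin N → ℚ =>
      (List.finRange N).flatMap fun i => encodeRat (r i)) := by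
    intro x y s t h
    obtain ⟨h1, h2⟩ := flatMap_selfDelimiting encodeRat_selfDelimiting x y _ s t h
    exact ⟨funext fun i => h1 i (List.mem_finRange i), h2⟩
  obtain ⟨h1, -⟩ := flatMap_selfDelimiting hr (fun s i => u i s) (fun s i => u' i s)
    (allProfiles N m) [] [] (by simpa using h)
  have h1 : u = u' := funext fun i => funext fun s => congrFun (h1 s (mem_allProfiles N m s)) i
  subst h1
  rfl

end Game

/-- Given a game, is every player permutation induced by some symmetry of the game? -/
def allPlayerPermsInduced : DecisionProblem where
  Instance := Game
  Symbol := Γ'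
  symbolFintype := inferInstance
  encode := Game.encode
  encode_injective := Game.encode_injective
  Yes := Game.AllPlayerPermsInduced

/-- The same problem, restricted to two-player zero-sum games. -/
def allPlayerPermsInducedTwoPlayerZeroSum : DecisionProblem where
  Instance := {Γ : Game // Γ.IsTwoPlayerZeroSum}
  Symbol := Γ'
  symbolFintype := inferInstance
  encode Γ := Γ.1.encode
  encode_injective := fun _ _ h => Subtype.ext (Game.encode_injective h)
  Yes Γ := Γ.1.AllPlayerPermsInduced

end GameSym

end

/-! Hardness. For graphs `G`, `H`, let both players choose a vertex of either graph or one further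
action, which keeps the action sets nonempty. The first player's payoff matrix is block diagonal: on
the block of `G` it is 1 for edges, 2 on the diagonal and 3 for the remaining pairs; the block of
`H` is the same with opposite sign; all other entries are 0. A symmetry that exchanges the players
gives maps with `M x y = -M (κ y) (ρ x)`. Diagonal entries 2 can only go to diagonal entries -2, so
`κ` and `ρ` agree on the vertices of `G` and map them to vertices of `H`, and the entries ±1 carry
edges to edges (`nonempty_iso_of_matrix`). Conversely an isomorphism together with its inverse gives
a symmetry. With two players, only the identity and this transposition have to be induced, and the
identity always is.

Restricted isomorphism. Induced permutations are closed under composition, so the transpositions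
suffice. A game becomes a graph on players, actions, profiles and cells `(k, s', l)`. Actions are
joined to their player and to the profiles that contain them; a profile `s` is joined to `(k, s',
l)` if `u_k(s) = u_l(s')`. Thus the table position `(s', l)` stands for a payoff value, and the
index `k` for the player who receives it. A permutation `π` is induced if and only if some
automorphism sends each player `k` to `π k` and each cell `(k, s', l)` to `(π k, s', l)`
(`induced_iff_exists_perm`). Since the prescribed images do not depend on the symmetry, this is an
instance of restricted graph isomorphism.

Membership in GI. All pairs of players are treated at once by disjoint copies of this graph. Colours
name the copy and, within it, each pinned vertex; the target graph colours a vertex by its image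
under the transposition, so colour-preserving isomorphisms are families of solutions of the
restricted instances (`copies_color_iff`). Colours are then encoded by numbers of leaves
(`leafGraph_iso_iff`).

Polynomial time. Structured stack programs are compiled to Turing machines (`Run.stepsTo`). The
functions that they compute in polynomial time form a class `PT`, closed under substitution and
bounded recursion, hence under unary arithmetic, bounded quantifiers and loops, and every
construction is written in these terms. The explicit payoff table makes the number of profiles at
most the input length. Hardness also needs transitivity of reductions, obtained by running two
arbitrary machines in sequence (`PolyTimeComputable.comp`). -/

noncomputable section

namespace GameSym

open Computability Turing Function

/-! ## Structured stack programs and their compilation to Turing machines -/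

/-- Exactly `n` steps of the transition function `f` lead from `a` to `b`. -/
def StepsTo {σ : Type*} (f : σ → Option σ) (n : ℕ) (a b : σ) : Prop :=
  (flip bind f)^[n] (some a) = some b

theorem StepsTo.single {σ : Type*} {f : σ → Option σ} {a b : σ} (h : f a = some b) :
    StepsTo f 1 a b := h

theorem StepsTo.refl {σ : Type*} (f : σ → Option σ) (a : σ) : StepsTo f 0 a a := rfl

theorem StepsTo.trans {σ : Type*} {f : σ → Option σ} {m n : ℕ} {a b c : σ}
    (h₁ : StepsTo f m a b) (h₂ : StepsTo f n b c) : StepsTo f (m + n) a c := by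
  unfold StepsTo at *
  rw [add_comm, iterate_add_apply, h₁, h₂]

/-- Programs acting on stacks of symbols indexed by natural numbers. -/
inductive Prog
  | skip
  | push (k : ℕ) (c : Γ')
  | pop (k : ℕ)
  | seq (p q : Prog)
  | cas (k : ℕ) (br : Option Γ' → Prog)
  | loop (k : ℕ) (p : Prog)

/-- The contents of all stacks. -/
abbrev Store : Type := ℕ → List Γ'

/-- `Run p s s' t`: started on `s`, the program `p` stops after `t` steps with the stacks `s'`. -/
inductive Run : Prog → Store → Store → ℕ → Prop
  | skip (s) : Run .skip s s 1
  | push (k c s) : Run (.push k c) s (update s k (c :: s k)) 1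
  | pop (k s) : Run (.pop k) s (update s k (s k).tail) 1
  | seq {p q s s' s'' t t'} : Run p s s' t → Run q s' s'' t' → Run (.seq p q) s s'' (t + t')
  | cas {k br s s' t} : Run (br (s k).head?) s s' t → Run (.cas k br) s s' (1 + t)
  | loopNil {k p s} : s k = [] → Run (.loop k p) s s 1
  | loopCons {k p s s' s'' t t'} : s k ≠ [] → Run p s s' t → Run (.loop k p) s' s'' t' →
      Run (.loop k p) s s'' (1 + t + t')

/-- All stacks used by the program have an index below `n`. -/
def Prog.Below (n : ℕ) : Prog → Prop
  | .skip => True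
  | .push k _ => k < n
  | .pop k => k < n
  | .seq p q => p.Below n ∧ q.Below n
  | .cas k br => k < n ∧ ∀ o, (br o).Below n
  | .loop k p => k < n ∧ p.Below n

theorem Prog.Below.mono {n m : ℕ} (h : n ≤ m) : ∀ {p : Prog}, p.Below n → p.Below m
  | .skip, _ => trivial
  | .push _ _, hp => lt_of_lt_of_le hp h
  | .pop _, hp => lt_of_lt_of_le hp h
  | .seq _ _, hp => ⟨hp.1.mono h, hp.2.mono h⟩
  | .cas _ _, hp => ⟨lt_of_lt_of_le hp.1 h, fun o => (hp.2 o).mono h⟩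
  | .loop _ _, hp => ⟨lt_of_lt_of_le hp.1 h, hp.2.mono h⟩

/-- A machine has finitely many stacks, so a program must be confined to an initial segment of the
stack indices before it is compiled. -/
theorem Prog.exists_below (p : Prog) : ∃ n, p.Below n := by
  induction p with
  | skip => exact ⟨0, trivial⟩
  | push k c => exact ⟨k + 1, k.lt_succ_self⟩
  | pop k => exact ⟨k + 1, k.lt_succ_self⟩
  | seq p q hp hq =>
    obtain ⟨n, hn⟩ := hp
    obtain ⟨m, hm⟩ := hq
    exact ⟨max n m, hn.mono (le_max_left _ _), hm.mono (le_max_right _ _)⟩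
  | cas k br ih =>
    choose n hn using ih
    exact ⟨max (k + 1) (Finset.univ.sup n), lt_of_lt_of_le k.lt_succ_self (le_max_left _ _),
      fun o => (hn o).mono ((Finset.le_sup (Finset.mem_univ o)).trans (le_max_right _ _))⟩
  | loop k p hp =>
    obtain ⟨n, hn⟩ := hp
    exact ⟨max (k + 1) n, lt_of_lt_of_le k.lt_succ_self (le_max_left _ _),
      hn.mono (le_max_right _ _)⟩

/-- The control points of a program. -/
def Prog.Label : Prog → Type
  | .skip => Unit
  | .push _ _ => Unit
  | .pop _ => Unit
  | .seq p q => p.Label ⊕ q.Label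
  | .cas _ br => Option (Σ o, (br o).Label)
  | .loop _ p => Option p.Label

/-- The control point where a program starts. -/
def Prog.start : (p : Prog) → p.Label
  | .skip => ()
  | .push _ _ => ()
  | .pop _ => ()
  | .seq p _ => Sum.inl p.start
  | .cas _ _ => none
  | .loop _ _ => none

@[reducible] def Prog.labelFintype : (p : Prog) → Fintype p.Label
  | .skip => inferInstanceAs (Fintype Unit)
  | .push _ _ => inferInstanceAs (Fintype Unit)
  | .pop _ => inferInstanceAs (Fintype Unit)
  | .seq p q =>
    haveI := p.labelFintype
    haveI := q.labelFintype
    inferInstanceAs (Fintype (p.Label ⊕ q.Label))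
  | .cas _ br =>
    haveI := fun o => (br o).labelFintype
    inferInstanceAs (Fintype (Option (Σ o, (br o).Label)))
  | .loop _ p =>
    haveI := p.labelFintype
    inferInstanceAs (Fintype (Option p.Label))

/-- Statements of the machines that run programs on the stacks `0, …, n`. -/
abbrev ProgStmt (n : ℕ) (L : Type) : Type :=
  TM2.Stmt (fun _ : Fin (n + 1) => Γ') L (Option Γ')

/-- The machine statements of a program, with its control points renamed by `emb` and continuing
at `exit`. -/
def Prog.code (n : ℕ) {L : Type} :
    (p : Prog) → (emb : p.Label → L) → (exit : L) → p.Label → ProgStmt n L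
  | .skip, _, exit, _ => .goto fun _ => exit
  | .push k c, _, exit, _ => .push (Fin.ofNat (n + 1) k) (fun _ => c) (.goto fun _ => exit)
  | .pop k, _, exit, _ => .pop (Fin.ofNat (n + 1) k) (fun v _ => v) (.goto fun _ => exit)
  | .seq p q, emb, exit, l => match l with
    | Sum.inl l => p.code n (fun x => emb (Sum.inl x)) (emb (Sum.inr q.start)) l
    | Sum.inr l => q.code n (fun x => emb (Sum.inr x)) exit l
  | .cas k br, emb, exit, l => match l with
    | none => .peek (Fin.ofNat (n + 1) k) (fun _ o => o) (.goto fun v => emb (some ⟨v, (br v).start⟩))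
    | some ⟨o, l⟩ => (br o).code n (fun x => emb (some ⟨o, x⟩)) exit l
  | .loop k p, emb, exit, l => match l with
    | none => .peek (Fin.ofNat (n + 1) k) (fun _ o => o)
        (.goto fun v => if v.isSome then emb (some p.start) else exit)
    | some l => p.code n (fun x => emb (some x)) (emb none) l

/-- `Fin.ofNat` reduces modulo `n + 1`. For `k < n + 1` no two stacks are identified, so restriction
to the first `n + 1` stacks commutes with updates. -/
theorem update_comp_val {n k : ℕ} (hk : k < n + 1) (s : Store) (l : List Γ') :
    (fun i : Fin (n + 1) => update s k l i) =
      update (fun i : Fin (n + 1) => s i) (Fin.ofNat (n + 1) k) l := by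
  funext i
  by_cases h : (i : ℕ) = k
  · subst h
    simp
  · rw [update_of_ne h, update_of_ne]
    rintro rfl
    exact h (by simp [Nat.mod_eq_of_lt hk])

/-- The costs in `Run` are chosen to equal the numbers of machine transitions, so the simulation is
exact. The final register `v'` is unspecified because tests and pops leave the last symbol there. -/
theorem Run.stepsTo {n : ℕ} {L : Type} {M : L → ProgStmt n L} {p : Prog} {s s' : Store} {t : ℕ}
    (h : Run p s s' t) (hp : p.Below (n + 1)) (emb : p.Label → L) (exit : L)
    (hM : ∀ l, M (emb l) = p.code n emb exit l) (v : Option Γ') :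
    ∃ v', StepsTo (TM2.step M) t ⟨some (emb p.start), v, fun i => s i⟩
      ⟨some exit, v', fun i => s' i⟩ := by
  induction h generalizing exit v with
  | skip s =>
    exact ⟨v, .single (by rw [TM2.step, hM]; rfl)⟩
  | push k c s =>
    refine ⟨v, .single ?_⟩
    rw [TM2.step, hM, update_comp_val hp]
    simp [Prog.code, Nat.mod_eq_of_lt (show k < n + 1 from hp)]
  | pop k s =>
    refine ⟨v, .single ?_⟩
    rw [TM2.step, hM, update_comp_val hp]
    simp [Prog.code, Nat.mod_eq_of_lt (show k < n + 1 from hp)]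
  | seq _ _ ih₁ ih₂ =>
    obtain ⟨v₁, h₁⟩ := ih₁ hp.1 _ _ (fun l => hM (Sum.inl l)) v
    obtain ⟨v₂, h₂⟩ := ih₂ hp.2 _ _ (fun l => hM (Sum.inr l)) v₁
    exact ⟨v₂, h₁.trans h₂⟩
  | @cas k br s s' t _ ih =>
    obtain ⟨v₁, h₁⟩ := ih (hp.2 _) (fun x => emb (some ⟨_, x⟩)) exit
      (fun l => hM (some ⟨_, l⟩)) (s k).head?
    refine ⟨v₁, StepsTo.trans (.single ?_) h₁⟩
    have := hM none
    simp only [Prog.start]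
    rw [TM2.step, this]
    simp [Prog.code, Nat.mod_eq_of_lt (show k < n + 1 from hp.1)]
  | @loopNil k p s hs =>
    refine ⟨none, .single ?_⟩
    have := hM none
    simp only [Prog.start]
    rw [TM2.step, this]
    simp [Prog.code, Nat.mod_eq_of_lt (show k < n + 1 from hp.1), hs]
  | @loopCons k p s s' s'' t t' hs _ _ ih₁ ih₂ =>
    obtain ⟨v₁, h₁⟩ := ih₁ hp.2 (fun x => emb (some x)) (emb none)
      (fun l => hM (some l)) (s k).head?
    obtain ⟨v₂, h₂⟩ := ih₂ hp emb exit hM v₁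
    refine ⟨v₂, StepsTo.trans (StepsTo.trans (.single ?_) h₁) h₂⟩
    have := hM none
    simp only [Prog.start]
    rw [TM2.step, this]
    obtain ⟨c, l, hl⟩ := List.exists_cons_of_ne_nil hs
    simp [Prog.code, Nat.mod_eq_of_lt (show k < n + 1 from hp.1), hl]

/-- The Turing machine that runs a program, with input on stack `0` and output on stack `1`. -/
def Prog.machine (p : Prog) (n : ℕ) : FinTM2 where
  -- At least two stacks, so that input and output stack are different whatever `n` is.
  K := Fin (n + 1 + 1)
  k₀ := 0
  k₁ := 1
  Γ _ := Γ'
  Λ := Option p.Label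
  main := some p.start
  ΛFin := haveI := p.labelFintype; inferInstance
  σ := Option Γ'
  initialState := none
  Γk₀Fin := inferInstanceAs (Fintype Γ')
  m l := match l with
    -- `haltList` requires the initial register value. The exit label restores it in one further
    -- step, which accounts for `t + 1` and `P + 1` below.
    | none => .load (fun _ => none) .halt
    | some l => p.code (n + 1) some none l

theorem polyTimeComputable_of_run {α β : Type} {ea : α → List Γ'} {eb : β → List Γ'} {f : α → β}
    (p : Prog) (P : Polynomial ℕ)
    (h : ∀ x, ∃ t ≤ P.eval (ea x).length,
      Run p (update (fun _ => []) 0 (ea x)) (update (fun _ => []) 1 (eb (f x))) t) :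
    PolyTimeComputable ea eb f := by
  obtain ⟨n, hn⟩ := p.exists_below
  refine ⟨{ tm := p.machine n, inputAlphabet := Equiv.refl _, outputAlphabet := Equiv.refl _,
            time := P + 1, outputsFun := fun x => ?_ }⟩
  have h' : ∃ t ≤ P.eval (ea x).length, StepsTo (p.machine n).step (t + 1)
      (initList (p.machine n) (ea x)) (haltList (p.machine n) (eb (f x))) := by
    obtain ⟨t, ht, hr⟩ := h x
    refine ⟨t, ht, ?_⟩
    obtain ⟨v, hv⟩ := hr.stepsTo (M := (p.machine n).m) (hn.mono (by omega : n ≤ n + 1 + 1))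
      some none (fun _ => rfl) none
    have h₁ : (⟨some (some p.start), none, fun i => update (fun _ => []) 0 (ea x) (i : ℕ)⟩ :
        TM2.Cfg (fun _ : Fin (n + 1 + 1) => Γ') (Option p.Label) (Option Γ')) =
        initList (p.machine n) (ea x) := by
      simp only [initList, Prog.machine]
      congr 1
      funext i
      by_cases hi : i = 0
      · subst hi; simp; rfl
      · have : (i : ℕ) ≠ 0 := fun hh => hi (Fin.ext hh)
        simp [hi, this]
    have h₂ : (⟨none, none, fun i => update (fun _ => []) 1 (eb (f x)) (i : ℕ)⟩ :
        TM2.Cfg (fun _ : Fin (n + 1 + 1) => Γ') (Option p.Label) (Option Γ')) =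
        haltList (p.machine n) (eb (f x)) := by
      simp only [haltList, Prog.machine]
      congr 1
      funext i
      by_cases hi : i = 1
      · subst hi; simp; rfl
      · have : (i : ℕ) ≠ 1 := fun hh => hi (Fin.ext hh)
        simp [hi, this]
    rw [← h₁, ← h₂]
    exact hv.trans (.single rfl)
  refine Classical.choice ?_
  obtain ⟨t, ht, hs⟩ := h'
  refine ⟨⟨⟨t + 1, ?_⟩, by simpa using ht⟩⟩
  have e : ∀ l : List Γ', l.map (Equiv.refl Γ').invFun = l := fun l => List.map_id l
  simp only [Prog.machine] at e ⊢
  rw [e, e]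
  exact hs

end GameSym
end

noncomputable section

namespace GameSym

open Computability Turing Function

/-! ## Composition of polynomial-time computations -/

/-- Only defined steps of `f` have to be matched. Hence `e` may send a halted configuration to one
from which `g` continues, as is needed to run one machine after another. -/
theorem StepsTo.map {σ τ : Type*} {f : σ → Option σ} {g : τ → Option τ} (e : σ → τ)
    (h : ∀ a b, f a = some b → g (e a) = some (e b)) {n : ℕ} {a b : σ} (hab : StepsTo f n a b) :
    StepsTo g n (e a) (e b) := by
  induction n generalizing a with
  | zero =>
    cases hab
    exact .refl _ _
  | succ n ih =>
    unfold StepsTo at hab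
    rw [iterate_succ_apply] at hab
    cases hfa : f a with
    | none =>
      have : (flip bind f) (some a) = none := hfa
      rw [this] at hab
      have hn : ∀ n, (flip bind f)^[n] none = none := fun n => by
        induction n with
        | zero => rfl
        | succ n ih => rw [iterate_succ_apply]; exact ih
      rw [hn] at hab
      cases hab
    | some a' =>
      have : (flip bind f) (some a) = some a' := hfa
      rw [this] at hab
      rw [add_comm]
      exact StepsTo.trans (.single (h _ _ hfa)) (ih hab)

theorem StepsTo.bound {σ : Type*} {f : σ → Option σ} (φ : σ → ℕ) (c : ℕ)
    (h : ∀ a b, f a = some b → φ b ≤ φ a + c) {n : ℕ} {a b : σ} (hab : StepsTo f n a b) :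
    φ b ≤ φ a + n * c := by
  induction n generalizing b with
  | zero =>
    cases hab
    simp
  | succ n ih =>
    unfold StepsTo at hab
    rw [iterate_succ_apply'] at hab
    cases hfa : (flip bind f)^[n] (some a) with
    | none => rw [hfa] at hab; cases hab
    | some a' =>
      rw [hfa] at hab
      have h₁ := h a' b hab
      have h₂ := ih hfa
      rw [Nat.succ_mul]
      omega

/-- The number of push instructions in a statement. -/
def pushCount {K : Type*} {Γ : K → Type*} {Λ σ : Type*} : TM2.Stmt Γ Λ σ → ℕ
  | .push _ _ q => pushCount q + 1
  | .peek _ _ q => pushCount q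
  | .pop _ _ q => pushCount q
  | .load _ q => pushCount q
  | .branch _ q r => pushCount q + pushCount r
  | .goto _ => 0
  | .halt => 0

theorem length_stepAux_le {K : Type*} [DecidableEq K] {Γ : K → Type*} {Λ σ : Type*} (k : K)
    (q : TM2.Stmt Γ Λ σ) (v : σ) (S : ∀ k, List (Γ k)) :
    ((TM2.stepAux q v S).stk k).length ≤ (S k).length + pushCount q := by
  induction q generalizing v S with
  | push k' f q ih =>
    refine (ih _ _).trans ?_
    by_cases h : k = k'
    · subst h; simp [pushCount]; omega
    · rw [update_of_ne h]; simp [pushCount]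
  | peek k' f q ih => exact ih _ _
  | pop k' f q ih =>
    refine (ih _ _).trans ?_
    by_cases h : k = k'
    · subst h; simp [pushCount]
    · rw [update_of_ne h]; simp [pushCount]
  | load f q ih => exact ih _ _
  | branch f q r ihq ihr =>
    simp only [TM2.stepAux, pushCount]
    cases f v
    · exact (ihr _ _).trans (by omega)
    · exact (ihq _ _).trans (by omega)
  | goto f => simp [pushCount]
  | halt => simp [pushCount]

/-- There are finitely many labels, so the number of pushes per step is bounded. With
`StepsTo.bound` the output length is then bounded in terms of input length and running time. -/
theorem exists_length_step_le (tm : FinTM2) (k : tm.K) : ∃ c, ∀ a b, tm.step a = some b →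
    (b.stk k).length ≤ (a.stk k).length + c := by
  have := tm.ΛFin
  refine ⟨Finset.univ.sup fun l => pushCount (tm.m l), ?_⟩
  rintro ⟨_ | l, v, S⟩ b h
  · cases h
  · cases h
    exact (length_stepAux_le k _ _ _).trans
      (Nat.add_le_add_left (Finset.le_sup (f := fun l => pushCount (tm.m l)) (Finset.mem_univ l)) _)

theorem polynomial_eval_mono (P : Polynomial ℕ) : Monotone fun n => P.eval n := by
  intro a b hab
  simp only [Polynomial.eval_eq_sum]
  exact Finset.sum_le_sum fun i _ => Nat.mul_le_mul_left _ (Nat.pow_le_pow_left hab i)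

namespace TMComp

variable (M N : FinTM2)

/-- Stack alphabets of the composed machine; the extra stack is used for copying. -/
abbrev Alph : Option (M.K ⊕ N.K) → Type
  | none => N.Γ N.k₀
  | some (Sum.inl k) => M.Γ k
  | some (Sum.inr k) => N.Γ k

/-- The Boolean labels are the two copying phases: `false` moves the output of `M` to the extra
stack, `true` moves it on to the input of `N`. The two reversals cancel. -/
abbrev Lab : Type := M.Λ ⊕ Bool ⊕ N.Λ

abbrev State : Type := M.σ × N.σ × Option (N.Γ N.k₀)

variable {M N}

def liftFst : TM2.Stmt M.Γ M.Λ M.σ → TM2.Stmt (Alph M N) (Lab M N) (State M N)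
  | .push k f q => .push (some (Sum.inl k)) (fun v => f v.1) (liftFst q)
  | .peek k f q => .peek (some (Sum.inl k)) (fun v o => (f v.1 o, v.2)) (liftFst q)
  | .pop k f q => .pop (some (Sum.inl k)) (fun v o => (f v.1 o, v.2)) (liftFst q)
  | .load f q => .load (fun v => (f v.1, v.2)) (liftFst q)
  | .branch f q r => .branch (fun v => f v.1) (liftFst q) (liftFst r)
  | .goto f => .goto fun v => Sum.inl (f v.1)
  | .halt => .goto fun _ => Sum.inr (Sum.inl false)

def liftSnd : TM2.Stmt N.Γ N.Λ N.σ → TM2.Stmt (Alph M N) (Lab M N) (State M N)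
  | .push k f q => .push (some (Sum.inr k)) (fun v => f v.2.1) (liftSnd q)
  | .peek k f q => .peek (some (Sum.inr k)) (fun v o => (v.1, f v.2.1 o, v.2.2)) (liftSnd q)
  | .pop k f q => .pop (some (Sum.inr k)) (fun v o => (v.1, f v.2.1 o, v.2.2)) (liftSnd q)
  | .load f q => .load (fun v => (v.1, f v.2.1, v.2.2)) (liftSnd q)
  | .branch f q r => .branch (fun v => f v.2.1) (liftSnd q) (liftSnd r)
  | .goto f => .goto fun v => Sum.inr (Sum.inr (f v.2.1))
  | .halt => .halt

/-- Joint stack contents. -/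
def join (S : ∀ k, List (M.Γ k)) (T : ∀ k, List (N.Γ k)) (l : List (N.Γ N.k₀)) :
    ∀ k, List (Alph M N k)
  | none => l
  | some (Sum.inl k) => S k
  | some (Sum.inr k) => T k

variable (S : ∀ k, List (M.Γ k)) (T : ∀ k, List (N.Γ k)) (l : List (N.Γ N.k₀))

theorem update_join_fst (k : M.K) (x : List (M.Γ k)) :
    update (join S T l) (some (Sum.inl k)) x = join (update S k x) T l := by
  funext i
  rcases i with _ | i | i
  · exact update_of_ne (by simp) _ _
  · by_cases h : i = k
    · subst h
      exact (update_self (some (Sum.inl i)) _ _).trans (update_self i x S).symm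
    · have h₁ : update S k x i = S i := update_of_ne h x S
      exact (update_of_ne (by simpa using h) _ _).trans h₁.symm
  · exact update_of_ne (by simp) _ _

theorem update_join_snd (k : N.K) (x : List (N.Γ k)) :
    update (join S T l) (some (Sum.inr k)) x = join S (update T k x) l := by
  funext i
  rcases i with _ | i | i
  · exact update_of_ne (by simp) _ _
  · exact update_of_ne (by simp) _ _
  · by_cases h : i = k
    · subst h
      exact (update_self (some (Sum.inr i)) _ _).trans (update_self i x T).symm
    · have h₁ : update T k x i = T i := update_of_ne h x T
      exact (update_of_ne (by simpa using h) _ _).trans h₁.symm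

theorem update_join_none (x : List (N.Γ N.k₀)) :
    update (join S T l) none x = join S T x := by
  funext i
  rcases i with _ | i | i
  · exact update_self none _ _
  · exact update_of_ne (by simp) _ _
  · exact update_of_ne (by simp) _ _

/-- A halted configuration of `M` is read as the beginning of the copying phase. -/
def embFst (T : ∀ k, List (N.Γ k)) (l : List (N.Γ N.k₀)) (w : N.σ × Option (N.Γ N.k₀))
    (c : TM2.Cfg M.Γ M.Λ M.σ) : TM2.Cfg (Alph M N) (Lab M N) (State M N) :=
  ⟨some (c.l.elim (Sum.inr (Sum.inl false)) Sum.inl), (c.var, w), join c.stk T l⟩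

def embSnd (S : ∀ k, List (M.Γ k)) (l : List (N.Γ N.k₀)) (v : M.σ) (o : Option (N.Γ N.k₀))
    (c : TM2.Cfg N.Γ N.Λ N.σ) : TM2.Cfg (Alph M N) (Lab M N) (State M N) :=
  ⟨c.l.map fun x => Sum.inr (Sum.inr x), (v, c.var, o), join S c.stk l⟩

theorem stepAux_liftFst (q : TM2.Stmt M.Γ M.Λ M.σ) (v : M.σ) (w : N.σ × Option (N.Γ N.k₀)) :
    TM2.stepAux (liftFst q) (v, w) (join S T l) = embFst T l w (TM2.stepAux q v S) := by
  induction q generalizing v S with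
  | push k f q ih => simp only [liftFst, TM2.stepAux]; rw [← ih, ← update_join_fst]; rfl
  | peek k f q ih => simp only [liftFst, TM2.stepAux]; rw [← ih]; rfl
  | pop k f q ih => simp only [liftFst, TM2.stepAux]; rw [← ih, ← update_join_fst]; rfl
  | load f q ih => simp only [liftFst, TM2.stepAux]; rw [← ih]
  | branch f q r ihq ihr =>
    simp only [liftFst, TM2.stepAux]
    cases f v
    · exact ihr _ _
    · exact ihq _ _
  | goto f => rfl
  | halt => rfl

theorem stepAux_liftSnd (q : TM2.Stmt N.Γ N.Λ N.σ) (v : M.σ) (w : N.σ) (o : Option (N.Γ N.k₀)) :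
    TM2.stepAux (liftSnd q) (v, w, o) (join S T l) = embSnd S l v o (TM2.stepAux q w T) := by
  induction q generalizing w T with
  | push k f q ih => simp only [liftSnd, TM2.stepAux]; rw [← ih, ← update_join_snd]; rfl
  | peek k f q ih => simp only [liftSnd, TM2.stepAux]; rw [← ih]; rfl
  | pop k f q ih => simp only [liftSnd, TM2.stepAux]; rw [← ih, ← update_join_snd]; rfl
  | load f q ih => simp only [liftSnd, TM2.stepAux]; rw [← ih]
  | branch f q r ihq ihr =>
    simp only [liftSnd, TM2.stepAux]
    cases f w
    · exact ihr _ _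
    · exact ihq _ _
  | goto f => rfl
  | halt => rfl

variable (M N) in
/-- Run `M`, move its output through the extra stack to the input stack of `N`, run `N`. -/
def comp (e : M.Γ M.k₁ → N.Γ N.k₀) (d : N.Γ N.k₀) : FinTM2 where
  K := Option (M.K ⊕ N.K)
  kFin := haveI := M.kFin; haveI := N.kFin; inferInstance
  k₀ := some (Sum.inl M.k₀)
  k₁ := some (Sum.inr N.k₁)
  Γ := Alph M N
  Λ := Lab M N
  main := Sum.inl M.main
  ΛFin := haveI := M.ΛFin; haveI := N.ΛFin; inferInstance
  σ := State M N
  initialState := (M.initialState, N.initialState, none)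
  σFin := haveI := M.σFin; haveI := N.σFin; haveI := N.Γk₀Fin; inferInstance
  Γk₀Fin := M.Γk₀Fin
  m
    | Sum.inl x => liftFst (M.m x)
    | Sum.inr (Sum.inl false) =>
      .pop (some (Sum.inl M.k₁)) (fun v o => (v.1, v.2.1, o.map e))
        (.branch (fun v => v.2.2.isSome)
          (.push none (fun v => v.2.2.getD d) (.goto fun _ => Sum.inr (Sum.inl false)))
          (.goto fun _ => Sum.inr (Sum.inl true)))
    | Sum.inr (Sum.inl true) =>
      .pop none (fun v o => (v.1, v.2.1, o))
        (.branch (fun v => v.2.2.isSome)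
          (.push (some (Sum.inr N.k₀)) (fun v => v.2.2.getD d)
            (.goto fun _ => Sum.inr (Sum.inl true)))
          (.goto fun _ => Sum.inr (Sum.inr N.main)))
    | Sum.inr (Sum.inr x) => liftSnd (N.m x)

variable (e : M.Γ M.k₁ → N.Γ N.k₀) (d : N.Γ N.k₀)

theorem stepsTo_fst {n : ℕ} {a b : M.Cfg} (h : StepsTo M.step n a b)
    (w : N.σ × Option (N.Γ N.k₀)) :
    StepsTo (comp M N e d).step n (embFst T l w a) (embFst T l w b) := by
  refine h.map (embFst T l w) ?_
  rintro ⟨_ | x, v, S⟩ b h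
  · cases h
  · cases h
    exact congrArg some (stepAux_liftFst S T l _ v w)

theorem stepsTo_snd {n : ℕ} {a b : N.Cfg} (h : StepsTo N.step n a b) (v : M.σ)
    (o : Option (N.Γ N.k₀)) :
    StepsTo (comp M N e d).step n (embSnd S l v o a) (embSnd S l v o b) := by
  refine h.map (embSnd S l v o) ?_
  rintro ⟨_ | x, w, T⟩ b h
  · cases h
  · cases h
    exact congrArg some (stepAux_liftSnd S T l _ v w o)

theorem step_unload (v : M.σ) (w : N.σ) (o : Option (N.Γ N.k₀)) :
    (comp M N e d).step ⟨some (Sum.inr (Sum.inl false)), (v, w, o), join S T l⟩ =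
      some (bif ((S M.k₁).head?.map e).isSome then
        ⟨some (Sum.inr (Sum.inl false)), (v, w, (S M.k₁).head?.map e),
          join (update S M.k₁ (S M.k₁).tail) T (((S M.k₁).head?.map e).getD d :: l)⟩
      else
        ⟨some (Sum.inr (Sum.inl true)), (v, w, (S M.k₁).head?.map e),
          join (update S M.k₁ (S M.k₁).tail) T l⟩) := by
  rw [← update_join_none (update S M.k₁ (S M.k₁).tail) T l (_ :: _), ← update_join_fst]
  rfl

theorem step_load (v : M.σ) (w : N.σ) (o : Option (N.Γ N.k₀)) :
    (comp M N e d).step ⟨some (Sum.inr (Sum.inl true)), (v, w, o), join S T l⟩ =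
      some (bif l.head?.isSome then
        ⟨some (Sum.inr (Sum.inl true)), (v, w, l.head?),
          join S (update T N.k₀ (l.head?.getD d :: T N.k₀)) l.tail⟩
      else
        ⟨some (Sum.inr (Sum.inr N.main)), (v, w, l.head?), join S T l.tail⟩) := by
  rw [← update_join_snd S T l.tail, ← update_join_none S T l l.tail]
  rfl

theorem stepsTo_unload (v : M.σ) (w : N.σ) (o : Option (N.Γ N.k₀)) (x : List (M.Γ M.k₁)) :
    StepsTo (comp M N e d).step (x.length + 1)
      ⟨some (Sum.inr (Sum.inl false)), (v, w, o), join (update S M.k₁ x) T l⟩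
      ⟨some (Sum.inr (Sum.inl true)), (v, w, none),
        join (update S M.k₁ []) T ((x.map e).reverse ++ l)⟩ := by
  induction x generalizing o l with
  | nil =>
    refine .single ?_
    rw [step_unload]
    simp
    rfl
  | cons c x ih =>
    rw [List.length_cons, add_comm]
    refine StepsTo.trans (.single ?_) (by simpa using ih (e c :: l) (some (e c)))
    rw [step_unload]
    simp
    rfl

theorem stepsTo_load (v : M.σ) (w : N.σ) (o : Option (N.Γ N.k₀)) (x y : List (N.Γ N.k₀)) :
    StepsTo (comp M N e d).step (x.length + 1)
      ⟨some (Sum.inr (Sum.inl true)), (v, w, o), join S (update T N.k₀ y) x⟩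
      ⟨some (Sum.inr (Sum.inr N.main)), (v, w, none),
        join S (update T N.k₀ (x.reverse ++ y)) []⟩ := by
  induction x generalizing o y with
  | nil =>
    refine .single ?_
    rw [step_load]
    simp
    rfl
  | cons c x ih =>
    rw [List.length_cons, add_comm]
    refine StepsTo.trans (.single ?_) (by simpa using ih (some c) (c :: y))
    rw [step_load]
    simp
    rfl

end TMComp

theorem initList_eq (tm : FinTM2) (x : List (tm.Γ tm.k₀)) : initList tm x =
    (⟨some tm.main, tm.initialState, update (fun _ => []) tm.k₀ x⟩ :
      TM2.Cfg tm.Γ tm.Λ tm.σ) := by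
  unfold initList
  congr 1
  funext k
  by_cases h : k = tm.k₀
  · subst h; simp
  · simp [h]

theorem haltList_eq (tm : FinTM2) (x : List (tm.Γ tm.k₁)) : haltList tm x =
    (⟨none, tm.initialState, update (fun _ => []) tm.k₁ x⟩ :
      TM2.Cfg tm.Γ tm.Λ tm.σ) := by
  unfold haltList
  congr 1
  funext k
  by_cases h : k = tm.k₁
  · subst h; simp
  · simp [h]

/-- The time is that of the first machine, two passes over the intermediate string, and that of the
second machine on a string of length at most `Q`. -/
theorem PolyTimeComputable.comp {α β γ A B C : Type} [Inhabited B] {ea : α → List A}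
    {eb : β → List B} {ec : γ → List C} {f : α → β} {g : β → γ}
    (hg : PolyTimeComputable eb ec g) (hf : PolyTimeComputable ea eb f) :
    PolyTimeComputable ea ec (fun x => g (f x)) := by
  obtain ⟨F⟩ := hf
  obtain ⟨G⟩ := hg
  obtain ⟨c, hc⟩ := exists_length_step_le F.tm F.tm.k₁
  let e : F.tm.Γ F.tm.k₁ → G.tm.Γ G.tm.k₀ := fun z => G.inputAlphabet.symm (F.outputAlphabet z)
  -- A dummy for `Option.getD`; it is never written, since pushes happen only when a symbol was
  -- found.
  let d : G.tm.Γ G.tm.k₀ := G.inputAlphabet.symm default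
  -- The intermediate string is at most as long as the input plus `c` symbols for each step of the
  -- first machine.
  let Q : Polynomial ℕ := Polynomial.X + F.time * Polynomial.C c
  have key : ∀ x, ∃ t ≤ (F.time + (2 * Q + 2) + G.time.comp Q).eval (ea x).length,
      StepsTo (TMComp.comp F.tm G.tm e d).step t
        (initList (TMComp.comp F.tm G.tm e d) ((ea x).map F.inputAlphabet.symm))
        (haltList (TMComp.comp F.tm G.tm e d) ((ec (g (f x))).map G.outputAlphabet.symm)) := by
    intro x
    obtain ⟨⟨t₁, h₁⟩, ht₁⟩ := F.outputsFun x
    obtain ⟨⟨t₂, h₂⟩, ht₂⟩ := G.outputsFun (f x)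
    have h₁ : StepsTo F.tm.step t₁ (initList F.tm ((ea x).map F.inputAlphabet.symm))
      (haltList F.tm ((eb (f x)).map F.outputAlphabet.symm)) := h₁
    have h₂ : StepsTo G.tm.step t₂ (initList G.tm ((eb (f x)).map G.inputAlphabet.symm))
      (haltList G.tm ((ec (g (f x))).map G.outputAlphabet.symm)) := h₂
    have ht₁ : t₁ ≤ F.time.eval (ea x).length := ht₁
    have ht₂ : t₂ ≤ G.time.eval (eb (f x)).length := ht₂
    have hb := h₁.bound (fun a => (a.stk F.tm.k₁).length) c hc
    rw [initList_eq, haltList_eq] at hb h₁ h₂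
    have hlen : (eb (f x)).length ≤ Q.eval (ea x).length := by
      -- The input and output stacks of the first machine may coincide, so the output stack may
      -- initially contain the input.
      have h0 : ((update (fun _ => []) F.tm.k₀ ((ea x).map F.inputAlphabet.symm) :
          ∀ k, List (F.tm.Γ k)) F.tm.k₁).length ≤ (ea x).length := by
        by_cases hk : F.tm.k₁ = F.tm.k₀
        · generalize hy : (ea x).map F.inputAlphabet.symm = y
          have : (ea x).length = y.length := by rw [← hy, List.length_map]
          rw [this]
          revert y
          rw [hk]
          intro y _ _
          simp
        · rw [update_of_ne hk]; simp
      simp only [update_self, List.length_map] at hb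
      simp only [Q, Polynomial.eval_add, Polynomial.eval_X, Polynomial.eval_mul,
        Polynomial.eval_C]
      have := Nat.mul_le_mul_right c ht₁
      omega
    rw [initList_eq, haltList_eq]
    have s₁ := TMComp.stepsTo_fst (fun _ => []) [] e d h₁ (G.tm.initialState, none)
    have s₂ := TMComp.stepsTo_unload (fun _ => []) (fun _ => []) [] e d F.tm.initialState
      G.tm.initialState none ((eb (f x)).map F.outputAlphabet.symm)
    have s₃ := TMComp.stepsTo_load (update (fun _ => []) F.tm.k₁ []) (fun _ => []) e d
      F.tm.initialState G.tm.initialState none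
      (((eb (f x)).map F.outputAlphabet.symm).map e).reverse []
    have s₄ := TMComp.stepsTo_snd (fun _ => []) [] e d h₂ F.tm.initialState none
    have hS : (update (fun _ => []) F.tm.k₁ [] : ∀ k, List (F.tm.Γ k)) = fun _ => [] :=
      update_eq_self _ _
    have hT : (update (fun _ => []) G.tm.k₀ [] : ∀ k, List (G.tm.Γ k)) = fun _ => [] :=
      update_eq_self _ _
    have he : (((eb (f x)).map F.outputAlphabet.symm).map e) =
        (eb (f x)).map G.inputAlphabet.symm := by
      simp [e, Function.comp_def]
    simp only [hS, hT, he, List.append_nil, List.reverse_reverse] at s₂ s₃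
    refine ⟨t₁ + (((eb (f x)).map F.outputAlphabet.symm).length + 1) +
      (((eb (f x)).map G.inputAlphabet.symm).reverse.length + 1) + t₂, ?_, ?_⟩
    · simp only [List.length_map, List.length_reverse, Polynomial.eval_add, Polynomial.eval_mul,
        Polynomial.eval_comp, Polynomial.eval_ofNat]
      have := ht₂.trans (polynomial_eval_mono G.time hlen)
      simp only at this
      omega
    · have s := ((s₁.trans s₂).trans s₃).trans s₄
      have hj : (TMComp.join (fun _ => []) (fun _ => []) [] :
          ∀ k, List (TMComp.Alph F.tm G.tm k)) = fun _ => [] := by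
        funext i
        rcases i with _ | i | i <;> rfl
      simp only [TMComp.embFst, TMComp.embSnd, ← TMComp.update_join_fst,
        ← TMComp.update_join_snd, hj] at s
      exact s
  refine ⟨{ tm := TMComp.comp F.tm G.tm e d, inputAlphabet := F.inputAlphabet,
            outputAlphabet := G.outputAlphabet, time := F.time + (2 * Q + 2) + G.time.comp Q
            outputsFun := fun x => ?_ }⟩
  refine Classical.choice ?_
  obtain ⟨t, ht, hs⟩ := key x
  exact ⟨⟨⟨t, hs⟩, ht⟩⟩

theorem PolyTimeReduces.trans {P Q R : DecisionProblem} [Inhabited Q.Symbol]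
    (h₁ : PolyTimeReduces P Q) (h₂ : PolyTimeReduces Q R) : PolyTimeReduces P R := by
  obtain ⟨f, hf, hf'⟩ := h₁
  obtain ⟨g, hg, hg'⟩ := h₂
  exact ⟨fun x => g (f x), hg.comp hf, fun x => (hf' x).trans (hg' _)⟩

theorem GIHard.of_reduces {P : DecisionProblem} (h : PolyTimeReduces graphIsomorphism P) :
    GIHard P := fun _ hQ =>
  haveI : Inhabited graphIsomorphism.Symbol := inferInstanceAs (Inhabited Γ')
  PolyTimeReduces.trans hQ h

end GameSym
end

noncomputable section

namespace GameSym

open Computability Function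

/-! ## Polynomial-time functions -/

/-- `p` turns the stacks `s` into `s'` in at most `T` steps. -/
def Does (p : Prog) (s s' : Store) (T : ℕ) : Prop := ∃ t ≤ T, Run p s s' t

theorem Does.mono {p : Prog} {s s' : Store} {T T' : ℕ} (h : Does p s s' T) (hT : T ≤ T') :
    Does p s s' T' := by
  obtain ⟨t, ht, hr⟩ := h
  exact ⟨t, ht.trans hT, hr⟩

theorem Does.of_eq {p : Prog} {s s₁ s' : Store} {T T' : ℕ} (h : Does p s s₁ T) (hT : T ≤ T')
    (hs : s₁ = s') : Does p s s' T' := hs ▸ h.mono hT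

theorem Does.seq {p q : Prog} {s s' s'' : Store} {T T' : ℕ} (h : Does p s s' T)
    (h' : Does q s' s'' T') : Does (.seq p q) s s'' (T + T') := by
  obtain ⟨t, ht, hr⟩ := h
  obtain ⟨t', ht', hr'⟩ := h'
  exact ⟨t + t', by omega, hr.seq hr'⟩

theorem Does.push (k : ℕ) (c : Γ') (s : Store) :
    Does (.push k c) s (update s k (c :: s k)) 1 := ⟨1, le_rfl, .push k c s⟩

theorem Does.pop (k : ℕ) (s : Store) : Does (.pop k) s (update s k (s k).tail) 1 :=
  ⟨1, le_rfl, .pop k s⟩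

theorem Does.cas {k : ℕ} {br : Option Γ' → Prog} {s s' : Store} {T : ℕ}
    (h : Does (br (s k).head?) s s' T) : Does (.cas k br) s s' (1 + T) := by
  obtain ⟨t, ht, hr⟩ := h
  exact ⟨1 + t, by omega, .cas hr⟩

theorem Does.loopNil {k : ℕ} {p : Prog} {s : Store} (h : s k = []) : Does (.loop k p) s s 1 :=
  ⟨1, le_rfl, .loopNil h⟩

theorem Does.loopCons {k : ℕ} {p : Prog} {s s' s'' : Store} {T T' : ℕ} (hk : s k ≠ [])
    (h : Does p s s' T) (h' : Does (.loop k p) s' s'' T') :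
    Does (.loop k p) s s'' (1 + T + T') := by
  obtain ⟨t, ht, hr⟩ := h
  obtain ⟨t', ht', hr'⟩ := h'
  exact ⟨1 + t + t', by omega, .loopCons hk hr hr'⟩

namespace Prog

/-- Empty the stack `k`. -/
def clear (k : ℕ) : Prog := .loop k (.pop k)

/-- Move the stack `a` to the stack `b`, reversing it. -/
def move (a b : ℕ) : Prog :=
  .loop a (.cas a fun
    | none => .skip
    | some c => .seq (.pop a) (.push b c))

/-- Move the stack `a` to both stacks `b` and `c`, reversing it. -/
def fork (a b c : ℕ) : Prog :=
  .loop a (.cas a fun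
    | none => .skip
    | some x => .seq (.pop a) (.seq (.push b x) (.push c x)))

/-- Copy the stack `a` to the top of the stack `o` with the help of the empty stack `m`. -/
def copy (a o m : ℕ) : Prog := .seq (move a m) (fork m a o)

/-- Move the stack `a` to the top of the stack `o` with the help of the empty stack `m`. -/
def transfer (a o m : ℕ) : Prog := .seq (move a m) (move m o)

end Prog

theorem does_clear (k : ℕ) (s : Store) :
    Does (Prog.clear k) s (update s k []) (2 * (s k).length + 1) := by
  generalize hl : s k = l
  induction l generalizing s with
  | nil =>
    have : update s k [] = s := by rw [← hl, update_eq_self]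
    rw [this]
    exact (Does.loopNil hl).mono (by simp)
  | cons c l ih =>
    have h := ih (update s k l) (by simp)
    rw [update_idem] at h
    refine (Does.loopCons (by simp [hl]) (Does.pop k s) (by rw [hl]; exact h)).mono ?_
    simp only [List.length_cons]
    omega

theorem does_move {a b : ℕ} (hab : a ≠ b) (s : Store) :
    Does (Prog.move a b) s (update (update s a []) b ((s a).reverse ++ s b))
      (4 * (s a).length + 1) := by
  generalize hl : s a = l
  induction l generalizing s with
  | nil =>
    have : update (update s a []) b ([].reverse ++ s b) = s := by
      rw [← hl]
      funext j
      simp only [update_apply]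
      split_ifs <;> simp_all
    rw [this]
    exact (Does.loopNil hl).mono (by simp)
  | cons c l ih =>
    have h := ih (update (update s a l) b (c :: s b)) (by simp [hab])
    refine (Does.loopCons (by simp [hl]) (s' := update (update s a l) b (c :: s b))
      (Does.cas (T := 2) ?_) h).of_eq ?_ ?_
    · simp only [hl, List.head?_cons]
      convert (Does.pop a s).seq (Does.push b c _) using 2
      · simp [hl]
      · simp [hab.symm]
    · simp only [List.length_cons]
      omega
    · funext j
      simp only [update_apply]
      split_ifs <;> simp_all

theorem does_fork {a b c : ℕ} (hab : a ≠ b) (hac : a ≠ c) (hbc : b ≠ c) (s : Store) :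
    Does (Prog.fork a b c) s
      (update (update (update s a []) b ((s a).reverse ++ s b)) c ((s a).reverse ++ s c))
      (5 * (s a).length + 1) := by
  generalize hl : s a = l
  induction l generalizing s with
  | nil =>
    have : update (update (update s a []) b ([].reverse ++ s b)) c ([].reverse ++ s c) = s := by
      rw [← hl]
      funext j
      simp only [update_apply]
      split_ifs <;> simp_all
    rw [this]
    exact (Does.loopNil hl).mono (by simp)
  | cons x l ih =>
    have h := ih (update (update (update s a l) b (x :: s b)) c (x :: s c)) (by simp [hab, hac])
    refine (Does.loopCons (by simp [hl]) 
      (s' := update (update (update s a l) b (x :: s b)) c (x :: s c)) (Does.cas (T := 3) ?_) h).of_eq ?_ ?_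
    · simp only [hl, List.head?_cons]
      convert (Does.pop a s).seq ((Does.push b x _).seq (Does.push c x _)) using 2
      · simp [hl, hab.symm]
      · simp [hac.symm, hbc.symm]
    · simp only [List.length_cons]
      omega
    · funext j
      simp only [update_apply]
      split_ifs <;> simp_all

theorem does_copy {a o m : ℕ} (hao : a ≠ o) (ham : a ≠ m) (hom : o ≠ m) {s : Store}
    (hm : s m = []) :
    Does (Prog.copy a o m) s (update s o (s a ++ s o)) (9 * (s a).length + 2) := by
  have h := (does_move ham s).seq (does_fork ham.symm hom.symm hao _)
  refine h.of_eq ?_ ?_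
  · simp [hm]
    omega
  · funext j
    simp only [update_apply]
    split_ifs <;> simp_all

theorem does_transfer {a o m : ℕ} (hao : a ≠ o) (ham : a ≠ m) (hom : o ≠ m) {s : Store}
    (hm : s m = []) :
    Does (Prog.transfer a o m) s (update (update s a []) o (s a ++ s o))
      (8 * (s a).length + 2) := by
  have h := (does_move ham s).seq (does_move hom.symm _)
  refine h.of_eq ?_ ?_
  · simp [hm]
    omega
  · funext j
    simp only [update_apply]
    split_ifs <;> simp_all

/-! ### Data on stacks and the class `PT` -/

/-- Types whose elements are written as strings. -/
class Str (β : Type) where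
  str : β → List Γ'

instance : Str (List Γ') := ⟨fun l => l⟩

/-- Numbers are in unary, so polynomial bounds refer to values and arithmetic can be done by
counting. A proposition is a string that is nonempty exactly if it is true, so testing it means
inspecting the head. -/
instance : Str ℕ := ⟨fun n => List.replicate n (Γ'.bit true)⟩

open Classical in
instance : Str Prop := ⟨fun p => if p then [Γ'.bit true] else []⟩

theorem str_list (l : List Γ') : Str.str l = l := rfl

theorem str_nat (n : ℕ) : Str.str n = List.replicate n (Γ'.bit true) := rfl

open Classical in
theorem str_prop (p : Prop) : Str.str p = if p then [Γ'.bit true] else [] := rfl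

/-- Types whose elements are stored on a family of stacks. -/
class Data (α : Type) where
  Idx : Type
  enc : α → Idx → List Γ'
  size : α → ℕ
  length_le : ∀ x i, (enc x i).length ≤ size x

instance {β : Type} [Str β] : Data β where
  Idx := Unit
  enc x _ := Str.str x
  size x := (Str.str x).length
  length_le _ _ := le_rfl

/-- The components of a pair stay on separate stacks, so forming pairs and projecting require no
computation. -/
instance {α β : Type} [Data α] [Data β] : Data (α × β) where
  Idx := Data.Idx α ⊕ Data.Idx β
  enc x := Sum.elim (Data.enc x.1) (Data.enc x.2)
  size x := Data.size x.1 + Data.size x.2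
  length_le x i := by
    rcases i with i | i
    · exact (Data.length_le x.1 i).trans (Nat.le_add_right _ _)
    · exact (Data.length_le x.2 i).trans (Nat.le_add_left _ _)

/-- `f` can be computed in time `P`: wherever the input is stored, there is a program that puts the
output on top of a given stack and leaves all other stacks unchanged. -/
def Implements {α β : Type} [Data α] [Str β] (P : Polynomial ℕ) (f : α → β) : Prop :=
  ∀ (a : Data.Idx α → ℕ) (o m : ℕ), (∀ i, a i < m) → o < m → (∀ i, a i ≠ o) →
    ∃ p : Prog, ∀ (x : α) (s : Store), (∀ i, s (a i) = Data.enc x i) → (∀ j, m ≤ j → s j = []) →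
      Does p s (update s o (Str.str (f x) ++ s o)) (P.eval (Data.size x))

/-- The polynomial-time functions. -/
def PT {α β : Type} [Data α] [Str β] (f : α → β) : Prop :=
  ∃ P : Polynomial ℕ, Implements P f ∧ ∀ x, (Str.str (f x)).length ≤ P.eval (Data.size x)

/-- `φ` only rearranges the strings that its argument consists of. -/
def Rearranges {α β : Type} [Data α] [Data β] (φ : α → β) : Prop :=
  ∃ r : Data.Idx β → Data.Idx α, (∀ x i, Data.enc (φ x) i = Data.enc x (r i)) ∧
    ∃ c, ∀ x, Data.size (φ x) ≤ c * Data.size x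

section

variable {α β γ δ : Type} [Data α]

theorem Rearranges.id : Rearranges (fun x : α => x) :=
  ⟨fun i => i, fun _ _ => rfl, 1, fun _ => by simp⟩

theorem Rearranges.fst [Data β] [Data γ] {φ : α → β × γ} (h : Rearranges φ) :
    Rearranges fun x => (φ x).1 := by
  obtain ⟨r, hr, c, hc⟩ := h
  exact ⟨fun i => r (Sum.inl i), fun x i => hr x (Sum.inl i), c, fun x =>
    (Nat.le_add_right _ _).trans (hc x)⟩

theorem Rearranges.snd [Data β] [Data γ] {φ : α → β × γ} (h : Rearranges φ) :
    Rearranges fun x => (φ x).2 := by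
  obtain ⟨r, hr, c, hc⟩ := h
  exact ⟨fun i => r (Sum.inr i), fun x i => hr x (Sum.inr i), c, fun x =>
    (Nat.le_add_left _ _).trans (hc x)⟩

theorem Rearranges.pair [Data β] [Data γ] {φ : α → β} {ψ : α → γ} (h : Rearranges φ)
    (h' : Rearranges ψ) : Rearranges fun x => (φ x, ψ x) := by
  obtain ⟨r, hr, c, hc⟩ := h
  obtain ⟨r', hr', c', hc'⟩ := h'
  refine ⟨Sum.elim r r', ?_, c + c', fun x => ?_⟩
  · rintro x (i | i)
    · exact hr x i
    · exact hr' x i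
  · rw [add_mul]
    exact add_le_add (hc x) (hc' x)

/-- Only the strings matter, so a value may change its type, for instance from a list of `true` bits
to a natural number. -/
theorem PT.of_str_eq [Str β] [Str γ] {f : α → β} {g : α → γ} (hf : PT f)
    (h : ∀ x, Str.str (f x) = Str.str (g x)) : PT g := by
  obtain ⟨P, hP, hl⟩ := hf
  exact ⟨P, fun a o m h₁ h₂ h₃ => by simpa only [h] using hP a o m h₁ h₂ h₃, fun x => h x ▸ hl x⟩

theorem PT.congr [Str β] {f g : α → β} (hf : PT f) (h : ∀ x, f x = g x) : PT g :=
  (funext h : f = g) ▸ hf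

theorem PT.rearrange [Data β] [Str γ] {f : β → γ} {φ : α → β} (hf : PT f) (h : Rearranges φ) :
    PT fun x => f (φ x) := by
  obtain ⟨P, hP, hl⟩ := hf
  obtain ⟨r, hr, c, hc⟩ := h
  have hle : ∀ x, P.eval (Data.size (φ x)) ≤ (P.comp (Polynomial.C c * Polynomial.X)).eval
      (Data.size x) := fun x => by
    rw [Polynomial.eval_comp]
    exact polynomial_eval_mono P (by simpa using hc x)
  refine ⟨P.comp (Polynomial.C c * Polynomial.X), fun a o m h₁ h₂ h₃ => ?_,
    fun x => (hl _).trans (hle x)⟩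
  obtain ⟨p, hp⟩ := hP (fun i => a (r i)) o m (fun _ => h₁ _) h₂ (fun _ => h₃ _)
  exact ⟨p, fun x s hs hj => (hp (φ x) s (fun i => (hs _).trans (hr x i).symm) hj).mono (hle x)⟩

theorem PT.nil : PT (fun _ : α => ([] : List Γ')) := by
  refine ⟨1, fun a o m _ _ _ => ⟨.skip, fun x s _ _ => ?_⟩, fun x => by simp [str_list]⟩
  refine ⟨1, by simp, ?_⟩
  have : update s o (Str.str ([] : List Γ') ++ s o) = s := by
    simp [str_list]
  rw [this]
  exact .skip s

theorem PT.id [Str β] : PT (fun x : β => x) := by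
  refine ⟨9 * Polynomial.X + 2, fun a o m h₁ h₂ h₃ => ⟨Prog.copy (a ()) o m, fun x s hs hj => ?_⟩,
    fun x => ?_⟩
  · have h := does_copy (h₃ ()) (h₁ ()).ne h₂.ne (hj m le_rfl)
    rw [hs] at h
    refine h.mono ?_
    simp [Data.size, Data.enc]
  · simp [Data.size]
    omega

/-- Continue with the value of `g` as an additional argument. -/
theorem PT.bind [Str β] [Str γ] {g : α → β} {f : α × β → γ} (hf : PT f) (hg : PT g) :
    PT fun x => f (x, g x) := by
  obtain ⟨P, hP, hPl⟩ := hf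
  obtain ⟨Q, hQ, hQl⟩ := hg
  have hle : ∀ x, P.eval (Data.size (x, g x)) ≤ (P.comp (Polynomial.X + Q)).eval
      (Data.size x) := fun x => by
    rw [Polynomial.eval_comp]
    refine polynomial_eval_mono P ?_
    simpa [Data.size] using hQl x
  refine ⟨Q + P.comp (Polynomial.X + Q) + (2 * Q + 1), fun a o m h₁ h₂ h₃ => ?_, fun x => ?_⟩
  -- The value of `g` is kept on stack `m`, and the scratch area is moved up to begin at `m + 1`.
  · obtain ⟨q, hq⟩ := hQ a m (m + 1) (fun i => (h₁ i).trans m.lt_succ_self) m.lt_succ_self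
      (fun i => (h₁ i).ne)
    obtain ⟨p, hp⟩ := hP (Sum.elim a fun _ => m) o (m + 1)
      (by rintro (i | i); exacts [(h₁ i).trans m.lt_succ_self, m.lt_succ_self])
      (h₂.trans m.lt_succ_self) (by rintro (i | i); exacts [h₃ i, h₂.ne'])
    refine ⟨.seq (.seq q p) (Prog.clear m), fun x s hs hj => ?_⟩
    have e₁ := hq x s hs (fun j hjm => hj j (by omega))
    have e₂ := hp (x, g x) (update s m (Str.str (g x) ++ s m)) (by
      rintro (i | i)
      · simp [(h₁ i).ne, hs, Data.enc]
      · simp [hj m le_rfl, Data.enc]) (fun j hjm => by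
        rw [update_of_ne (by omega)]; exact hj j (by omega))
    have e₃ := (e₁.seq (e₂.mono (hle x))).seq (does_clear m _)
    refine e₃.of_eq ?_ ?_
    · have := hQl x
      rw [update_of_ne h₂.ne', update_self, hj m le_rfl]
      simp only [List.append_nil, Polynomial.eval_add, Polynomial.eval_mul,
        Polynomial.eval_ofNat, Polynomial.eval_one]
      omega
    · have hm := hj m le_rfl
      have hom := h₂.ne
      funext j
      simp only [update_apply]
      split_ifs <;> simp_all
  · have := (hPl (x, g x)).trans (hle x)
    simp only [Polynomial.eval_add]
    omega

theorem PT.cons (c : Γ') {f : α → List Γ'} (hf : PT f) : PT fun x => c :: f x := by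
  obtain ⟨P, hP, hl⟩ := hf
  refine ⟨P + 1, fun a o m h₁ h₂ h₃ => ?_, fun x => ?_⟩
  · obtain ⟨p, hp⟩ := hP a o m h₁ h₂ h₃
    refine ⟨.seq p (.push o c), fun x s hs hj => ?_⟩
    refine ((hp x s hs hj).seq (Does.push o c _)).of_eq (by simp) ?_
    simp [str_list]
  · have := hl x
    simp only [str_list, Polynomial.eval_add, Polynomial.eval_one, List.length_cons] at this ⊢
    omega

theorem PT.append {f g : α → List Γ'} (hf : PT f) (hg : PT g) : PT fun x => f x ++ g x := by
  obtain ⟨P, hP, hPl⟩ := hf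
  obtain ⟨Q, hQ, hQl⟩ := hg
  refine ⟨Q + P, fun a o m h₁ h₂ h₃ => ?_, fun x => ?_⟩
  · obtain ⟨p, hp⟩ := hP a o m h₁ h₂ h₃
    obtain ⟨q, hq⟩ := hQ a o m h₁ h₂ h₃
    refine ⟨.seq q p, fun x s hs hj => ?_⟩
    have e := (hq x s hs hj).seq (hp x _ (fun i => by rw [update_of_ne (h₃ i)]; exact hs i)
      (fun j hjm => by rw [update_of_ne (by omega)]; exact hj j hjm))
    refine e.of_eq (by simp) ?_
    simp [str_list]
  · have := hPl x
    have := hQl x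
    simp only [str_list, Polynomial.eval_add, List.length_append] at *
    omega

theorem PT.tail {f : α → List Γ'} (hf : PT f) : PT fun x => (f x).tail := by
  obtain ⟨P, hP, hl⟩ := hf
  refine ⟨P + 1 + (8 * P + 2), fun a o m h₁ h₂ h₃ => ?_, fun x => ?_⟩
  · obtain ⟨p, hp⟩ := hP a m (m + 1) (fun i => (h₁ i).trans m.lt_succ_self) m.lt_succ_self
      (fun i => (h₁ i).ne)
    refine ⟨.seq (.seq p (.pop m)) (Prog.transfer m o (m + 1)), fun x s hs hj => ?_⟩
    have hm := hj m le_rfl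
    have hom := h₂.ne
    have e := ((hp x s hs (fun j hjm => hj j (by omega))).seq (Does.pop m _)).seq
      (does_transfer h₂.ne' (by omega) (by omega : o ≠ m + 1)
        (by simp [hj (m + 1) (by omega)]))
    refine e.of_eq ?_ ?_
    · have := hl x
      simp only [str_list, update_self, hm, List.append_nil, List.length_tail,
        Polynomial.eval_add, Polynomial.eval_mul, Polynomial.eval_ofNat,
        Polynomial.eval_one] at this ⊢
      omega
    · funext j
      simp only [update_apply, str_list]
      split_ifs <;> simp_all
  · have := hl x
    simp only [str_list, Polynomial.eval_add, Polynomial.eval_one, List.length_tail] at this ⊢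
    omega

/-- The head takes finitely many values, so the sum of the bounds of all branches bounds whichever
branch is taken. -/
theorem PT.cases [Str β] {g : α → List Γ'} {f : Option Γ' → α → β} (hf : ∀ o, PT (f o))
    (hg : PT g) : PT fun x => f (g x).head? x := by
  choose P hP hPl using hf
  obtain ⟨Q, hQ, hQl⟩ := hg
  have hle : ∀ o n, (P o).eval n ≤ (∑ o, P o).eval n := fun o n => by
    rw [Polynomial.eval_finsetSum]
    exact Finset.single_le_sum (f := fun o => (P o).eval n) (fun _ _ => Nat.zero_le _)
      (Finset.mem_univ o)
  refine ⟨Q + (1 + (2 * Q + 1 + ∑ o, P o)), fun a o m h₁ h₂ h₃ => ?_, fun x => ?_⟩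
  · obtain ⟨q, hq⟩ := hQ a m (m + 1) (fun i => (h₁ i).trans m.lt_succ_self) m.lt_succ_self
      (fun i => (h₁ i).ne)
    have hp := fun z => hP z a o m h₁ h₂ h₃
    choose p hp using hp
    refine ⟨.seq q (.cas m fun z => .seq (Prog.clear m) (p z)), fun x s hs hj => ?_⟩
    have hm := hj m le_rfl
    have e₁ := hq x s hs (fun j hjm => hj j (by omega))
    have hs' : update (update s m (Str.str (g x) ++ s m)) m [] = s := by
      rw [update_idem, ← hm, update_eq_self]
    have e₂ := does_clear m (update s m (Str.str (g x) ++ s m))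
    rw [hs'] at e₂
    have hh : (update s m (Str.str (g x) ++ s m) m).head? = (g x).head? := by
      simp [hm, str_list]
    have e₃ : Does (.cas m fun z => .seq (Prog.clear m) (p z)) _ _ _ :=
      Does.cas (by rw [hh]; exact e₂.seq ((hp (g x).head? x s hs hj).mono (hle _ _)))
    refine (e₁.seq e₃).mono ?_
    · have := hQl x
      simp only [str_list, update_self, hm, List.append_nil,
        Polynomial.eval_add, Polynomial.eval_mul, Polynomial.eval_ofNat,
        Polynomial.eval_one] at this ⊢
      omega
  · have := (hPl (g x).head? x).trans (hle _ _)
    simp only [Polynomial.eval_add]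
    omega

end

end GameSym
end

/-! ### Bounded recursion -/

noncomputable section

namespace GameSym

open Computability Function

/-- The stacks `m, …, m + 4` are those on which the recursion program below works; separating them
lets `simp` decide all updates. -/
theorem store_ext {m : ℕ} {s t : Store} (h : ∀ j < m, s j = t j) (h₀ : s m = t m)
    (h₁ : s (m + 1) = t (m + 1)) (h₂ : s (m + 2) = t (m + 2)) (h₃ : s (m + 3) = t (m + 3))
    (h₄ : s (m + 4) = t (m + 4)) (h₅ : ∀ k, s (m + (k + 5)) = t (m + (k + 5))) : s = t := by
  funext j
  rcases lt_or_ge j m with hj | hj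
  · exact h j hj
  · obtain ⟨k, rfl⟩ := Nat.exists_eq_add_of_le hj
    match k with
    | 0 => exact h₀
    | 1 => exact h₁
    | 2 => exact h₂
    | 3 => exact h₃
    | 4 => exact h₄
    | k + 5 => exact h₅ k

section

variable {α β γ δ : Type} [Data α]

/-- Bounded recursion. -/
theorem PT.recursion [Str γ] [Str δ] {g : α → γ} {n : α → δ} {h : (α × ℕ) × γ → γ}
    {R : α → ℕ → γ} (hh : PT h) (hg : PT g) (hn : PT n) (Q : Polynomial ℕ)
    (hR₀ : ∀ x, R x 0 = g x) (hR : ∀ x i, R x (i + 1) = h ((x, i), R x i))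
    (hQ : ∀ x, ∀ i ≤ (Str.str (n x)).length, (Str.str (R x i)).length ≤ Q.eval (Data.size x)) :
    PT fun x => R x (Str.str (n x)).length := by
  obtain ⟨Ph, hPh, -⟩ := hh
  obtain ⟨Pg, hPg, -⟩ := hg
  obtain ⟨Pn, hPn, hPnl⟩ := hn
  -- Stack `m` holds the symbols of `n x` still to be consumed, `m + 1` the index `i`, `m + 2` the
  -- value `R x i`, `m + 3` the next value; `m + 4` serves for moving it. `H` bounds a call of `h`,
  -- whose argument consists of `x`, an index below the length of `n x` and a value of length at
  -- most `Q`. `K` bounds one round of the loop.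
  let H := Ph.comp (Polynomial.X + Pn + Q)
  let K := 1 + (1 + H + (2 * Q + 1) + (8 * Q + 2) + 1)
  refine ⟨Pn + Pg + (Pn * K + 1) + (2 * Pn + 1) + (8 * Q + 2) + Q, fun a o m h₁ h₂ h₃ => ?_,
    fun x => ?_⟩
  swap
  · have := hQ x _ le_rfl
    simp only [Polynomial.eval_add]
    omega
  obtain ⟨pn, hpn⟩ := hPn a m (m + 5) (fun i => (h₁ i).trans (by omega)) (by omega)
    (fun i => (h₁ i).ne)
  obtain ⟨pg, hpg⟩ := hPg a (m + 2) (m + 5) (fun i => (h₁ i).trans (by omega)) (by omega)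
    (fun i => ((h₁ i).trans (by omega)).ne)
  obtain ⟨ph, hph⟩ := hPh (Sum.elim (Sum.elim a fun _ => m + 1) fun _ => m + 2) (m + 3) (m + 4)
    (by
      rintro ((i | i) | i)
      exacts [(h₁ i).trans (by omega), by simp, by simp])
    (by omega)
    (by
      rintro ((i | i) | i)
      exacts [((h₁ i).trans (by omega)).ne, by simp, by simp])
  let body : Prog := .seq (.seq (.seq (.seq (.pop m) ph) (Prog.clear (m + 2)))
    (Prog.transfer (m + 3) (m + 2) (m + 4))) (.push (m + 1) (Γ'.bit true))
  refine ⟨.seq (.seq (.seq (.seq pn pg) (.loop m body)) (Prog.clear (m + 1)))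
    (Prog.transfer (m + 2) o (m + 3)), fun x s hs hj => ?_⟩
  have hm : ∀ k, s (m + k) = [] := fun k => hj _ (Nat.le_add_right _ _)
  have hm0 : s m = [] := hm 0
  have ho : ∀ k, o ≠ m + k := fun k => by omega
  have ho0 : o ≠ m := ho 0
  let S : List Γ' → ℕ → Store := fun l i =>
    update (update (update s m l) (m + 1) (List.replicate i (Γ'.bit true))) (m + 2)
      (Str.str (R x i))
  have hbody : ∀ c l i, i < (Str.str (n x)).length →
      Does body (S (c :: l) i) (S l (i + 1)) ((1 + H + (2 * Q + 1) + (8 * Q + 2) + 1).eval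
        (Data.size x)) := by
    intro c l i hi
    have e₁ := Does.pop m (S (c :: l) i)
    have e₁' : update (S (c :: l) i) m ((S (c :: l) i) m).tail = S l i := by
      refine store_ext (m := m) (fun j hjm => ?_) ?_ ?_ ?_ ?_ ?_ (fun k => ?_)
      rotate_left
      all_goals simp [S, update_of_ne]
      have n0 := hjm.ne
      have n1 : j ≠ m + 1 := by omega
      have n2 : j ≠ m + 2 := by omega
      simp [n0, n1, n2]
    rw [e₁'] at e₁
    have e₂ := hph ((x, i), R x i) (S l i) (by
      rintro ((k | k) | k)
      · have := h₁ k
        simp only [Sum.elim_inl, S]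
        rw [update_of_ne (by omega), update_of_ne (by omega), update_of_ne (by omega)]
        exact hs k
      · simp [S, Data.enc, str_nat]
      · simp [S, Data.enc]) (fun j hjm => by
        simp only [S]
        rw [update_of_ne (by omega), update_of_ne (by omega), update_of_ne (by omega)]
        exact hj j (by omega))
    have hle : Ph.eval (Data.size ((x, i), R x i)) ≤ H.eval (Data.size x) := by
      simp only [H, Polynomial.eval_comp]
      refine polynomial_eval_mono Ph ?_
      have := hQ x i hi.le
      have := hPnl x
      simp only [Data.size, str_nat, List.length_replicate, Polynomial.eval_add,
        Polynomial.eval_X]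
      omega
    have e₃ := ((e₁.seq (e₂.mono hle)).seq (does_clear (m + 2) _)).seq
      (does_transfer (a := m + 3) (o := m + 2) (m := m + 4) (by omega) (by omega) (by omega) (by
        simp [S, hm]))
    refine (e₃.seq (Does.push (m + 1) (Γ'.bit true) _)).of_eq ?_ ?_
    · have q₁ := hQ x i hi.le
      have q₂ := hQ x (i + 1) hi
      rw [hR] at q₂
      simp [S, hm, ← hR] at q₁ q₂ ⊢
      omega
    · refine store_ext (m := m) (fun j hjm => ?_) ?_ ?_ ?_ ?_ ?_ (fun k => ?_)
      rotate_left
      all_goals simp [S, hm, ← hR, List.replicate_succ]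
      have n0 := hjm.ne
      have n1 : j ≠ m + 1 := by omega
      have n2 : j ≠ m + 2 := by omega
      have n3 : j ≠ m + 3 := by omega
      simp [n0, n1, n2, n3]
  have hloop : ∀ l i, i + l.length = (Str.str (n x)).length →
      Does (.loop m body) (S l i) (S [] (Str.str (n x)).length)
        (l.length * K.eval (Data.size x) + 1) := by
    intro l
    induction l with
    | nil =>
      intro i hi
      simp only [List.length_nil, add_zero] at hi
      rw [← hi]
      exact (Does.loopNil (by simp [S])).mono (by simp)
    | cons c l ih =>
      intro i hi
      simp only [List.length_cons] at hi
      refine (Does.loopCons (by simp [S]) (hbody c l i (by omega)) (ih (i + 1) (by omega))).mono ?_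
      simp only [K, List.length_cons, Nat.succ_mul, Polynomial.eval_add, Polynomial.eval_one]
      omega
  have e₁ := hpn x s hs (fun j hjm => hj j (by omega))
  have e₂ := hpg x (update s m (Str.str (n x) ++ s m)) (fun i => by
    rw [update_of_ne (h₁ i).ne]; exact hs i) (fun j hjm => by
    rw [update_of_ne (by omega)]; exact hj j (by omega))
  have e₂' : update (update s m (Str.str (n x) ++ s m)) (m + 2) (Str.str (g x) ++
      update s m (Str.str (n x) ++ s m) (m + 2)) = S (Str.str (n x)) 0 := by
    refine store_ext (m := m) (fun j hjm => ?_) ?_ ?_ ?_ ?_ ?_ (fun k => ?_)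
    rotate_left
    all_goals simp [S, hm, hm0, hR₀]
    have n0 := hjm.ne
    have n1 : j ≠ m + 1 := by omega
    have n2 : j ≠ m + 2 := by omega
    simp [n0, n1, n2]
  rw [e₂'] at e₂
  have e₃ := (((e₁.seq e₂).seq (hloop _ 0 (by simp))).seq (does_clear (m + 1) _)).seq
    (does_transfer (a := m + 2) (o := o) (m := m + 3) (ho _).symm (by omega) (ho _) (by
      simp [S, hm]))
  refine e₃.of_eq ?_ ?_
  · have q₁ := hPnl x
    have q₂ := hQ x _ le_rfl
    have q₃ := Nat.mul_le_mul_right (K.eval (Data.size x)) q₁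
    simp [S] at q₁ q₂ q₃ ⊢
    omega
  · refine store_ext (m := m) (fun j hjm => ?_) ?_ ?_ ?_ ?_ ?_ (fun k => ?_)
    rotate_left
    all_goals simp [S, hm, hm0, ho, ho0, (ho _).symm, ho0.symm]
    have n0 := hjm.ne
    have n1 : j ≠ m + 1 := by omega
    have n2 : j ≠ m + 2 := by omega
    simp [update_apply, n0, n1, n2]

end

end GameSym
end

/-! ### Unary arithmetic, logic and loops in polynomial time -/

noncomputable section

namespace GameSym

open Computability Function

section

variable {α β γ δ : Type} [Data α]

theorem PT.str_of [Str β] {f : α → β} (hf : PT f) : PT fun x => Str.str (f x) :=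
  hf.of_str_eq fun _ => rfl

theorem PT.of_str [Str β] {f : α → β} (hf : PT fun x => Str.str (f x)) : PT f :=
  hf.of_str_eq fun _ => rfl

theorem PT.const [Str β] (b : β) : PT fun _ : α => b := by
  refine PT.of_str ?_
  generalize Str.str b = l
  induction l with
  | nil => exact PT.nil
  | cons c l ih => exact ih.cons c

/-- Projections out of nested pairs. -/
theorem PT.proj [Str β] {φ : α → β} (h : Rearranges φ) : PT φ :=
  PT.id.rearrange h

theorem PT.succ {f : α → ℕ} (hf : PT f) : PT fun x => f x + 1 :=
  PT.of_str (hf.str_of.cons (Γ'.bit true))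

theorem PT.add {f g : α → ℕ} (hf : PT f) (hg : PT g) : PT fun x => f x + g x :=
  (hf.str_of.append hg.str_of).of_str_eq fun x => by
    simp [str_nat, str_list]

theorem PT.pred {f : α → ℕ} (hf : PT f) : PT fun x => f x - 1 :=
  hf.str_of.tail.of_str_eq fun x => by simp [str_nat, str_list]

/-- The string itself drives the recursion, and the value returned is the index. -/
theorem PT.length {f : α → List Γ'} (hf : PT f) : PT fun x => (f x).length := by
  have ⟨P, _, hl⟩ := hf
  exact PT.recursion (R := fun _ i => i) (h := fun p : (α × ℕ) × ℕ => p.2 + 1) (g := fun _ => 0)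
    (PT.proj Rearranges.id.snd).succ (PT.const 0) hf P (fun _ => rfl) (fun _ _ => rfl)
    fun x i hi => by simpa [str_nat] using hi.trans (hl x)

theorem PT.recursion_nat [Str γ] {g : α → γ} {n : α → ℕ} {h : (α × ℕ) × γ → γ}
    {R : α → ℕ → γ} (hh : PT h) (hg : PT g) (hn : PT n) (Q : Polynomial ℕ)
    (hR₀ : ∀ x, R x 0 = g x) (hR : ∀ x i, R x (i + 1) = h ((x, i), R x i))
    (hQ : ∀ x, ∀ i ≤ n x, (Str.str (R x i)).length ≤ Q.eval (Data.size x)) :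
    PT fun x => R x (n x) :=
  (PT.recursion hh hg hn Q hR₀ hR (by simpa [str_nat] using hQ)).congr fun x => by simp [str_nat]

theorem PT.sub {f g : α → ℕ} (hf : PT f) (hg : PT g) : PT fun x => f x - g x := by
  have ⟨P, _, hl⟩ := hf
  refine PT.recursion_nat (R := fun x i => f x - i) (h := fun p : (α × ℕ) × ℕ => p.2 - 1)
    (PT.proj Rearranges.id.snd).pred hf hg P (fun _ => rfl) (fun _ _ => by simp; omega)
    fun x i hi => ?_
  have := hl x
  simp only [str_nat, List.length_replicate] at this ⊢
  omega

theorem PT.mul {f g : α → ℕ} (hf : PT f) (hg : PT g) : PT fun x => f x * g x := by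
  have ⟨P, _, hl⟩ := hf
  have ⟨Q, _, hl'⟩ := hg
  refine PT.recursion_nat (R := fun x i => f x * i) (h := fun p : (α × ℕ) × ℕ => p.2 + f p.1.1)
    ((PT.proj Rearranges.id.snd).add (hf.rearrange Rearranges.id.fst.fst)) (PT.const 0) hg (P * Q)
    (fun _ => rfl) (fun _ _ => Nat.mul_succ _ _) fun x i hi => ?_
  have h₁ := hl x
  have h₂ := hl' x
  simp only [str_nat, List.length_replicate, Polynomial.eval_mul] at h₁ h₂ ⊢
  exact Nat.mul_le_mul h₁ (hi.trans h₂)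

theorem PT.drop {f : α → List Γ'} {n : α → ℕ} (hf : PT f) (hn : PT n) :
    PT fun x => (f x).drop (n x) := by
  have ⟨P, _, hl⟩ := hf
  refine PT.recursion_nat (R := fun x i => (f x).drop i)
    (h := fun p : (α × ℕ) × List Γ' => p.2.tail)
    (PT.proj Rearranges.id.snd).tail hf hn P (fun _ => rfl) (fun _ _ => by simp)
    fun x i hi => ?_
  have := hl x
  simp only [str_list, List.length_drop] at this ⊢
  omega

theorem PT.ite [Str β] {p : α → Prop} [∀ x, Decidable (p x)] {f g : α → β} (hp : PT p) (hf : PT f) (hg : PT g) :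
    PT fun x => if p x then f x else g x := by
  refine (PT.cases (f := fun o x => o.elim (g x) fun _ => f x) (g := fun x => Str.str (p x))
    (fun o => by cases o; exacts [hg, hf]) hp.str_of).congr fun x => ?_
  by_cases h : p x
  · simp [h, str_prop]
  · simp [h, str_prop]

open Classical in
theorem PT.not {p : α → Prop} (hp : PT p) : PT fun x => ¬p x :=
  (PT.ite hp (PT.const False) (PT.const True)).congr fun x => by by_cases h : p x <;> simp [h]

open Classical in
theorem PT.and {p q : α → Prop} (hp : PT p) (hq : PT q) : PT fun x => p x ∧ q x :=
  (PT.ite hp hq (PT.const False)).congr fun x => by by_cases h : p x <;> simp [h]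

open Classical in
theorem PT.or {p q : α → Prop} (hp : PT p) (hq : PT q) : PT fun x => p x ∨ q x :=
  (PT.ite hp (PT.const True) hq).congr fun x => by by_cases h : p x <;> simp [h]

theorem PT.isNil {f : α → List Γ'} (hf : PT f) : PT fun x => f x = [] := by
  refine (PT.cases (f := fun o _ => o = none) (fun o => PT.const (o = none)) hf).congr fun x => ?_
  simp

theorem PT.le {f g : α → ℕ} (hf : PT f) (hg : PT g) : PT fun x => f x ≤ g x :=
  (hf.sub hg).str_of.isNil.congr fun x => by simp [str_nat, Nat.sub_eq_zero_iff_le]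

theorem PT.lt {f g : α → ℕ} (hf : PT f) (hg : PT g) : PT fun x => f x < g x :=
  (hf.succ.le hg).congr fun _ => rfl

theorem PT.eq {f g : α → ℕ} (hf : PT f) (hg : PT g) : PT fun x => f x = g x :=
  ((hf.le hg).and (hg.le hf)).congr fun _ => propext le_antisymm_iff.symm

theorem PT.getElem {f : α → List Γ'} {i : α → ℕ} (hf : PT f) (hi : PT i) (c : Γ') :
    PT fun x => (f x)[i x]? = some c :=
  (PT.cases (f := fun o _ => o = some c) (fun o => PT.const _) (hf.drop hi)).congr fun x => by
    simp [List.head?_drop]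

/-- A list with one symbol, from the value of an optional symbol at a position. -/
theorem PT.getElem_toList {f : α → List Γ'} {i : α → ℕ} (hf : PT f) (hi : PT i) :
    PT fun x => (f x)[i x]?.toList :=
  (PT.cases (f := fun o _ => o.toList) (fun o => PT.const _) (hf.drop hi)).congr fun x => by
    simp [List.head?_drop]

/-- The loop from which all outputs are assembled. Its result is bounded by the number of pieces
times a bound for the length of a piece; the latter is polynomial since every index `j` is below `n
x`. -/
theorem PT.flatMap_range {n : α → ℕ} {f : α → ℕ → List Γ'} (hn : PT n)
    (hf : PT fun p : α × ℕ => f p.1 p.2) : PT fun x => (List.range (n x)).flatMap (f x) := by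
  have ⟨P, _, hl⟩ := hf
  have ⟨Q, _, hl'⟩ := hn
  refine PT.recursion_nat (R := fun x i => (List.range i).flatMap (f x))
    (h := fun p : (α × ℕ) × List Γ' => p.2 ++ f p.1.1 p.1.2)
    ((PT.proj Rearranges.id.snd).append (hf.rearrange Rearranges.id.fst)) PT.nil hn
    (Q * P.comp (Polynomial.X + Q)) (fun _ => rfl) (fun _ _ => by simp [List.range_succ])
    fun x i hi => ?_
  have h₂ := hl' x
  simp only [str_nat, List.length_replicate, str_list] at h₂ ⊢
  have h₃ : ∀ j < i, (f x j).length ≤ (P.comp (Polynomial.X + Q)).eval (Data.size x) := by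
    intro j hj
    refine (hl (x, j)).trans ?_
    rw [Polynomial.eval_comp]
    refine polynomial_eval_mono P ?_
    simp only [Data.size, str_nat, List.length_replicate, Polynomial.eval_add, Polynomial.eval_X]
    omega
  rw [Polynomial.eval_mul]
  refine le_trans ?_ (Nat.mul_le_mul_right _ (hi.trans h₂))
  clear hi
  induction i with
  | zero => simp
  | succ i ih =>
    have := ih fun j hj => h₃ j (by omega)
    have := h₃ i (by omega)
    simp only [List.range_succ, List.flatMap_append, List.length_append, List.flatMap_cons,
      List.flatMap_nil, List.append_nil, Nat.succ_mul]
    omega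

/-- In unary, concatenation is addition. -/
theorem PT.sum_range {n : α → ℕ} {f : α → ℕ → ℕ} (hn : PT n)
    (hf : PT fun p : α × ℕ => f p.1 p.2) : PT fun x => ∑ i ∈ Finset.range (n x), f x i := by
  refine (PT.flatMap_range (f := fun x i => Str.str (f x i)) hn hf.str_of).of_str_eq fun x => ?_
  simp only [str_list, str_nat]
  induction n x with
  | zero => rfl
  | succ k ih => simp [List.range_succ, Finset.sum_range_succ, ih]

/-- A concatenation of truth values is nonempty exactly if one of them is. -/
theorem PT.exists_lt {n : α → ℕ} {p : α → ℕ → Prop} (hn : PT n)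
    (hp : PT fun q : α × ℕ => p q.1 q.2) : PT fun x => ∃ i < n x, p x i := by
  refine (PT.flatMap_range (f := fun x i => Str.str (p x i)) hn hp.str_of).isNil.not.congr
    fun x => ?_
  simp only [List.flatMap_eq_nil_iff, List.mem_range, not_forall, eq_iff_iff]
  refine exists_congr fun i => ?_
  rw [str_prop]
  by_cases h : p x i <;> simp [h]

theorem PT.forall_lt {n : α → ℕ} {p : α → ℕ → Prop} (hn : PT n)
    (hp : PT fun q : α × ℕ => p q.1 q.2) : PT fun x => ∀ i < n x, p x i :=
  (PT.exists_lt (p := fun x i => ¬p x i) hn hp.not).not.congr fun x => by simp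

/-- For a nonzero divisor the quotient is the number of `i < f x` with `(i + 1) * g x ≤ f x`.
Division by zero is a separate case. -/
theorem PT.div {f g : α → ℕ} (hf : PT f) (hg : PT g) : PT fun x => f x / g x := by
  classical
  refine (PT.ite (hg.eq (PT.const 0)) (PT.const 0) (PT.sum_range
    (f := fun x i => if (i + 1) * g x ≤ f x then 1 else 0) hf (PT.ite
    (((PT.proj Rearranges.id.snd).succ.mul (hg.rearrange Rearranges.id.fst)).le
      (hf.rearrange Rearranges.id.fst)) (PT.const 1) (PT.const 0)))).congr fun x => ?_
  split_ifs with h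
  · simp [h]
  · have hpos : 0 < g x := Nat.pos_of_ne_zero h
    rw [← Finset.sum_filter, Finset.sum_const, smul_eq_mul, mul_one]
    conv_rhs => rw [← Finset.card_range (f x / g x)]
    congr 1
    ext i
    simp only [Finset.mem_filter, Finset.mem_range]
    rw [← Nat.le_div_iff_mul_le hpos]
    have := Nat.div_le_self (f x) (g x)
    omega

theorem PT.mod {f g : α → ℕ} (hf : PT f) (hg : PT g) : PT fun x => f x % g x :=
  (hf.sub (hg.mul (hf.div hg))).congr fun x => by
    have := Nat.div_add_mod (f x) (g x)
    omega

/-- A single bit. -/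
theorem PT.bit {p : α → Prop} [∀ x, Decidable (p x)] (hp : PT p) : PT fun x => [Γ'.bit (decide (p x))] :=
  (PT.ite hp (PT.const [Γ'.bit true]) (PT.const [Γ'.bit false])).congr fun x => by
    by_cases h : p x <;> simp [h]

theorem PT.unary {f : α → ℕ} (hf : PT f) : PT fun x => encodeUnary (f x) :=
  (hf.str_of.append (PT.const [Γ'.comma])).congr fun x => by
    simp [encodeUnary, encodeBits, str_nat]

end

end GameSym
end

/-! ### From `PT` to machines, and the parsing of inputs -/

noncomputable section

namespace GameSym

open Computability Function

theorem polyTimeComputable_of_str {A B : Type} [Str A] [Str B] {F : A → B} (hF : PT F) :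
    PolyTimeComputable (Str.str : A → List Γ') (Str.str : B → List Γ') F := by
  obtain ⟨P, hP, -⟩ := hF
  obtain ⟨p, hp⟩ := hP (fun _ => 0) 1 2 (by simp) (by simp) (by simp)
  refine polyTimeComputable_of_run (.seq p (Prog.clear 0)) (P + (2 * Polynomial.X + 1)) fun x => ?_
  have e := (hp x (update (fun _ => []) 0 (Str.str x)) (fun i => by simp [Data.enc])
    (fun j hj => by rw [update_of_ne (by omega)])).seq (does_clear 0 _)
  refine e.of_eq ?_ ?_
  · simp [Data.size]
  · funext j
    simp only [update_apply]
    split_ifs <;> simp_all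

/-- A machine sees only strings, so it computes every function with the same codes. This allows the
problems' own instance types to be replaced by types with a `Str` instance. -/
theorem PolyTimeComputable.transport {A A' B B' S T : Type} {ea : A → List S} {eb : B → List T}
    {F : A → B} (h : PolyTimeComputable ea eb F) {ea' : A' → List S} {eb' : B' → List T}
    {F' : A' → B'} (i : A' → A) (hi : ∀ x, ea (i x) = ea' x)
    (hF : ∀ x, eb (F (i x)) = eb' (F' x)) : PolyTimeComputable ea' eb' F' := by
  obtain ⟨M⟩ := h
  refine ⟨{ M.toTM2ComputableAux with time := M.time, outputsFun := fun x => ?_ }⟩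
  have := M.outputsFun (i x)
  rwa [hi, hF] at this

/-! ## Strings consisting of tokens separated by commas -/

open Classical in
/-- The `i`-th maximal comma-free substring of `x`. -/
def token (x : List Γ') (i : ℕ) : List Γ' :=
  (List.range x.length).flatMap fun q =>
    if (∑ r ∈ Finset.range q, if x[r]? = some Γ'.comma then 1 else 0) = i ∧
      x[q]? ≠ some Γ'.comma then x[q]?.toList else []

theorem PT.token {α : Type} [Data α] {f : α → List Γ'} {i : α → ℕ} (hf : PT f) (hi : PT i) :
    PT fun x => token (f x) (i x) := by
  classical
  have hq : PT fun q : α × ℕ => q.2 := PT.proj Rearranges.id.snd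
  refine PT.flatMap_range hf.length (PT.ite (PT.and (PT.eq (PT.sum_range hq ?_)
    (hi.rearrange Rearranges.id.fst)) (PT.not ?_)) ?_ PT.nil)
  · exact PT.ite ((hf.rearrange Rearranges.id.fst.fst).getElem (PT.proj Rearranges.id.snd) _)
      (PT.const 1) (PT.const 0)
  · exact (hf.rearrange Rearranges.id.fst).getElem hq _
  · exact (hf.rearrange Rearranges.id.fst).getElem_toList hq

/-- The definition by ranges is suited to `PT`; this recursion along the string is suited to proofs.
-/
theorem token_cons (c : Γ') (x : List Γ') (i : ℕ) : token (c :: x) i =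
    if c = Γ'.comma then (if i = 0 then [] else token x (i - 1))
    else if i = 0 then c :: token x 0 else token x i := by
  unfold token
  rw [List.length_cons, List.range_succ_eq_map, List.flatMap_cons, List.flatMap_map]
  simp only [Finset.sum_range_succ', List.getElem?_cons_succ, List.getElem?_cons_zero]
  by_cases hc : c = Γ'.comma
  · by_cases hi : i = 0
    · subst hi
      simp [hc]
    · obtain ⟨j, rfl⟩ := Nat.exists_eq_succ_of_ne_zero hi
      simp [hc]
  · by_cases hi : i = 0
    · subst hi
      simp [hc]
    · simp [hc, hi, Ne.symm hi]

theorem token_zero {w : List Γ'} (hw : Γ'.comma ∉ w) : token w 0 = w := by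
  induction w with
  | nil => rfl
  | cons c w ih =>
    simp only [List.mem_cons, not_or] at hw
    simp [token_cons, Ne.symm hw.1, ih hw.2]

theorem token_append_zero {w : List Γ'} (hw : Γ'.comma ∉ w) (y : List Γ') :
    token (w ++ Γ'.comma :: y) 0 = w := by
  induction w with
  | nil => simp [token_cons]
  | cons c w ih =>
    simp only [List.mem_cons, not_or] at hw
    simp [token_cons, Ne.symm hw.1, ih hw.2]

theorem token_append_succ {w : List Γ'} (hw : Γ'.comma ∉ w) (y : List Γ') (i : ℕ) :
    token (w ++ Γ'.comma :: y) (i + 1) = token y i := by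
  induction w with
  | nil => simp [token_cons]
  | cons c w ih =>
    simp only [List.mem_cons, not_or] at hw
    simp [token_cons, Ne.symm hw.1, ih hw.2]

theorem token_flatMap {L : List (List Γ')} (hL : ∀ w ∈ L, Γ'.comma ∉ w) (i : ℕ) :
    token (L.flatMap fun w => w ++ [Γ'.comma]) i = L[i]?.getD [] := by
  induction L generalizing i with
  | nil => rfl
  | cons w L ih =>
    simp only [List.flatMap_cons, List.append_assoc, List.cons_append, List.nil_append]
    have hw := hL w List.mem_cons_self
    cases i with
    | zero => simp [token_append_zero hw]
    | succ i =>
      rw [token_append_succ hw, ih fun w h => hL w (List.mem_cons_of_mem _ h)]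
      simp

/-- Row-major addressing, used for adjacency matrices, payoff tables and lists of profiles. -/
theorem getElem?_flatMap_of_length {ι X : Type*} {f : ι → List X} {c : ℕ} (l : List ι)
    (hf : ∀ i, (f i).length = c) {b : ℕ} (hb : b < c) (a : ℕ) :
    (l.flatMap f)[a * c + b]? = l[a]?.bind fun i => (f i)[b]? := by
  induction l generalizing a with
  | nil => simp
  | cons i l ih =>
    rw [List.flatMap_cons]
    cases a with
    | zero =>
      rw [zero_mul, zero_add, List.getElem?_append_left (by rw [hf]; exact hb)]
      simp
    | succ a =>
      rw [List.getElem?_append_right (by rw [hf, Nat.succ_mul]; omega), hf, Nat.succ_mul]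
      have : a * c + c + b - c = a * c + b := by omega
      rw [this, ih]
      simp

theorem finRange_flatMap {X : Type*} (n : ℕ) (f : ℕ → List X) :
    (List.finRange n).flatMap (fun i : Fin n => f i) = (List.range n).flatMap f := by
  rw [← List.map_coe_finRange_eq_range, List.flatMap_map]

/-! ## Reading pairs of graphs -/

/-- The adjacency relation on natural numbers. -/
def FinGraph.adj (G : FinGraph) (u v : ℕ) : Prop :=
  ∃ (hu : u < G.order) (hv : v < G.order), G.graph.Adj ⟨u, hu⟩ ⟨v, hv⟩

theorem FinGraph.adj_coe (G : FinGraph) (u v : Fin G.order) : G.adj u v ↔ G.graph.Adj u v :=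
  ⟨fun ⟨_, _, h⟩ => h, fun h => ⟨u.2, v.2, h⟩⟩

open Classical in
/-- The entries of the adjacency matrix. -/
def FinGraph.bits (G : FinGraph) : List Bool :=
  (List.finRange G.order).flatMap fun u => (List.finRange G.order).map fun v =>
    decide (G.graph.Adj u v)

theorem FinGraph.encode_eq_bits (G : FinGraph) :
    G.encode = encodeUnary G.order ++ G.bits.map Γ'.bit := by
  simp only [encode, bits, List.map_flatMap, List.map_map]
  congr 2
  funext u
  induction List.finRange G.order with
  | nil => rfl
  | cons v l ih => simp_all

theorem FinGraph.length_bits (G : FinGraph) : G.bits.length = G.order * G.order := by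
  simp [bits, List.length_flatMap]

theorem FinGraph.getElem?_bits (G : FinGraph) {u v : ℕ} (hu : u < G.order) (hv : v < G.order) :
    G.bits[u * G.order + v]? = some true ↔ G.adj u v := by
  rw [bits, getElem?_flatMap_of_length _ (by simp) hv]
  simp [hu, hv, FinGraph.adj]

theorem FinGraph.encode_eq_adj (G : FinGraph) [∀ u v, Decidable (G.adj u v)] :
    G.encode = encodeUnary G.order ++ (List.range G.order).flatMap fun u =>
      (List.range G.order).flatMap fun v => [Γ'.bit (decide (G.adj u v))] := by
  rw [encode]
  congr 1
  rw [← finRange_flatMap]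
  refine List.flatMap_congr fun u _ => ?_
  rw [← finRange_flatMap]
  refine List.flatMap_congr fun v _ => ?_
  simp [FinGraph.adj_coe]

instance : Str FinGraph := ⟨FinGraph.encode⟩

/-- Pairs of graphs, written one after the other. -/
structure GraphPair where
  fst : FinGraph
  snd : FinGraph

/-- A product type would be stored on two stacks, whereas an instance of graph isomorphism is a
single string. -/
instance : Str GraphPair := ⟨fun p => p.1.encode ++ p.2.encode⟩

theorem PT.graphPair {α : Type} [Data α] {f g : α → FinGraph} (hf : PT f) (hg : PT g) :
    PT fun x => GraphPair.mk (f x) (g x) :=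
  (hf.str_of.append hg.str_of).of_str_eq fun _ => rfl

theorem PT.finGraph {α : Type} [Data α] {n : α → ℕ} {A : α → ℕ → ℕ → Prop} {f : α → FinGraph}
    (hn : PT n) (hA : PT fun p : (α × ℕ) × ℕ => A p.1.1 p.1.2 p.2) (hfn : ∀ x, (f x).order = n x)
    (hfA : ∀ x u v, u < n x → v < n x → ((f x).adj u v ↔ A x u v)) : PT f := by
  classical
  refine PT.of_str ((hn.unary.append (PT.flatMap_range
    (f := fun x u => (List.range (n x)).flatMap fun v => [Γ'.bit (decide (A x u v))]) hn
    (PT.flatMap_range (hn.rearrange Rearranges.id.fst) hA.bit))).congr fun x => ?_)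
  change _ = (f x).encode
  rw [FinGraph.encode_eq_adj, hfn]
  congr 1
  refine List.flatMap_congr fun u hu => List.flatMap_congr fun v hv => ?_
  rw [List.mem_range] at hu hv
  simp [hfA x u v hu hv]

/-- No comma follows an adjacency matrix, so the middle token is the first matrix followed by the
second order. The second order is therefore the length of that token minus the square of the first
order. -/
theorem GraphPair.str_eq (p : GraphPair) : Str.str p =
    List.replicate p.1.order (Γ'.bit true) ++ Γ'.comma :: ((p.1.bits.map Γ'.bit ++
      List.replicate p.2.order (Γ'.bit true)) ++ Γ'.comma :: p.2.bits.map Γ'.bit) := by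
  change p.1.encode ++ p.2.encode = _
  simp [FinGraph.encode_eq_bits, encodeUnary, encodeBits]

theorem GraphPair.token_zero (p : GraphPair) :
    token (Str.str p) 0 = List.replicate p.1.order (Γ'.bit true) := by
  rw [str_eq, token_append_zero (by simp)]

theorem GraphPair.token_one (p : GraphPair) : token (Str.str p) 1 =
    p.1.bits.map Γ'.bit ++ List.replicate p.2.order (Γ'.bit true) := by
  rw [str_eq, token_append_succ (by simp), token_append_zero (by simp)]

theorem GraphPair.token_two (p : GraphPair) : token (Str.str p) 2 = p.2.bits.map Γ'.bit := by
  rw [str_eq, token_append_succ (by simp), token_append_succ (by simp),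
    GameSym.token_zero (by simp)]

theorem PT.order_fst : PT fun p : GraphPair => p.1.order :=
  (PT.length (PT.token PT.id.str_of (PT.const 0))).congr fun p => by
    simp [GraphPair.token_zero]

theorem PT.order_snd : PT fun p : GraphPair => p.2.order :=
  ((PT.length (PT.token PT.id.str_of (PT.const 1))).sub (PT.order_fst.mul PT.order_fst)).congr
    fun p => by simp [GraphPair.token_one, FinGraph.length_bits]

theorem PT.adj_fst : PT fun q : (GraphPair × ℕ) × ℕ => q.1.1.1.adj q.1.2 q.2 := by
  have hp : Rearranges fun q : (GraphPair × ℕ) × ℕ => q.1.1 := Rearranges.id.fst.fst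
  have hu : PT fun q : (GraphPair × ℕ) × ℕ => q.1.2 := PT.proj Rearranges.id.fst.snd
  have hv : PT fun q : (GraphPair × ℕ) × ℕ => q.2 := PT.proj Rearranges.id.snd
  have hn := PT.order_fst.rearrange hp
  refine (((hu.lt hn).and (hv.lt hn)).and ((PT.token (PT.proj hp).str_of (PT.const 1)).getElem
    ((hu.mul hn).add hv) (Γ'.bit true))).congr fun q => propext ⟨?_, ?_⟩
  · rintro ⟨⟨h₁, h₂⟩, h⟩
    rw [GraphPair.token_one, List.getElem?_append_left (by
      simp only [List.length_map, FinGraph.length_bits]; nlinarith)] at h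
    rw [← FinGraph.getElem?_bits _ h₁ h₂]
    simpa using h
  · intro h
    have ⟨h₁, h₂, _⟩ := h
    refine ⟨⟨h₁, h₂⟩, ?_⟩
    rw [GraphPair.token_one, List.getElem?_append_left (by
      simp only [List.length_map, FinGraph.length_bits]; nlinarith)]
    rw [← FinGraph.getElem?_bits _ h₁ h₂] at h
    simpa using h

theorem PT.adj_snd : PT fun q : (GraphPair × ℕ) × ℕ => q.1.1.2.adj q.1.2 q.2 := by
  have hp : Rearranges fun q : (GraphPair × ℕ) × ℕ => q.1.1 := Rearranges.id.fst.fst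
  have hu : PT fun q : (GraphPair × ℕ) × ℕ => q.1.2 := PT.proj Rearranges.id.fst.snd
  have hv : PT fun q : (GraphPair × ℕ) × ℕ => q.2 := PT.proj Rearranges.id.snd
  have hn := PT.order_snd.rearrange hp
  refine (((hu.lt hn).and (hv.lt hn)).and ((PT.token (PT.proj hp).str_of (PT.const 2)).getElem
    ((hu.mul hn).add hv) (Γ'.bit true))).congr fun q => propext ⟨?_, ?_⟩
  · rintro ⟨⟨h₁, h₂⟩, h⟩
    rw [GraphPair.token_two] at h
    rw [← FinGraph.getElem?_bits _ h₁ h₂]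
    simpa using h
  · intro h
    have ⟨h₁, h₂, _⟩ := h
    refine ⟨⟨h₁, h₂⟩, ?_⟩
    rw [GraphPair.token_two]
    rw [← FinGraph.getElem?_bits _ h₁ h₂] at h
    simpa using h

end GameSym
end

noncomputable section

namespace GameSym

open Computability Function

/-! ## Reduction of graph isomorphism to zero-sum games -/

instance : Str Game := ⟨Game.encode⟩

instance : Str ℚ := ⟨encodeRat⟩

theorem PT.game {α : Type} [Data α] {f : α → Game} {n : α → ℕ} {M : α → Fin 2 → ℕ → ℕ → ℚ}
    (hn : PT n) (hM : ∀ i, PT fun p : (α × ℕ) × ℕ => M p.1.1 i p.1.2 p.2)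
    (hpos : ∀ x, 0 < n x)
    (hf : ∀ x, f x = ⟨2, fun _ => n x, fun _ => hpos x, fun i s => M x i (s 0) (s 1)⟩) :
    PT f := by
  refine PT.of_str ((((PT.const (encodeUnary 2)).append (hn.unary.append hn.unary)).append
    (PT.flatMap_range (f := fun x a => (List.range (n x)).flatMap fun b =>
      encodeRat (M x 0 a b) ++ encodeRat (M x 1 a b)) hn (PT.flatMap_range
      (hn.rearrange Rearranges.id.fst) ((hM 0).str_of.append (hM 1).str_of)))).congr fun x => ?_)
  rw [hf]
  change _ = Game.encode _
  simp only [Game.encode, Game.allProfiles, List.finRange_succ, List.finRange_zero, List.map_nil,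
    List.flatMap_cons, List.flatMap_nil, List.append_nil, List.map_cons, List.flatMap_assoc,
    List.flatMap_map, Fin.cons_zero, Fin.cons_one]
  congr 1
  rw [← finRange_flatMap]
  refine List.flatMap_congr fun u _ => ?_
  rw [← finRange_flatMap]
  rfl

namespace GraphPair

open Classical in
/-- One of three multiples of `s`. -/
def select (s : ℚ) (P Q : Prop) : ℚ := if P then s else if Q then 2 * s else 3 * s

/-- The payoffs that record the adjacency of `u` and `v`. -/
def weight (s : ℚ) (G : FinGraph) (u v : ℕ) : ℚ := select s (G.adj u v) (u = v)

theorem select_neg (s : ℚ) (P Q : Prop) : select (-s) P Q = -select s P Q := by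
  unfold select
  split_ifs <;> ring

theorem select_one_eq_two {P Q : Prop} : select 1 P Q = 2 ↔ ¬P ∧ Q := by
  unfold select
  split_ifs with h h' <;> simp [*]

theorem select_one_eq_one {P Q : Prop} : select 1 P Q = 1 ↔ P := by
  unfold select
  split_ifs with h h' <;> simp [*]

theorem select_one_pos {P Q : Prop} : 0 < select 1 P Q := by
  unfold select
  split_ifs <;> norm_num

open Classical in
/-- The block matrix of the weights of both graphs, the second block with opposite sign, and an
additional row and column of zeros. -/
def matrix (s : ℚ) (p : GraphPair) (a b : ℕ) : ℚ :=
  if a < p.1.order ∧ b < p.1.order then weight s p.1 a b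
  else if (p.1.order ≤ a ∧ a - p.1.order < p.2.order) ∧
    (p.1.order ≤ b ∧ b - p.1.order < p.2.order) then
    weight (-s) p.2 (a - p.1.order) (b - p.1.order)
  else 0

/-- The number of actions of each player of the game of two graphs. -/
def numActions (p : GraphPair) : ℕ := p.1.order + p.2.order + 1

/-- The zero-sum game of a pair of graphs. -/
abbrev game (p : GraphPair) : Game where
  numPlayers := 2
  numActions _ := p.numActions
  numActions_pos _ := Nat.succ_pos _
  payoff i s := matrix (if i = 0 then 1 else -1) p (s 0) (s 1)

theorem weight_neg (s : ℚ) (G : FinGraph) (u v : ℕ) : weight (-s) G u v = -weight s G u v :=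
  select_neg _ _ _

theorem matrix_neg (s : ℚ) (p : GraphPair) (a b : ℕ) : matrix (-s) p a b = -matrix s p a b := by
  unfold matrix
  split_ifs <;> simp [weight_neg]

theorem isTwoPlayerZeroSum_game (p : GraphPair) : p.game.IsTwoPlayerZeroSum := by
  refine ⟨rfl, fun s => ?_⟩
  change ∑ i : Fin 2, matrix (if i = 0 then 1 else -1) p (s 0) (s 1) = 0
  simp [Fin.sum_univ_two, matrix_neg]

theorem pt_select {α : Type} [Data α] (s : ℚ) {P Q : α → Prop} (hP : PT P) (hQ : PT Q) :
    PT fun x => select s (P x) (Q x) := by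
  classical
  exact PT.ite hP (PT.const s) (PT.ite hQ (PT.const (2 * s)) (PT.const (3 * s)))

theorem pt_game : PT game := by
  classical
  have hu : PT fun q : (GraphPair × ℕ) × ℕ => q.1.2 := PT.proj Rearranges.id.fst.snd
  have hv : PT fun q : (GraphPair × ℕ) × ℕ => q.2 := PT.proj Rearranges.id.snd
  have hn : PT fun q : (GraphPair × ℕ) × ℕ => q.1.1.1.order :=
    PT.order_fst.rearrange Rearranges.id.fst.fst
  have hm : PT fun q : (GraphPair × ℕ) × ℕ => q.1.1.2.order :=
    PT.order_snd.rearrange Rearranges.id.fst.fst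
  have hun := hu.sub hn
  have hvn := hv.sub hn
  have h₁ : ∀ s : ℚ, PT fun q : (GraphPair × ℕ) × ℕ => weight s q.1.1.1 q.1.2 q.2 := fun s =>
    pt_select s PT.adj_fst (hu.eq hv)
  have hadj : PT fun q : (GraphPair × ℕ) × ℕ =>
      q.1.1.2.adj (q.1.2 - q.1.1.1.order) (q.2 - q.1.1.1.order) :=
    -- Two uses of `PT.bind` substitute the shifted row and column numbers into the adjacency test.
    PT.bind (f := fun q : ((GraphPair × ℕ) × ℕ) × ℕ =>
      q.1.1.1.2.adj q.2 (q.1.2 - q.1.1.1.1.order)) (PT.bind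
      (f := fun q : (((GraphPair × ℕ) × ℕ) × ℕ) × ℕ => q.1.1.1.1.2.adj q.1.2 q.2)
      (PT.adj_snd.rearrange (φ := fun q : (((GraphPair × ℕ) × ℕ) × ℕ) × ℕ =>
        ((q.1.1.1.1, q.1.2), q.2)) ((Rearranges.id.fst.fst.fst.fst.pair
          Rearranges.id.fst.snd).pair Rearranges.id.snd))
      (hvn.rearrange Rearranges.id.fst)) hun
  have h₂ : ∀ s : ℚ, PT fun q : (GraphPair × ℕ) × ℕ =>
      weight s q.1.1.2 (q.1.2 - q.1.1.1.order) (q.2 - q.1.1.1.order) := fun s =>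
    pt_select s hadj (hun.eq hvn)
  refine PT.game (n := numActions) (M := fun p i a b => matrix (if i = 0 then 1 else -1) p a b)
    (PT.order_fst.add PT.order_snd).succ (fun i => ?_) (fun _ => Nat.succ_pos _) (fun _ => rfl)
  generalize (if i = 0 then (1 : ℚ) else -1) = s
  exact PT.ite ((hu.lt hn).and (hv.lt hn)) (h₁ s) (PT.ite (((hn.le hu).and (hun.lt hm)).and
    ((hn.le hv).and (hvn.lt hm))) (h₂ _) (PT.const 0))

/-! ### Symmetries of the game of two graphs -/

/-- The actions of either player: the vertices of both graphs and an additional action. -/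
def actionEquiv (p : GraphPair) :
    Fin p.numActions ≃ Option (Fin p.1.order ⊕ Fin p.2.order) :=
  finSuccEquivLast.trans (Equiv.optionCongr finSumFinEquiv.symm)

/-- The matrix in terms of vertices. -/
def vertexMatrix (p : GraphPair) : Option (Fin p.1.order ⊕ Fin p.2.order) →
    Option (Fin p.1.order ⊕ Fin p.2.order) → ℚ
  | some (Sum.inl u), some (Sum.inl v) => select 1 (p.1.graph.Adj u v) (u = v)
  | some (Sum.inr u), some (Sum.inr v) => -select 1 (p.2.graph.Adj u v) (u = v)
  | _, _ => 0

theorem matrix_eq (p : GraphPair) (x y : Option (Fin p.1.order ⊕ Fin p.2.order)) :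
    matrix 1 p (p.actionEquiv.symm x) (p.actionEquiv.symm y) = p.vertexMatrix x y := by
  have h₀ : ((p.actionEquiv.symm none : Fin p.numActions) : ℕ) = p.1.order + p.2.order := rfl
  have h₁ : ∀ u, ((p.actionEquiv.symm (some (Sum.inl u)) : Fin p.numActions) : ℕ) = u :=
    fun u => by
      change ((finSuccEquivLast.symm (some (finSumFinEquiv (Sum.inl u))) :
        Fin (p.1.order + p.2.order + 1)) : ℕ) = u
      simp
  have h₂ : ∀ u, ((p.actionEquiv.symm (some (Sum.inr u)) : Fin p.numActions) : ℕ) =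
      p.1.order + u := fun u => by
      change ((finSuccEquivLast.symm (some (finSumFinEquiv (Sum.inr u))) :
        Fin (p.1.order + p.2.order + 1)) : ℕ) = p.1.order + u
      simp
  rcases x with _ | u | u <;> rcases y with _ | v | v <;>
    simp [h₀, h₁, h₂, matrix, vertexMatrix, weight, select_neg, FinGraph.adj_coe, Fin.ext_iff]

/-- The value 2 marks the diagonal of the first block: the other entries of that block are 1 or 3,
the second block is negative, and the rest is 0. -/
theorem vertexMatrix_eq_two {p : GraphPair} {x y} (h : p.vertexMatrix x y = 2) :
    ∃ u, x = some (Sum.inl u) ∧ y = some (Sum.inl u) := by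
  rcases x with _ | u | u <;> rcases y with _ | v | v <;> simp only [vertexMatrix] at h
  all_goals first | norm_num at h; done | skip
  · rw [select_one_eq_two] at h
    exact ⟨u, rfl, by rw [h.2]⟩
  · linarith [select_one_pos (P := p.2.graph.Adj u v) (Q := u = v)]

theorem vertexMatrix_eq_neg_two {p : GraphPair} {x y} (h : p.vertexMatrix x y = -2) :
    ∃ u, x = some (Sum.inr u) ∧ y = some (Sum.inr u) := by
  rcases x with _ | u | u <;> rcases y with _ | v | v <;> simp only [vertexMatrix] at h
  all_goals first | norm_num at h; done | skip
  · linarith [select_one_pos (P := p.1.graph.Adj u v) (Q := u = v)]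
  · rw [neg_inj, select_one_eq_two] at h
    exact ⟨u, rfl, by rw [h.2]⟩

/-- The entry 2 at `(u, u)` must correspond to an entry -2, so `κ` and `ρ` send the vertex `u` of
the first graph to one and the same vertex of the second. In the same way `ρ` embeds the second
vertex set into the first; by counting, both embeddings are bijective. The entries ±1 then match
edges. That rows and columns are exchanged does not matter, because adjacency is symmetric. -/
theorem nonempty_iso_of_matrix {p : GraphPair}
    {ρ κ : Option (Fin p.1.order ⊕ Fin p.2.order) → Option (Fin p.1.order ⊕ Fin p.2.order)}
    (hρ : Injective ρ) (h : ∀ x y, p.vertexMatrix x y = -p.vertexMatrix (κ y) (ρ x)) :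
    Nonempty (p.1.graph ≃g p.2.graph) := by
  have h₁ : ∀ u, ∃ v, κ (some (Sum.inl u)) = some (Sum.inr v) ∧
      ρ (some (Sum.inl u)) = some (Sum.inr v) := fun u => by
    refine vertexMatrix_eq_neg_two ?_
    rw [eq_comm, ← neg_eq_iff_eq_neg.trans eq_comm, ← h]
    simp [vertexMatrix, select_one_eq_two]
  have h₂ : ∀ u, ∃ v, κ (some (Sum.inr u)) = some (Sum.inl v) ∧
      ρ (some (Sum.inr u)) = some (Sum.inl v) := fun u => by
    refine vertexMatrix_eq_two ?_
    rw [← neg_inj, ← h]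
    simp [vertexMatrix, select_one_eq_two]
  choose f hfκ hfρ using h₁
  choose g _ hgρ using h₂
  have hf : Injective f := fun u v huv => by
    have := hρ ((hfρ u).trans ((congrArg (fun z => some (Sum.inr z)) huv).trans (hfρ v).symm))
    simpa using this
  have hg : Injective g := fun u v huv => by
    have := hρ ((hgρ u).trans ((congrArg (fun z => some (Sum.inl z)) huv).trans (hgρ v).symm))
    simpa using this
  have hb : Bijective f := by
    rw [Fintype.bijective_iff_injective_and_card]
    exact ⟨hf, le_antisymm (Fintype.card_le_of_injective f hf) (Fintype.card_le_of_injective g hg)⟩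
  refine ⟨⟨Equiv.ofBijective f hb, fun {u v} => ?_⟩⟩
  have := h (some (Sum.inl u)) (some (Sum.inl v))
  rw [hfκ, hfρ] at this
  simp only [vertexMatrix, neg_neg] at this
  simp only [Equiv.ofBijective_apply]
  exact ((p.2.graph.adj_comm _ _).trans (select_one_eq_one (Q := f v = f u)).symm).trans
    ((Eq.congr_left this.symm).trans select_one_eq_one)

/-- The permutation acts by `e` and its inverse and fixes the additional action; it serves for rows
and columns alike. -/
theorem exists_perm_of_iso {p : GraphPair} (e : p.1.graph ≃g p.2.graph) :
    ∃ σ : Equiv.Perm (Option (Fin p.1.order ⊕ Fin p.2.order)),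
      ∀ x y, p.vertexMatrix x y = -p.vertexMatrix (σ y) (σ x) := by
  classical
  refine ⟨Equiv.optionCongr ((Equiv.sumCongr e.toEquiv e.toEquiv.symm).trans (Equiv.sumComm _ _)),
    fun x y => ?_⟩
  rcases x with _ | u | u <;> rcases y with _ | v | v <;> simp only [vertexMatrix,
    Equiv.optionCongr_apply, Option.map_none, Option.map_some, Equiv.trans_apply,
    Equiv.sumCongr_apply, Sum.map_inl, Sum.map_inr, Equiv.sumComm_apply, Sum.swap_inl,
    Sum.swap_inr, neg_zero]
  · have : p.2.graph.Adj (e v) (e u) ↔ p.1.graph.Adj u v := by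
      rw [e.map_adj_iff, p.1.graph.adj_comm]
    have he : e v = e u ↔ u = v := by rw [e.injective.eq_iff, eq_comm]
    simp only [RelIso.coe_fn_toEquiv, this, he, neg_neg]
  · have : p.1.graph.Adj (e.symm v) (e.symm u) ↔ p.2.graph.Adj u v := by
      rw [e.symm.map_adj_iff, p.2.graph.adj_comm]
    have he : e.symm v = e.symm u ↔ u = v := by rw [e.symm.injective.eq_iff, eq_comm]
    exact congrArg Neg.neg (congrArg₂ (select 1) (propext this.symm) (propext he.symm))

theorem induced_swap_iff (p : GraphPair) :
    p.game.Induced (Equiv.swap (0 : Fin 2) 1) ↔ Nonempty (p.1.graph ≃g p.2.graph) := by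
  constructor
  · rintro ⟨φ, h, hu⟩
    -- Applying `mapProfile` to a constant profile and reading off one coordinate yields the image
    -- of the other player's action, already with the right type.
    let ρ : Fin p.numActions → Fin p.numActions := fun a =>
      p.game.mapProfile h (fun _ => a) (1 : Fin 2)
    let κ : Fin p.numActions → Fin p.numActions := fun a =>
      p.game.mapProfile h (fun _ => a) (0 : Fin 2)
    have hρ : ∀ a, φ ⟨(0 : Fin 2), a⟩ = ⟨(1 : Fin 2), ρ a⟩ := fun a =>
      (p.game.mapProfile_spec h (fun _ => a) (1 : Fin 2)).symm
    have hκ : ∀ a, φ ⟨(1 : Fin 2), a⟩ = ⟨(0 : Fin 2), κ a⟩ := fun a =>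
      (p.game.mapProfile_spec h (fun _ => a) (0 : Fin 2)).symm
    have hρi : Injective ρ := fun a b hab => by
      have : φ ⟨(0 : Fin 2), a⟩ = φ ⟨(0 : Fin 2), b⟩ := by rw [hρ, hρ, hab]
      simpa using φ.injective this
    have hM : ∀ a b : Fin p.numActions, matrix 1 p a b = -matrix 1 p (κ b) (ρ a) := by
      intro a b
      let s : p.game.Profile := fun i : Fin 2 => if i = 0 then a else b
      have h₁ : p.game.mapProfile h s (1 : Fin 2) = ρ a := by
        have := p.game.mapProfile_spec h s (1 : Fin 2)
        exact eq_of_heq (Sigma.mk.inj (this.trans (hρ a))).2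
      have h₀ : p.game.mapProfile h s (0 : Fin 2) = κ b := by
        have := p.game.mapProfile_spec h s (0 : Fin 2)
        exact eq_of_heq (Sigma.mk.inj (this.trans (hκ b))).2
      have := hu (0 : Fin 2) s
      change matrix 1 p a b = matrix (-1) p (p.game.mapProfile h s (0 : Fin 2))
        (p.game.mapProfile h s (1 : Fin 2)) at this
      rw [this, h₁, h₀, matrix_neg]
    refine nonempty_iso_of_matrix (ρ := fun x => p.actionEquiv (ρ (p.actionEquiv.symm x)))
      (κ := fun x => p.actionEquiv (κ (p.actionEquiv.symm x)))
      (p.actionEquiv.injective.comp (hρi.comp p.actionEquiv.symm.injective)) fun x y => ?_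
    rw [← matrix_eq, ← matrix_eq, hM]
    simp
  · rintro ⟨e⟩
    obtain ⟨σ, hσ⟩ := exists_perm_of_iso e
    let τ : Equiv.Perm (Fin p.numActions) := (p.actionEquiv.trans σ).trans p.actionEquiv.symm
    have hM : ∀ a b : Fin p.numActions, matrix 1 p a b = -matrix 1 p (τ b) (τ a) := by
      intro a b
      have := hσ (p.actionEquiv a) (p.actionEquiv b)
      rw [← matrix_eq, ← matrix_eq] at this
      simpa [τ] using this
    let φ : Equiv.Perm p.game.Action := ((Equiv.sigmaEquivProd (Fin 2) (Fin p.numActions)).trans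
      (Equiv.prodCongr (Equiv.swap 0 1) τ)).trans
        (Equiv.sigmaEquivProd (Fin 2) (Fin p.numActions)).symm
    have h : p.game.MapsPlayers φ (Equiv.swap (0 : Fin 2) 1) := fun _ => rfl
    refine ⟨φ, h, fun i s => ?_⟩
    have hm : ∀ j : Fin 2, p.game.mapProfile h s j = τ (s (Equiv.swap (0 : Fin 2) 1 j)) := fun j =>
      rfl
    change Fin 2 at i
    change matrix (if i = 0 then 1 else -1) p (s (0 : Fin 2)) (s (1 : Fin 2)) =
      matrix (if Equiv.swap (0 : Fin 2) 1 i = 0 then 1 else -1) p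
        (p.game.mapProfile h s (0 : Fin 2)) (p.game.mapProfile h s (1 : Fin 2))
    rw [hm, hm, Equiv.swap_apply_left, Equiv.swap_apply_right]
    fin_cases i
    · simp [matrix_neg, hM (s (0 : Fin 2))]
    · simp [matrix_neg, hM (s (0 : Fin 2))]

end GraphPair

theorem Game.induced_one (Γ : Game) : Γ.Induced 1 :=
  ⟨1, fun _ => rfl, fun i s => by
    refine congrArg (Γ.payoff i) (funext fun j => ?_)
    rfl⟩

theorem GraphPair.allPlayerPermsInduced_iff (p : GraphPair) :
    p.game.AllPlayerPermsInduced ↔ Nonempty (p.1.graph ≃g p.2.graph) := by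
  rw [← p.induced_swap_iff]
  refine ⟨fun h => h _, fun h π => ?_⟩
  have : ∀ π : Equiv.Perm (Fin 2), π = 1 ∨ π = Equiv.swap 0 1 := by decide
  rcases this π with rfl | rfl
  · exact p.game.induced_one
  · exact h

theorem graphIsomorphism_reduces : PolyTimeReduces graphIsomorphism allPlayerPermsInduced :=
  ⟨fun p => GraphPair.game ⟨p.1, p.2⟩, (polyTimeComputable_of_str GraphPair.pt_game).transport
    (fun p => ⟨p.1, p.2⟩) (fun _ => rfl) (fun _ => rfl),
    fun p => (GraphPair.allPlayerPermsInduced_iff ⟨p.1, p.2⟩).symm⟩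

theorem graphIsomorphism_reduces_zeroSum :
    PolyTimeReduces graphIsomorphism allPlayerPermsInducedTwoPlayerZeroSum :=
  ⟨fun p => ⟨GraphPair.game ⟨p.1, p.2⟩, GraphPair.isTwoPlayerZeroSum_game _⟩,
    (polyTimeComputable_of_str GraphPair.pt_game).transport
      (fun p => ⟨p.1, p.2⟩) (fun _ => rfl) (fun _ => rfl),
    fun p => (GraphPair.allPlayerPermsInduced_iff ⟨p.1, p.2⟩).symm⟩

end GameSym
end

noncomputable section

namespace GameSym

open Function

/-! ## The graph of a game -/

namespace Game

variable (Γ : Game)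

/-- The vertices of the graph of a game: players, actions, profiles, and cells. The cell
`(k, s, l)` represents player `k` together with the payoff of player `l` at the profile `s`. -/
inductive Node
  | player (k : Γ.Player)
  | action (x : Γ.Action)
  | profile (s : Γ.Profile)
  | cell (k : Γ.Player) (s : Γ.Profile) (l : Γ.Player)

variable {Γ}

/-- The edges of the graph of a game: actions belong to players, profiles consist of actions, and
profiles have payoffs. -/
def Link : Γ.Node → Γ.Node → Prop
  | .player k, .action x => x.1 = k
  | .action x, .profile s => s x.1 = x.2
  | .profile s, .cell k s' l => Γ.payoff k s = Γ.payoff l s'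
  | _, _ => False

variable (Γ) in
def nodeGraph : SimpleGraph Γ.Node where
  Adj x y := Link x y ∨ Link y x
  symm := ⟨fun _ _ h => h.symm⟩
  loopless := ⟨fun x h => by cases x <;> simp [Link] at h⟩

theorem nodeGraph_adj {x y : Γ.Node} : Γ.nodeGraph.Adj x y ↔ Link x y ∨ Link y x := Iff.rfl

/-- This replaces the casts in `mapProfile` by equations between actions, in which `φ` can be
cancelled. -/
theorem mapProfile_eq_iff {φ : Equiv.Perm Γ.Action} {π : Equiv.Perm Γ.Player}
    (h : Γ.MapsPlayers φ π) (s t : Γ.Profile) :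
    Γ.mapProfile h s = t ↔ ∀ k, φ ⟨k, s k⟩ = ⟨π k, t (π k)⟩ := by
  constructor
  · rintro rfl k
    have := Γ.mapProfile_spec h s (π k)
    rw [this, π.symm_apply_apply]
  · intro hk
    funext j
    have := Γ.mapProfile_spec h s j
    rw [hk, π.apply_symm_apply] at this
    exact eq_of_heq (Sigma.mk.inj this).2

theorem mapProfile_injective {φ : Equiv.Perm Γ.Action} {π : Equiv.Perm Γ.Player}
    (h : Γ.MapsPlayers φ π) : Injective (Γ.mapProfile h) := by
  intro s t hst
  funext k
  have h₁ := (mapProfile_eq_iff h s _).1 rfl k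
  have h₂ := (mapProfile_eq_iff h t _).1 hst.symm k
  exact eq_of_heq (Sigma.mk.inj (φ.injective (h₁.trans h₂.symm))).2

/-- A symmetry acts on the vertices that represent actions and profiles. -/
def mapNode (φ : Equiv.Perm Γ.Action) (Φ : Equiv.Perm Γ.Profile) : Equiv.Perm Γ.Node where
  toFun
    | .player k => .player k
    | .action x => .action (φ x)
    | .profile s => .profile (Φ s)
    | .cell k s l => .cell k s l
  invFun
    | .player k => .player k
    | .action x => .action (φ.symm x)
    | .profile s => .profile (Φ.symm s)
    | .cell k s l => .cell k s l
  left_inv x := by cases x <;> simp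
  right_inv x := by cases x <;> simp

/-- A permutation of the players acts on the vertices that represent players and cells. -/
def pinNode (π : Equiv.Perm Γ.Player) : Equiv.Perm Γ.Node where
  toFun
    | .player k => .player (π k)
    | .action x => .action x
    | .profile s => .profile s
    | .cell k s l => .cell (π k) s l
  invFun
    | .player k => .player (π.symm k)
    | .action x => .action x
    | .profile s => .profile s
    | .cell k s l => .cell (π.symm k) s l
  left_inv x := by cases x <;> simp
  right_inv x := by cases x <;> simp

/-- The vertices that represent players or cells. -/
def Node.IsPin : Γ.Node → Prop
  | .player _ => True
  | .cell _ _ _ => True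
  | _ => False

theorem heq_apply (s : Γ.Profile) {i j : Γ.Player} (h : i = j) : s i ≍ s j := by rw [h]

/-- In a cell only the player changes, while the table entry that names the payoff value is kept.
Hence invariance of the edges between profiles and cells is the equation `Γ.payoff k s = Γ.payoff (π
k) (Γ.mapProfile h s)`. -/
theorem link_map {φ : Equiv.Perm Γ.Action} {π : Equiv.Perm Γ.Player} (h : Γ.MapsPlayers φ π)
    (hu : ∀ i s, Γ.payoff i s = Γ.payoff (π i) (Γ.mapProfile h s)) {Φ : Equiv.Perm Γ.Profile}
    (hΦ : ∀ s, Φ s = Γ.mapProfile h s) (x y : Γ.Node) :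
    Link (mapNode φ Φ (pinNode π x)) (mapNode φ Φ (pinNode π y)) ↔ Link x y := by
  cases x <;> cases y <;> simp only [mapNode, pinNode, Equiv.coe_fn_mk, Link]
  · rw [h, π.injective.eq_iff]
  · rename_i x s
    rw [hΦ]
    have hx := (mapProfile_eq_iff h s _).1 rfl x.1
    constructor
    · intro h'
      have : φ ⟨x.1, s x.1⟩ = φ x := by
        rw [hx]
        refine Sigma.ext (h x).symm ?_
        rw [← h']
        exact heq_apply (Γ.mapProfile h s) (h x).symm
      have := φ.injective this
      exact eq_of_heq (Sigma.mk.inj this).2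
    · intro h'
      have : (⟨x.1, s x.1⟩ : Γ.Action) = x := by rw [h']
      rw [this] at hx
      rw [hx]
  · rw [hΦ, ← hu]

variable {V : Type} (ι : Γ.Node ↪ V) {pinned : V → Prop} {pin : Equiv.Perm V}
  {π : Equiv.Perm Γ.Player}

/-- Neighbours of pinned vertices are located by the images of those vertices. The players show that
`e` maps actions to actions and induces `π`; the cells show that it maps profiles to profiles with
matching payoffs. The edges between actions and profiles force the map on profiles to be the one
given by the map on actions. -/
theorem induced_of_perm (hpinned : ∀ x : Γ.Node, x.IsPin → pinned (ι x))
    (hpin : ∀ x, pin (ι x) = ι (pinNode π x)) {e : Equiv.Perm V}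
    (he : ∀ u v, (Γ.nodeGraph.map ι).Adj (e u) (e v) ↔ (Γ.nodeGraph.map ι).Adj u v)
    (hp : ∀ v, pinned v → e v = pin v) : Γ.Induced π := by
  -- A player `k₀` is needed to have a cell adjacent to a given profile; without players there is
  -- nothing to check.
  rcases isEmpty_or_nonempty Γ.Player with hN | ⟨⟨k₀⟩⟩
  · exact ⟨1, fun a => isEmptyElim a.1, fun i => isEmptyElim i⟩
  have hpin' : ∀ x : Γ.Node, x.IsPin → e (ι x) = ι (pinNode π x) := fun x hx => by
    rw [hp _ (hpinned x hx), hpin]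
  have hadj : ∀ {x y : Γ.Node}, Γ.nodeGraph.Adj x y → x.IsPin →
      ∃ y', e (ι y) = ι y' ∧ Γ.nodeGraph.Adj (pinNode π x) y' := by
    intro x y hxy hx
    have := (he (ι x) (ι y)).2 ((SimpleGraph.map_adj_apply).2 hxy)
    rw [hpin' x hx] at this
    obtain ⟨x', y', h, hx', hy'⟩ := (SimpleGraph.map_adj _ _ _ _).1 this
    rw [ι.injective hx'] at h
    exact ⟨y', hy'.symm, h⟩
  have hact : ∀ x : Γ.Action, ∃ x' : Γ.Action, e (ι (.action x)) = ι (.action x') ∧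
      x'.1 = π x.1 := by
    intro x
    obtain ⟨y, hy, h⟩ := hadj (x := .player x.1) (y := .action x) (Or.inl rfl) trivial
    cases y <;> simp only [pinNode, Equiv.coe_fn_mk, nodeGraph_adj, Link, or_false, or_self] at h
    exact ⟨_, hy, h⟩
  choose φ₀ hφ hφπ using hact
  have hprof : ∀ s : Γ.Profile, ∃ s' : Γ.Profile, e (ι (.profile s)) = ι (.profile s') ∧
      ∀ k, Γ.payoff k s = Γ.payoff (π k) s' := by
    intro s
    have h₁ : ∀ k, ∃ s' : Γ.Profile, e (ι (.profile s)) = ι (.profile s') ∧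
        Γ.payoff k s = Γ.payoff (π k) s' := by
      intro k
      -- The cell `(k, s, k)` names the payoff of `k` at `s` itself, so it is adjacent to `s`.
      obtain ⟨y, hy, h⟩ := hadj (x := .cell k s k) (y := .profile s) (Or.inr rfl) trivial
      cases y <;> simp only [pinNode, Equiv.coe_fn_mk, nodeGraph_adj, Link, false_or, or_self] at h
      exact ⟨_, hy, h.symm⟩
    obtain ⟨s', hs', -⟩ := h₁ k₀
    refine ⟨s', hs', fun k => ?_⟩
    obtain ⟨t, ht, h⟩ := h₁ k
    have := ι.injective (ht.symm.trans hs')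
    simp only [Node.profile.injEq] at this
    rw [h, this]
  choose Φ₀ hΦ hΦu using hprof
  have hinj : Injective φ₀ := fun x y hxy => by
    have : e (ι (.action x)) = e (ι (.action y)) := by rw [hφ, hφ, hxy]
    simpa using ι.injective (e.injective this)
  let φ : Equiv.Perm Γ.Action := Equiv.ofBijective φ₀ (Finite.injective_iff_bijective.1 hinj)
  have hm : Γ.MapsPlayers φ π := hφπ
  refine ⟨φ, hm, fun i s => ?_⟩
  rw [hΦu s i]
  congr 1
  symm
  rw [mapProfile_eq_iff]
  intro k
  have h₁ := (he (ι (.action ⟨k, s k⟩)) (ι (.profile s))).2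
    (SimpleGraph.map_adj_apply.2 (Or.inl rfl))
  rw [hφ, hΦ, SimpleGraph.map_adj_apply, nodeGraph_adj] at h₁
  simp only [Link, or_false] at h₁
  change φ₀ ⟨k, s k⟩ = _
  have h₂ : (φ₀ ⟨k, s k⟩).1 = π k := hφπ _
  refine Sigma.ext h₂ ?_
  rw [← h₁]
  congr 1

theorem perm_of_induced (hpinned : ∀ x : Γ.Node, pinned (ι x) → x.IsPin)
    (hpin : ∀ x, pin (ι x) = ι (pinNode π x)) (h : Γ.Induced π) : ∃ e : Equiv.Perm V,
    (∀ u v, (Γ.nodeGraph.map ι).Adj (e u) (e v) ↔ (Γ.nodeGraph.map ι).Adj u v) ∧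
      ∀ v, pinned v → e v = pin v := by
  obtain ⟨φ, hm, hu⟩ := h
  let Φ : Equiv.Perm Γ.Profile := Equiv.ofBijective (Γ.mapProfile hm)
    (Finite.injective_iff_bijective.1 (mapProfile_injective hm))
  have hl := link_map hm hu (Φ := Φ) fun _ => rfl
  -- Outside the range of `ι` all vertices are isolated. There `e` agrees with `pin`, so that pinned
  -- elements of `V` that represent no node are mapped as prescribed too.
  let e : Equiv.Perm V := (mapNode φ Φ).viaEmbedding ι * pin
  have heι : ∀ x, e (ι x) = ι (mapNode φ Φ (pinNode π x)) := fun x => by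
    simp only [e, Equiv.Perm.mul_apply, hpin]
    exact Equiv.Perm.viaEmbedding_apply _ _ _
  have hrange : ∀ {v y}, e v = ι y → ∃ x, v = ι x ∧ y = mapNode φ Φ (pinNode π x) := by
    intro v y hv
    obtain ⟨x, rfl⟩ := ((pinNode π).trans (mapNode φ Φ)).surjective y
    exact ⟨x, e.injective (hv.trans (heι x).symm), rfl⟩
  refine ⟨e, fun u v => ?_, fun v hv => ?_⟩
  · constructor
    · intro h
      obtain ⟨x, y, hxy, hx, hy⟩ := (SimpleGraph.map_adj _ _ _ _).1 h
      obtain ⟨x, rfl, rfl⟩ := hrange hx.symm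
      obtain ⟨y, rfl, rfl⟩ := hrange hy.symm
      rw [SimpleGraph.map_adj_apply]
      exact hxy.imp (hl _ _).1 (hl _ _).1
    · intro h
      obtain ⟨x, y, hxy, rfl, rfl⟩ := (SimpleGraph.map_adj _ _ _ _).1 h
      rw [heι, heι, SimpleGraph.map_adj_apply]
      exact hxy.imp (hl _ _).2 (hl _ _).2
  · by_cases hr : v ∈ Set.range ι
    · obtain ⟨x, rfl⟩ := hr
      rw [heι, hpin]
      have := hpinned x hv
      cases x <;> first | rfl | exact this.elim
    · refine Equiv.Perm.viaEmbedding_apply_of_notMem _ _ _ ?_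
      rintro ⟨y, hy⟩
      obtain ⟨x, rfl⟩ := (pinNode π).surjective y
      rw [← hpin] at hy
      exact hr ⟨x, pin.injective hy⟩

theorem induced_iff_exists_perm (hpinned : ∀ x : Γ.Node, pinned (ι x) ↔ x.IsPin)
    (hpin : ∀ x, pin (ι x) = ι (pinNode π x)) : Γ.Induced π ↔ ∃ e : Equiv.Perm V,
    (∀ u v, (Γ.nodeGraph.map ι).Adj (e u) (e v) ↔ (Γ.nodeGraph.map ι).Adj u v) ∧
      ∀ v, pinned v → e v = pin v :=
  ⟨perm_of_induced ι (fun x => (hpinned x).1) hpin,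
    fun ⟨_, he, hp⟩ => induced_of_perm ι (fun x => (hpinned x).2) hpin he hp⟩

/-! ## Transpositions suffice -/

theorem Induced.mul {π π' : Equiv.Perm Γ.Player} (h : Γ.Induced π) (h' : Γ.Induced π') :
    Γ.Induced (π * π') := by
  obtain ⟨φ, hm, hu⟩ := h
  obtain ⟨φ', hm', hu'⟩ := h'
  have hmm : Γ.MapsPlayers (φ * φ') (π * π') := fun a => by
    simp only [Equiv.Perm.mul_apply]
    rw [hm, hm']
  refine ⟨φ * φ', hmm, fun i s => ?_⟩
  rw [hu' i s, hu]
  congr 1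
  symm
  rw [mapProfile_eq_iff]
  intro k
  simp only [Equiv.Perm.mul_apply]
  rw [(mapProfile_eq_iff hm' s _).1 rfl k, (mapProfile_eq_iff hm _ _).1 rfl (π' k)]

theorem allPlayerPermsInduced_iff_swap :
    Γ.AllPlayerPermsInduced ↔ ∀ i j, Γ.Induced (Equiv.swap i j) := by
  refine ⟨fun h i j => h _, fun h π => ?_⟩
  induction π using Equiv.Perm.swap_induction_on with
  | one => exact Γ.induced_one
  | swap_mul f x y _ ih => exact (h x y).mul ih

theorem mem_transpositions (i j : Γ.Player) : (i, j) ∈ Γ.transpositions ↔ i < j := by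
  simp [transpositions]

theorem allPlayerPermsInduced_iff_transpositions :
    Γ.AllPlayerPermsInduced ↔ ∀ p ∈ Γ.transpositions, Γ.Induced (Equiv.swap p.1 p.2) := by
  rw [allPlayerPermsInduced_iff_swap]
  constructor
  · exact fun h p _ => h _ _
  · intro h i j
    rcases lt_trichotomy i j with hij | rfl | hij
    · exact h (i, j) ((mem_transpositions i j).2 hij)
    · rw [Equiv.swap_self]
      exact Γ.induced_one
    · rw [Equiv.swap_comm]
      exact h (j, i) ((mem_transpositions j i).2 hij)

end Game

end GameSym
end

noncomputable section

namespace GameSym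

open Function

/-! ## Colours replaced by leaves -/

section

variable {V : Type} (A : SimpleGraph V) (c c' : V → ℕ) (Z : ℕ)

/-- The graph `A` on the vertices `(v, 0)`, with leaves `(v, 1), …, (v, c v + 2)` attached to
`(v, 0)`. -/
def leafGraph : SimpleGraph (V × Fin Z) where
  Adj x y := (x.2.val = 0 ∧ y.2.val = 0 ∧ A.Adj x.1 y.1) ∨
    (x.1 = y.1 ∧ x.2.val = 0 ∧ 1 ≤ y.2.val ∧ y.2.val ≤ c x.1 + 2) ∨
    (x.1 = y.1 ∧ y.2.val = 0 ∧ 1 ≤ x.2.val ∧ x.2.val ≤ c x.1 + 2)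
  symm := ⟨by
    rintro ⟨x, y⟩ ⟨x', y'⟩ (⟨h₁, h₂, h⟩ | ⟨rfl, h⟩ | ⟨rfl, h⟩)
    · exact Or.inl ⟨h₂, h₁, h.symm⟩
    · exact Or.inr (Or.inr ⟨rfl, h⟩)
    · exact Or.inr (Or.inl ⟨rfl, h⟩)⟩
  loopless := ⟨by
    rintro ⟨x, y⟩ (⟨_, _, h⟩ | ⟨_, h₁, h₂, _⟩ | ⟨_, h₁, h₂, _⟩)
    · exact A.loopless.irrefl _ h
    · simp_all
    · simp_all⟩

variable {A c c' Z}

theorem leafGraph_adj {x y : V × Fin Z} : (leafGraph A c Z).Adj x y ↔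
    (x.2.val = 0 ∧ y.2.val = 0 ∧ A.Adj x.1 y.1) ∨
    (x.1 = y.1 ∧ x.2.val = 0 ∧ 1 ≤ y.2.val ∧ y.2.val ≤ c x.1 + 2) ∨
    (x.1 = y.1 ∧ y.2.val = 0 ∧ 1 ≤ x.2.val ∧ x.2.val ≤ c x.1 + 2) := Iff.rfl

/-- Every original vertex carries at least two leaves, a leaf has a single neighbour, and the unused
pairs are isolated. So the original vertices are recognised by having two neighbours. -/
theorem leafGraph_snd_eq_zero_iff (hc : ∀ v, c v + 2 < Z) (x : V × Fin Z) : x.2.val = 0 ↔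
    ∃ y z, y ≠ z ∧ (leafGraph A c Z).Adj x y ∧ (leafGraph A c Z).Adj x z := by
  constructor
  · intro h
    have := hc x.1
    refine ⟨(x.1, ⟨1, by omega⟩), (x.1, ⟨2, by omega⟩), by simp, ?_, ?_⟩ <;>
      exact Or.inr (Or.inl ⟨rfl, h, by simp, by simp⟩)
  · rintro ⟨y, z, hyz, hy, hz⟩
    by_contra h
    simp only [leafGraph_adj, h, false_and, and_false, false_or] at hy hz
    exact hyz (Prod.ext (hy.1.symm.trans hz.1) (Fin.ext (hy.2.1.trans hz.2.1.symm)))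

theorem ncard_leaves (hc : ∀ v, c v + 2 < Z) {x : V × Fin Z} (hx : x.2.val = 0) :
    {y | (leafGraph A c Z).Adj x y ∧ y.2.val ≠ 0}.ncard = c x.1 + 2 := by
  have h : ∀ y : V × Fin Z, (leafGraph A c Z).Adj x y ∧ y.2.val ≠ 0 ↔
      x.1 = y.1 ∧ 1 ≤ y.2.val ∧ y.2.val ≤ c x.1 + 2 := by
    intro y
    rw [leafGraph_adj, hx]
    constructor
    · rintro ⟨⟨_, h, _⟩ | ⟨h, _, h'⟩ | ⟨_, h, _⟩, h₀⟩
      · exact absurd h h₀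
      · exact ⟨h, h'⟩
      · exact absurd h h₀
    · rintro ⟨h₁, h₂, h₃⟩
      exact ⟨Or.inr (Or.inl ⟨h₁, rfl, h₂, h₃⟩), by omega⟩
  simp only [h]
  have : (fun y : V × Fin Z => y.2.val) '' {y | x.1 = y.1 ∧ 1 ≤ y.2.val ∧ y.2.val ≤ c x.1 + 2} =
      (Finset.Icc 1 (c x.1 + 2) : Finset ℕ) := by
    ext z
    simp only [Set.mem_image, Set.mem_ofPred_eq, Finset.coe_Icc, Set.mem_Icc]
    constructor
    · rintro ⟨y, ⟨_, hy⟩, rfl⟩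
      exact hy
    · intro hz
      exact ⟨(x.1, ⟨z, hz.2.trans_lt (hc _)⟩), ⟨rfl, hz⟩, rfl⟩
  rw [← Set.InjOn.ncard_image (f := fun y : V × Fin Z => y.2.val), this,
    Set.ncard_coe_finset, Nat.card_Icc]
  · omega
  · rintro y ⟨hy, _⟩ y' ⟨hy', _⟩ h
    exact Prod.ext (hy.symm.trans hy') (Fin.ext h)

/-- An isomorphism preserves the set of original vertices, and the number of leaves at such a vertex
determines its colour. Conversely, equal colours mean leaves at the same positions, so `e` extends
by the identity on the second coordinate. -/
theorem leafGraph_iso_iff [Finite V] (hc : ∀ v, c v + 2 < Z) (hc' : ∀ v, c' v + 2 < Z) :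
    Nonempty (leafGraph A c Z ≃g leafGraph A c' Z) ↔
      ∃ e : Equiv.Perm V, (∀ u v, A.Adj (e u) (e v) ↔ A.Adj u v) ∧ ∀ v, c' (e v) = c v := by
  constructor
  · rintro ⟨f⟩
    have hf : ∀ x, (f x).2.val = 0 ↔ x.2.val = 0 := by
      intro x
      rw [leafGraph_snd_eq_zero_iff hc', leafGraph_snd_eq_zero_iff (A := A) hc]
      constructor
      · rintro ⟨y, z, hyz, hy, hz⟩
        refine ⟨f.symm y, f.symm z, fun h => hyz (f.symm.injective h), ?_, ?_⟩ <;>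
          rw [← f.map_adj_iff, f.apply_symm_apply] <;> assumption
      · rintro ⟨y, z, hyz, hy, hz⟩
        exact ⟨f y, f z, fun h => hyz (f.injective h), f.map_adj_iff.2 hy, f.map_adj_iff.2 hz⟩
    let o : V → Fin Z := fun v => ⟨0, by have := hc v; omega⟩
    have ho : ∀ v, f (v, o v) = ((f (v, o v)).1, o (f (v, o v)).1) := fun v =>
      Prod.ext rfl (Fin.ext ((hf _).2 rfl))
    have hinj : Injective fun v => (f (v, o v)).1 := by
      intro v w h
      have : f (v, o v) = f (w, o w) := by
        rw [ho v, ho w]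
        exact congrArg (fun u => (u, o u)) h
      exact (Prod.mk.inj (f.injective this)).1
    have hadj : ∀ c u v, (leafGraph A c Z).Adj (u, o u) (v, o v) ↔ A.Adj u v := by
      intro c u v
      simp [leafGraph_adj, o]
    refine ⟨Equiv.ofBijective _ (Finite.injective_iff_bijective.1 hinj), fun u v => ?_,
      fun v => ?_⟩
    · simp only [Equiv.ofBijective_apply]
      rw [← hadj c', ← ho, ← ho, f.map_adj_iff, hadj]
    · simp only [Equiv.ofBijective_apply]
      have h₁ := ncard_leaves (A := A) hc (x := (v, o v)) rfl
      have h₂ := ncard_leaves (A := A) hc' (x := f (v, o v)) ((hf _).2 rfl)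
      rw [← Set.ncard_image_of_injective _ f.injective] at h₁
      have : f '' {y | (leafGraph A c Z).Adj (v, o v) y ∧ y.2.val ≠ 0} =
          {y | (leafGraph A c' Z).Adj (f (v, o v)) y ∧ y.2.val ≠ 0} := by
        ext y
        obtain ⟨y, rfl⟩ := f.surjective y
        rw [f.injective.mem_set_image]
        simp only [Set.mem_ofPred_eq, f.map_adj_iff, ne_eq, hf]
      rw [this, h₂] at h₁
      simpa using h₁
  · rintro ⟨e, he, hec⟩
    refine ⟨⟨Equiv.prodCongr e (Equiv.refl _), fun {x y} => ?_⟩⟩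
    simp only [leafGraph_adj, Equiv.prodCongr_apply, Prod.map_fst, Prod.map_snd, Equiv.refl_apply,
      hec, he, e.injective.eq_iff]

/-! ### Disjoint copies and colours for prescribed images -/

variable (A) in
/-- Disjoint copies of a graph. -/
def copies (Q : ℕ) : SimpleGraph (Fin Q × V) where
  Adj x y := x.1 = y.1 ∧ A.Adj x.2 y.2
  symm := ⟨fun _ _ h => ⟨h.1.symm, h.2.symm⟩⟩
  loopless := ⟨fun _ h => A.loopless.irrefl _ h.2⟩

open Classical in
/-- The colour `v` in the `q`-th copy, if `v` is pinned; otherwise a colour that only depends on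
the copy. -/
def copyColor {n : ℕ} (pinned : Fin n → Prop) (q : ℕ) (u v : Fin n) : ℕ :=
  q * (n + 1) + if pinned u then v.val + 1 else 0

theorem copyColor_lt {n : ℕ} (pinned : Fin n → Prop) {Q q : ℕ} (hq : q < Q) (u v : Fin n) :
    copyColor pinned q u v + 2 < Q * (n + 1) + 3 := by
  have : (q + 1) * (n + 1) ≤ Q * (n + 1) := Nat.mul_le_mul_right _ hq
  have := v.2
  rw [Nat.succ_mul] at *
  unfold copyColor
  split_ifs <;> omega

theorem copyColor_eq_iff {n : ℕ} {pinned : Fin n → Prop} {q q' : ℕ} {u v u' v' : Fin n} :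
    copyColor pinned q u v = copyColor pinned q' u' v' ↔
      q = q' ∧ (pinned u ↔ pinned u') ∧ (pinned u → v = v') := by
  have hv := v.2
  have hv' := v'.2
  constructor
  · intro h
    unfold copyColor at h
    have hr : ∀ (p : Prop) [Decidable p] (w : Fin n), (if p then w.val + 1 else 0) < n + 1 := by
      intro p _ w
      split_ifs <;> omega
    have hq : q = q' := by
      have := congrArg (· / (n + 1)) h
      simpa [Nat.mul_comm _ (n + 1), Nat.mul_add_div, Nat.div_eq_of_lt (hr _ _)] using this
    subst hq
    refine ⟨rfl, ?_⟩
    by_cases h₁ : pinned u <;> by_cases h₂ : pinned u' <;> simp_all [Fin.ext_iff]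
  · rintro ⟨rfl, h₁, h₂⟩
    unfold copyColor
    by_cases h : pinned u
    · rw [if_pos h, if_pos (h₁.1 h), h₂ h]
    · rw [if_neg h, if_neg (fun h' => h (h₁.2 h'))]

/-- The colour determines the copy, so a colour-preserving automorphism splits into one for each
copy. At a pinned vertex, equality of colours says `pin q (e v) = v`, which is the prescription `e v
= pin q v` because `pin q` is an involution. -/
theorem copies_color_iff {n Q : ℕ} {A : SimpleGraph (Fin n)} {pinned : Fin n → Prop}
    {pin : Fin Q → Fin n → Fin n} (hpin : ∀ q, Involutive (pin q))
    (hpinned : ∀ q v, pinned (pin q v) ↔ pinned v) :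
    (∃ e : Equiv.Perm (Fin Q × Fin n),
      (∀ u v, (copies A Q).Adj (e u) (e v) ↔ (copies A Q).Adj u v) ∧
      ∀ x, copyColor pinned (e x).1 (e x).2 (pin (e x).1 (e x).2) =
        copyColor pinned x.1 x.2 x.2) ↔
    ∀ q, ∃ e : Equiv.Perm (Fin n), (∀ u v, A.Adj (e u) (e v) ↔ A.Adj u v) ∧
      ∀ v, pinned v → e v = pin q v := by
  simp only [copyColor_eq_iff, Fin.val_inj]
  constructor
  · rintro ⟨e, he, hec⟩ q
    have h₁ : ∀ v, e (q, v) = (q, (e (q, v)).2) := fun v => Prod.ext (hec (q, v)).1 rfl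
    have hinj : Injective fun v => (e (q, v)).2 := by
      intro v w h
      have : e (q, v) = e (q, w) := by rw [h₁ v, h₁ w]; exact congrArg _ h
      exact (Prod.mk.inj (e.injective this)).2
    refine ⟨Equiv.ofBijective _ (Finite.injective_iff_bijective.1 hinj), fun u v => ?_,
      fun v hv => ?_⟩
    · have := he (q, u) (q, v)
      rw [h₁ u, h₁ v] at this
      simpa [copies] using this
    · obtain ⟨h₂, h₃, h₄⟩ := hec (q, v)
      have := h₄ (h₃.2 hv)
      rw [h₂] at this
      exact (hpin q).injective (this.trans (hpin q v).symm)
  · intro h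
    choose e he hp using h
    refine ⟨⟨fun x => (x.1, e x.1 x.2), fun x => (x.1, (e x.1).symm x.2), fun x => by simp,
      fun x => by simp⟩, fun u v => ?_, fun x => ?_⟩
    · obtain ⟨q, u⟩ := u
      obtain ⟨q', v⟩ := v
      simp only [copies, Equiv.coe_fn_mk]
      refine and_congr_right fun h => ?_
      subst h
      exact he _ _ _
    · obtain ⟨q, v⟩ := x
      simp only [Equiv.coe_fn_mk, true_and]
      have hv : pinned (e q v) ↔ pinned v := by
        constructor
        · intro h
          -- If `e q v` is pinned, so is `pin q (e q v)`; its prescribed image is `e q v`, hence it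
          -- equals `v`, and `v` is pinned.
          have h' := hp q (pin q (e q v)) ((hpinned _ _).2 h)
          rw [hpin q] at h'
          rwa [← (e q).injective h', hpinned]
        · intro h
          rw [hp q v h, hpinned]
          exact h
      exact ⟨hv, fun h => by rw [hp q v (hv.1 h), hpin q]⟩

end

end GameSym
end

noncomputable section

namespace GameSym

open Function Computability

/-! ## Mixed radix digits -/

/-- The function `m`, extended by zero to the natural numbers. -/
def extend {N : ℕ} (m : Fin N → ℕ) (i : ℕ) : ℕ := if h : i < N then m ⟨i, h⟩ else 0

theorem extend_coe {N : ℕ} (m : Fin N → ℕ) (k : Fin N) : extend m k = m k := by simp [extend]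

/-- The product of the last `i` values of `m`. -/
def tailProd {N : ℕ} (m : Fin N → ℕ) (i : ℕ) : ℕ := ∏ j ∈ Finset.range i, extend m (N - 1 - j)

theorem tailProd_succ {N : ℕ} (m : Fin (N + 1) → ℕ) {i : ℕ} (hi : i ≤ N) :
    tailProd m i = tailProd (fun k => m k.succ) i := by
  refine Finset.prod_congr rfl fun j hj => ?_
  have hj : j < N := (Finset.mem_range.1 hj).trans_le hi
  have h : N - j = N - 1 - j + 1 := by omega
  simp only [extend, Nat.add_sub_cancel, h]
  rw [dif_pos (by omega), dif_pos (by omega)]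
  rfl

theorem tailProd_full_succ {N : ℕ} (m : Fin (N + 1) → ℕ) :
    tailProd m (N + 1) = m 0 * tailProd (fun k => m k.succ) N := by
  rw [← tailProd_succ m le_rfl, tailProd, Finset.prod_range_succ, mul_comm, ← tailProd]
  simp [extend]

theorem tailProd_dvd {N : ℕ} (m : Fin N → ℕ) {i j : ℕ} (h : i ≤ j) :
    tailProd m i ∣ tailProd m j :=
  Finset.prod_dvd_prod_of_subset _ _ _ (Finset.range_mono h)

theorem length_allProfiles : ∀ (N : ℕ) (m : Fin N → ℕ),
    (Game.allProfiles N m).length = tailProd m N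
  | 0, m => by simp [Game.allProfiles, tailProd]
  | N + 1, m => by
    simp [Game.allProfiles, length_allProfiles N, tailProd_full_succ]

theorem nodup_allProfiles : ∀ (N : ℕ) (m : Fin N → ℕ), (Game.allProfiles N m).Nodup
  | 0, m => by simp [Game.allProfiles]
  | N + 1, m => by
    rw [Game.allProfiles, List.nodup_flatMap]
    refine ⟨fun a _ => (nodup_allProfiles N _).map fun s t h => (Fin.cons_inj.1 h).2, ?_⟩
    refine (List.nodup_finRange _).imp fun {a b} hab => ?_
    rw [Function.onFun, List.disjoint_left]
    simp only [List.mem_map, not_exists, not_and]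
    rintro _ ⟨s, _, rfl⟩ t _ h
    exact hab (Fin.cons_inj.1 h).1.symm

/-- In lexicographic order the position is a mixed radix numeral whose leading digit is the action
of the first player; the weight of a digit is the product of the numbers of actions of all later
players. -/
theorem val_of_getElem?_allProfiles : ∀ (N : ℕ) (m : Fin N → ℕ) (c : ℕ) (s : ∀ i, Fin (m i)),
    (Game.allProfiles N m)[c]? = some s →
      ∀ k : Fin N, (s k).val = c / tailProd m (N - 1 - k) % m k
  | 0, _, _, _, _ => fun k => k.elim0
  | N + 1, m, c, s, h => by
    have hc : c < tailProd m (N + 1) := by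
      rw [← length_allProfiles]
      exact (List.getElem?_eq_some_iff.1 h).1
    rw [tailProd_full_succ] at hc
    set T := tailProd (fun k => m k.succ) N with hT
    have hT₀ : 0 < T := Nat.pos_of_ne_zero fun h => by simp [h] at hc
    rw [Game.allProfiles, ← Nat.div_add_mod' c T, getElem?_flatMap_of_length (c := T) _
      (by simp [length_allProfiles, hT]) (Nat.mod_lt _ hT₀)] at h
    obtain ⟨a, ha, h⟩ := Option.bind_eq_some_iff.1 h
    rw [List.getElem?_map] at h
    obtain ⟨s', hs', rfl⟩ := Option.map_eq_some_iff.1 h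
    have ih := val_of_getElem?_allProfiles N _ _ _ hs'
    intro k
    induction k using Fin.cases with
    | zero =>
      obtain ⟨_, ha⟩ := List.getElem?_eq_some_iff.1 ha
      have ha : a.val = c / T := by simp [← ha]
      simp only [Fin.cons_zero, Fin.val_zero, Nat.add_sub_cancel, Nat.sub_zero]
      rw [tailProd_succ m le_rfl, ← hT, ← ha, Nat.mod_eq_of_lt a.2]
    | succ k =>
      simp only [Fin.cons_succ, Fin.val_succ, Nat.add_sub_cancel]
      have hk : N - (k + 1) = N - 1 - k := by omega
      rw [ih, hk, tailProd_succ m (by omega)]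
      set P := tailProd (fun k => m k.succ) (N - 1 - k) with hP
      -- Since the weight times the radix divides `T`, the digits of `c % T` are those of `c`.
      have hd : P * m k.succ ∣ T := by
        have h₁ : tailProd (fun k => m k.succ) (N - 1 - k + 1) = P * m k.succ := by
          rw [tailProd, Finset.prod_range_succ, ← tailProd, ← hP]
          congr 1
          have : N - 1 - (N - 1 - k.val) = k := by omega
          rw [this, extend_coe]
        rw [← h₁]
        exact tailProd_dvd _ (by omega)
      obtain ⟨r, hr⟩ := hd
      rw [hr, mul_assoc, Nat.mod_mul_right_div_self, Nat.mod_mul_right_mod]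

/-! ## Reading games -/

theorem mul_length_le_length_flatMap {ι X : Type*} {f : ι → List X} {c : ℕ}
    (hf : ∀ i, c ≤ (f i).length) (l : List ι) : l.length * c ≤ (l.flatMap f).length := by
  induction l with
  | nil => simp
  | cons i l ih =>
    have := hf i
    simp only [List.length_cons, List.flatMap_cons, List.length_append, Nat.succ_mul]
    omega

namespace Game

variable (Γ : Game)

/-- The number of actions of the player `k`. -/
def acts (k : ℕ) : ℕ := extend Γ.numActions k

/-- The number of profiles. -/
def numProfiles : ℕ := tailProd Γ.numActions Γ.numPlayers

/-- The action of the player `k` at the `c`-th profile. -/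
def digit (c k : ℕ) : ℕ := c / tailProd Γ.numActions (Γ.numPlayers - 1 - k) % Γ.acts k

/-- The position of a profile in the list of all profiles. -/
def index (s : Γ.Profile) : ℕ := (allProfiles Γ.numPlayers Γ.numActions).idxOf s

variable {Γ}

theorem index_lt (s : Γ.Profile) : Γ.index s < Γ.numProfiles := by
  rw [numProfiles, ← length_allProfiles]
  exact List.idxOf_lt_length_of_mem (mem_allProfiles _ _ s)

theorem getElem?_index (s : Γ.Profile) :
    (allProfiles Γ.numPlayers Γ.numActions)[Γ.index s]? = some s :=
  List.getElem?_idxOf (mem_allProfiles _ _ s)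

theorem index_injective : Injective Γ.index := fun s t h => by
  have := getElem?_index s
  rw [h, getElem?_index] at this
  exact (Option.some.inj this).symm

theorem exists_index_eq {c : ℕ} (hc : c < Γ.numProfiles) : ∃ s, Γ.index s = c := by
  rw [numProfiles, ← length_allProfiles] at hc
  exact ⟨_, (nodup_allProfiles _ _).idxOf_getElem c hc⟩

theorem digit_index (s : Γ.Profile) (k : Γ.Player) : Γ.digit (Γ.index s) k = s k := by
  rw [digit, acts, extend_coe]
  exact (val_of_getElem?_allProfiles _ _ _ _ (getElem?_index s) k).symm

theorem acts_coe (k : Γ.Player) : Γ.acts k = Γ.numActions k := extend_coe _ _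

theorem tailProd_pos {i : ℕ} (hi : i ≤ Γ.numPlayers) : 0 < tailProd Γ.numActions i := by
  refine Finset.prod_pos fun j hj => ?_
  have := Finset.mem_range.1 hj
  rw [extend, dif_pos (by omega)]
  exact Γ.numActions_pos _

theorem numProfiles_pos : 0 < Γ.numProfiles := tailProd_pos le_rfl

theorem tailProd_le {i : ℕ} (hi : i ≤ Γ.numPlayers) :
    tailProd Γ.numActions i ≤ Γ.numProfiles :=
  Nat.le_of_dvd numProfiles_pos (tailProd_dvd _ hi)

theorem acts_le {k : ℕ} (hk : k < Γ.numPlayers) : Γ.acts k ≤ Γ.numProfiles := by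
  refine Nat.le_of_dvd numProfiles_pos ?_
  have : Γ.acts k = extend Γ.numActions (Γ.numPlayers - 1 - (Γ.numPlayers - 1 - k)) := by
    rw [acts]
    congr 1
    omega
  rw [this]
  exact Finset.dvd_prod_of_mem (fun j => extend Γ.numActions (Γ.numPlayers - 1 - j))
    (Finset.mem_range.2 (by omega))

/-- The table has an entry for every profile and player, so the input is longer than all quantities
over which the algorithms loop, although the number of profiles may be exponential in the number of
players. -/
theorem length_encode : Γ.numPlayers + Γ.numProfiles * Γ.numPlayers < Γ.encode.length := by
  have : Γ.numProfiles * Γ.numPlayers ≤ ((allProfiles Γ.numPlayers Γ.numActions).flatMap fun s =>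
      (List.finRange Γ.numPlayers).flatMap fun i => encodeRat (Γ.payoff i s)).length := by
    rw [numProfiles, ← length_allProfiles]
    refine mul_length_le_length_flatMap (fun s => ?_) _
    have := mul_length_le_length_flatMap (c := 1) (f := fun i => encodeRat (Γ.payoff i s))
      (fun i => by simp [encodeRat]) (List.finRange Γ.numPlayers)
    simpa using this
  simp only [encode, List.length_append]
  have : (encodeUnary Γ.numPlayers).length = Γ.numPlayers + 1 := by simp [encodeUnary, encodeBits]
  omega

theorem numProfiles_le : Γ.numProfiles ≤ Γ.encode.length := by
  have := length_encode (Γ := Γ)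
  rcases Nat.eq_zero_or_pos Γ.numPlayers with h | h
  · have : Γ.numProfiles = 1 := by simp [numProfiles, tailProd, h]
    omega
  · nlinarith

variable (Γ) in
/-- The comma-free blocks of the code of a game. -/
def blocks : List (List Γ') :=
  List.replicate Γ.numPlayers (Γ'.bit true) ::
    ((List.finRange Γ.numPlayers).map (fun i => List.replicate (Γ.numActions i) (Γ'.bit true)) ++
      (allProfiles Γ.numPlayers Γ.numActions).flatMap fun s =>
        (List.finRange Γ.numPlayers).flatMap fun i =>
          [Γ'.bit (decide ((Γ.payoff i s).num < 0)) ::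
              (encodeNat (Γ.payoff i s).num.natAbs).map Γ'.bit,
            (encodeNat (Γ.payoff i s).den).map Γ'.bit])

theorem encode_eq_blocks : Γ.encode = Γ.blocks.flatMap fun w => w ++ [Γ'.comma] := by
  simp [encode, blocks, encodeUnary, encodeBits, encodeRat, encodeBinary, List.flatMap_assoc,
    List.flatMap_map]

theorem comma_notMem_blocks : ∀ w ∈ Γ.blocks, Γ'.comma ∉ w := by
  intro w hw
  simp only [blocks, List.mem_cons, List.mem_append, List.mem_map, List.mem_flatMap,
    List.not_mem_nil, or_false] at hw
  rcases hw with rfl | ⟨_, _, rfl⟩ | ⟨_, _, _, _, rfl | rfl⟩ <;> simp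

theorem token_encode (i : ℕ) : token Γ.encode i = Γ.blocks[i]?.getD [] := by
  rw [encode_eq_blocks, token_flatMap comma_notMem_blocks]

theorem token_encode_acts (k : Γ.Player) :
    token Γ.encode (1 + k) = List.replicate (Γ.numActions k) (Γ'.bit true) := by
  rw [token_encode, blocks, Nat.add_comm, List.getElem?_cons_succ, List.getElem?_append_left
    (by simp)]
  simp

theorem token_encode_payoff (s : Γ.Profile) (l : Γ.Player) {b : ℕ} (hb : b < 2) :
    token Γ.encode (1 + Γ.numPlayers + ((Γ.index s * Γ.numPlayers + l) * 2 + b)) =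
      [Γ'.bit (decide ((Γ.payoff l s).num < 0)) ::
          (encodeNat (Γ.payoff l s).num.natAbs).map Γ'.bit,
        (encodeNat (Γ.payoff l s).den).map Γ'.bit][b]?.getD [] := by
  have hl := l.2
  rw [token_encode, blocks, Nat.add_assoc, Nat.add_comm, List.getElem?_cons_succ,
    List.getElem?_append_right (by simp)]
  simp only [List.length_map, List.length_finRange, Nat.add_sub_cancel_left]
  have : (Γ.index s * Γ.numPlayers + l) * 2 + b =
      Γ.index s * (Γ.numPlayers * 2) + (l * 2 + b) := by ring
  rw [this, getElem?_flatMap_of_length _ (by simp [List.length_flatMap]) (by omega),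
    getElem?_index, Option.bind_some, getElem?_flatMap_of_length _ (by simp) hb]
  simp

variable (Γ) in
/-- The payoffs at the positions `c` and `c'` of the payoff table agree. -/
def SamePayoff (c c' : ℕ) : Prop := ∀ b < 2,
  token Γ.encode (1 + Γ.numPlayers + (c * 2 + b)) = token Γ.encode (1 + Γ.numPlayers + (c' * 2 + b))

/-- Payoffs are compared as strings: each occupies two comma-free blocks, and the code of a rational
number is injective. No rational arithmetic is needed. -/
theorem samePayoff_iff (k l : Γ.Player) (s t : Γ.Profile) :
    Γ.SamePayoff (Γ.index s * Γ.numPlayers + k) (Γ.index t * Γ.numPlayers + l) ↔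
      Γ.payoff k s = Γ.payoff l t := by
  constructor
  · intro h
    apply encodeRat_selfDelimiting.injective
    have h₀ := h 0 (by omega)
    have h₁ := h 1 (by omega)
    rw [token_encode_payoff _ _ (by omega), token_encode_payoff _ _ (by omega)] at h₀ h₁
    simp only [List.getElem?_cons_zero, List.getElem?_cons_succ, Option.getD_some] at h₀ h₁
    simp only [encodeRat, encodeBinary, encodeBits, h₁, ← List.cons_append, ← List.append_assoc, h₀]
  · intro h b hb
    rw [token_encode_payoff _ _ hb, token_encode_payoff _ _ hb, h]

end Game

open Game

section

variable {α : Type} [Data α] {f : α → Game} {i j : α → ℕ}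

theorem PT.encode (hf : PT f) : PT fun x => (f x).encode := hf.str_of

theorem PT.numPlayers (hf : PT f) : PT fun x => (f x).numPlayers :=
  (PT.length (PT.token hf.encode (PT.const 0))).congr fun x => by
    simp [token_encode, blocks]

theorem PT.acts (hf : PT f) (hi : PT i) : PT fun x => (f x).acts (i x) :=
  (PT.ite (hi.lt hf.numPlayers) (PT.length (PT.token hf.encode ((PT.const 1).add hi)))
    (PT.const 0)).congr fun x => by
      split_ifs with h
      · rw [token_encode_acts ⟨i x, h⟩, ← acts_coe]
        simp
      · rw [Game.acts, extend, dif_neg h]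

/-- The restriction on `i` keeps every partial product below the number of profiles, and so below
the input length, as bounded recursion requires. -/
theorem PT.tailProd (hf : PT f) (hi : PT i) (h : ∀ x, i x ≤ (f x).numPlayers) :
    PT fun x => tailProd (f x).numActions (i x) := by
  have ⟨P, _, hP⟩ := hf
  refine PT.recursion_nat (R := fun x i => GameSym.tailProd (f x).numActions i)
    (h := fun p : (α × ℕ) × ℕ => p.2 * (f p.1.1).acts ((f p.1.1).numPlayers - 1 - p.1.2))
    ?_ (PT.const 1) hi P (fun _ => rfl) (fun x i => Finset.prod_range_succ _ _) fun x i hi => ?_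
  · have h₁ := hf.rearrange (φ := fun p : (α × ℕ) × ℕ => p.1.1) Rearranges.id.fst.fst
    exact (PT.proj Rearranges.id.snd).mul (h₁.acts
      ((h₁.numPlayers.sub (PT.const 1)).sub (PT.proj Rearranges.id.fst.snd)))
  · rw [str_nat, List.length_replicate]
    exact (tailProd_le (hi.trans (h x))).trans (numProfiles_le.trans (hP x))

theorem PT.numProfiles (hf : PT f) : PT fun x => (f x).numProfiles :=
  hf.tailProd hf.numPlayers fun _ => le_rfl

theorem PT.digit (hf : PT f) (hi : PT i) (hj : PT j) : PT fun x => (f x).digit (i x) (j x) :=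
  (hi.div (hf.tailProd ((hf.numPlayers.sub (PT.const 1)).sub hj) fun x => by omega)).mod
    (hf.acts hj)

theorem PT.getElem?_eq {f g : α → List Γ'} (hf : PT f) (hg : PT g) (hi : PT i) :
    PT fun x => (f x)[i x]? = (g x)[i x]? := by
  refine (PT.cases (f := fun o x => o = (g x)[i x]?) (fun o => ?_) (hf.drop hi)).congr fun x => by
    simp [List.head?_drop]
  cases o with
  | none => exact (hg.length.le hi).congr fun x => by simp
  | some c => exact (hg.getElem hi c).congr fun x => propext eq_comm

theorem PT.eq_list {f g : α → List Γ'} (hf : PT f) (hg : PT g) : PT fun x => f x = g x := by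
  refine (PT.forall_lt (p := fun x i => (f x)[i]? = (g x)[i]?) (hf.length.add hg.length)
    ((hf.rearrange Rearranges.id.fst).getElem?_eq (hg.rearrange Rearranges.id.fst)
      (PT.proj Rearranges.id.snd))).congr fun x => propext ⟨fun h => ?_, fun h i _ => by rw [h]⟩
  refine List.ext_getElem? fun i => ?_
  by_cases hi : i < (f x).length + (g x).length
  · exact h i hi
  · rw [List.getElem?_eq_none (by omega), List.getElem?_eq_none (by omega)]

theorem PT.samePayoff (hf : PT f) (hi : PT i) (hj : PT j) :
    PT fun x => (f x).SamePayoff (i x) (j x) := by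
  have h : ∀ {k : α → ℕ}, PT k → PT fun p : α × ℕ =>
      GameSym.token (f p.1).encode (1 + (f p.1).numPlayers + (k p.1 * 2 + p.2)) := fun {k} hk =>
    PT.token (hf.rearrange Rearranges.id.fst).encode (((PT.const 1).add
      (hf.numPlayers.rearrange Rearranges.id.fst)).add (((hk.rearrange Rearranges.id.fst).mul
        (PT.const 2)).add (PT.proj Rearranges.id.snd)))
  exact PT.forall_lt (p := fun x b => GameSym.token (f x).encode _ = GameSym.token (f x).encode _)
    (PT.const 2) ((h hi).eq_list (h hj))

end

end GameSym
end

noncomputable section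

namespace GameSym

open Function

/-! ## Coding triples -/

theorem mul_add_mod_of_lt {B a b : ℕ} (hb : b < B) : (a * B + b) % B = b := by
  rw [Nat.mul_add_mod_self_right, Nat.mod_eq_of_lt hb]

/-- The code of the triple `(t, a, b)` of numbers below `B`. -/
def triple (B t a b : ℕ) : ℕ := (t * B + a) * B + b

section

variable {B t a b : ℕ}

theorem triple_mod (hb : b < B) : triple B t a b % B = b := by
  rw [triple, mul_add_mod_of_lt hb]

theorem triple_div (hb : b < B) : triple B t a b / B = t * B + a := by
  rw [triple, Nat.mul_comm, Nat.mul_add_div (by omega), Nat.div_eq_of_lt hb, Nat.add_zero]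

theorem triple_div_mod (ha : a < B) (hb : b < B) : triple B t a b / B % B = a := by
  rw [triple_div hb, mul_add_mod_of_lt ha]

theorem triple_div_div (ha : a < B) (hb : b < B) : triple B t a b / B / B = t := by
  rw [triple_div hb, Nat.mul_comm, Nat.mul_add_div (by omega), Nat.div_eq_of_lt ha, Nat.add_zero]

theorem triple_of_div_mod (u : ℕ) : triple B (u / B / B) (u / B % B) (u % B) = u := by
  rw [triple, Nat.div_add_mod', Nat.div_add_mod']

theorem triple_lt (ht : t < B) (ha : a < B) (hb : b < B) : triple B t a b < B * B * B := by
  rw [triple]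
  have h₁ : t * B + a < B * B := by
    have : (t + 1) * B ≤ B * B := Nat.mul_le_mul_right _ ht
    rw [Nat.succ_mul] at this
    omega
  have : (t * B + a + 1) * B ≤ B * B * B := Nat.mul_le_mul_right _ h₁
  rw [Nat.succ_mul] at this
  omega

theorem PT.triple {α : Type} [Data α] {B t a b : α → ℕ} (hB : PT B) (ht : PT t) (ha : PT a)
    (hb : PT b) : PT fun x => triple (B x) (t x) (a x) (b x) :=
  (((ht.mul hB).add ha).mul hB).add hb

end

/-! ## Coding the graph of a game -/

namespace Game

variable (Γ : Game)

/-- A bound for the numbers that occur in the codes of vertices. -/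
def bound : ℕ := Γ.encode.length + 4

/-- The order of the coded graph of a game. -/
def order : ℕ := Γ.bound * Γ.bound * Γ.bound

variable {Γ}

theorem lt_bound {k : ℕ} (hk : k < Γ.numPlayers) : k < Γ.bound := by
  have := length_encode (Γ := Γ)
  unfold bound
  omega

theorem lt_bound_of_lt_acts {k : ℕ} (hk : k < Γ.numPlayers) {a : ℕ} (ha : a < Γ.acts k) :
    a < Γ.bound := by
  have := acts_le hk
  have := numProfiles_le (Γ := Γ)
  unfold bound
  omega

theorem lt_bound_of_lt_numProfiles {c : ℕ} (hc : c < Γ.numProfiles) : c < Γ.bound := by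
  have := numProfiles_le (Γ := Γ)
  unfold bound
  omega

theorem lt_bound_of_lt_mul {c : ℕ} (hc : c < Γ.numProfiles * Γ.numPlayers) : c < Γ.bound := by
  have := length_encode (Γ := Γ)
  unfold bound
  omega

theorem index_mul_add_lt (s : Γ.Profile) (l : Γ.Player) :
    Γ.index s * Γ.numPlayers + l < Γ.numProfiles * Γ.numPlayers := by
  have : (Γ.index s + 1) * Γ.numPlayers ≤ Γ.numProfiles * Γ.numPlayers :=
    Nat.mul_le_mul_right _ (index_lt s)
  rw [Nat.succ_mul] at this
  have := l.2
  omega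

theorem exists_index_mul_add {c : ℕ} (hc : c < Γ.numProfiles * Γ.numPlayers) :
    ∃ s l, c = Γ.index s * Γ.numPlayers + (l : Γ.Player).val := by
  have hN : 0 < Γ.numPlayers := Nat.pos_of_ne_zero fun h => by simp [h] at hc
  obtain ⟨s, hs⟩ := exists_index_eq (Nat.div_lt_of_lt_mul (Nat.mul_comm _ _ ▸ hc))
  exact ⟨s, ⟨c % Γ.numPlayers, Nat.mod_lt _ hN⟩, by rw [hs, Nat.div_add_mod']⟩

theorem index_mul_add_inj {s t : Γ.Profile} {l k : Γ.Player}
    (h : Γ.index s * Γ.numPlayers + l = Γ.index t * Γ.numPlayers + k) : s = t ∧ l = k := by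
  have h₁ := congrArg (· % Γ.numPlayers) h
  simp only [mul_add_mod_of_lt l.2, mul_add_mod_of_lt k.2] at h₁
  refine ⟨index_injective ?_, Fin.ext h₁⟩
  rw [h₁] at h
  exact Nat.eq_of_mul_eq_mul_right (Nat.zero_lt_of_lt l.2) (Nat.add_right_cancel h)

/-- The kind of a vertex. -/
def Node.kind : Γ.Node → ℕ
  | .player _ => 0
  | .action _ => 1
  | .profile _ => 2
  | .cell _ _ _ => 3

/-- The first parameter of a vertex. -/
def Node.major : Γ.Node → ℕ
  | .player k => k
  | .action x => x.1
  | .profile s => Γ.index s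
  | .cell k _ _ => k

/-- The second parameter of a vertex. -/
def Node.minor : Γ.Node → ℕ
  | .player _ => 0
  | .action x => x.2
  | .profile _ => 0
  | .cell _ s l => Γ.index s * Γ.numPlayers + l

/-- The summand 4 in `bound` makes room for the four kinds. -/
theorem Node.kind_lt (x : Γ.Node) : x.kind < Γ.bound := by
  cases x <;> simp only [kind, bound] <;> omega

theorem Node.major_lt (x : Γ.Node) : x.major < Γ.bound := by
  cases x
  · exact lt_bound (Fin.is_lt _)
  · exact lt_bound (Fin.is_lt _)
  · exact lt_bound_of_lt_numProfiles (index_lt _)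
  · exact lt_bound (Fin.is_lt _)

theorem Node.minor_lt (x : Γ.Node) : x.minor < Γ.bound := by
  cases x with
  | player k => exact (Nat.succ_pos _)
  | action x => exact lt_bound_of_lt_acts x.1.2 (by rw [acts_coe]; exact x.2.2)
  | profile s => exact (Nat.succ_pos _)
  | cell k s l => exact lt_bound_of_lt_mul (index_mul_add_lt s l)

theorem Node.ext_code {x y : Γ.Node} (h₁ : x.kind = y.kind) (h₂ : x.major = y.major)
    (h₃ : x.minor = y.minor) : x = y := by
  cases x <;> cases y <;> simp only [kind, major, minor] at h₁ h₂ h₃ <;> try omega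
  · rw [Fin.ext h₂]
  · rename_i x y
    rw [Sigma.ext (Fin.ext h₂) ((Fin.heq_ext_iff (congrArg Γ.numActions (Fin.ext h₂))).2 h₃)]
  · rw [index_injective h₂]
  · obtain ⟨rfl, rfl⟩ := index_mul_add_inj h₃
    rw [Fin.ext h₂]

theorem Node.code_lt (x : Γ.Node) : triple Γ.bound x.kind x.major x.minor < Γ.order :=
  triple_lt x.kind_lt x.major_lt x.minor_lt

variable (Γ) in
/-- The vertices of the graph of a game, coded by numbers. -/
def code : Γ.Node ↪ Fin Γ.order where
  toFun x := ⟨triple Γ.bound x.kind x.major x.minor, x.code_lt⟩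
  inj' x y h := by
    have h : triple _ _ _ _ = triple _ _ _ _ := Fin.val_eq_of_eq h
    have ha := x.major_lt
    have hb := x.minor_lt
    have ha' := y.major_lt
    have hb' := y.minor_lt
    refine Node.ext_code ?_ ?_ ?_
    · rw [← triple_div_div (t := x.kind) ha hb, h, triple_div_div ha' hb']
    · rw [← triple_div_mod (t := x.kind) ha hb, h, triple_div_mod ha' hb']
    · rw [← triple_mod (t := x.kind) (a := x.major) hb, h, triple_mod hb']

theorem code_val (x : Γ.Node) : (Γ.code x).val = triple Γ.bound x.kind x.major x.minor := rfl

variable (Γ) in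
/-- The edges of the coded graph. -/
def LinkCode (t a b t' a' b' : ℕ) : Prop :=
  (t = 0 ∧ t' = 1 ∧ a < Γ.numPlayers ∧ b = 0 ∧ a' = a ∧ b' < Γ.acts a) ∨
  (t = 1 ∧ t' = 2 ∧ a < Γ.numPlayers ∧ a' < Γ.numProfiles ∧ b' = 0 ∧ b = Γ.digit a' a) ∨
  (t = 2 ∧ t' = 3 ∧ a < Γ.numProfiles ∧ b = 0 ∧ a' < Γ.numPlayers ∧
    b' < Γ.numProfiles * Γ.numPlayers ∧ Γ.SamePayoff (a * Γ.numPlayers + a') b')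

/-- `LinkCode` checks the ranges of all parameters, so numbers that code no vertex are isolated. -/
theorem linkCode_iff {t a b t' a' b' : ℕ} : Γ.LinkCode t a b t' a' b' ↔ ∃ x y : Γ.Node,
    Link x y ∧ (x.kind = t ∧ x.major = a ∧ x.minor = b) ∧
      (y.kind = t' ∧ y.major = a' ∧ y.minor = b') := by
  constructor
  · rintro (⟨rfl, rfl, ha, rfl, rfl, hb⟩ | ⟨rfl, rfl, ha, ha', rfl, rfl⟩ |
      ⟨rfl, rfl, ha, rfl, ha', hb', h⟩)
    · refine ⟨.player ⟨a', ha⟩, .action ⟨⟨a', ha⟩, ⟨b', ?_⟩⟩, rfl, ⟨rfl, rfl, rfl⟩, rfl, rfl, rfl⟩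
      rwa [← acts_coe]
    · obtain ⟨s, rfl⟩ := exists_index_eq ha'
      exact ⟨.action ⟨⟨a, ha⟩, s ⟨a, ha⟩⟩, .profile s, rfl,
        ⟨rfl, rfl, (digit_index s ⟨a, ha⟩).symm⟩, rfl, rfl, rfl⟩
    · obtain ⟨s, rfl⟩ := exists_index_eq ha
      obtain ⟨s', l, rfl⟩ := exists_index_mul_add hb'
      exact ⟨.profile s, .cell ⟨a', ha'⟩ s' l, (samePayoff_iff ⟨a', ha'⟩ l s s').1 h,
        ⟨rfl, rfl, rfl⟩, rfl, rfl, rfl⟩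
  · rintro ⟨x, y, h, ⟨rfl, rfl, rfl⟩, rfl, rfl, rfl⟩
    cases x <;> cases y <;> simp only [Link] at h
    · rename_i k x
      subst h
      exact Or.inl ⟨rfl, rfl, x.1.2, rfl, rfl, by rw [Node.major, acts_coe]; exact x.2.2⟩
    · rename_i x s
      refine Or.inr (Or.inl ⟨rfl, rfl, x.1.2, index_lt s, rfl, ?_⟩)
      simp only [Node.major, Node.minor]
      rw [digit_index, h]
    · rename_i s k s' l
      exact Or.inr (Or.inr ⟨rfl, rfl, index_lt s, rfl, k.2, index_mul_add_lt s' l,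
        (samePayoff_iff k l s s').2 h⟩)

variable (Γ) in
/-- The edges of the coded graph, in one direction. -/
def Arc (u v : ℕ) : Prop := Γ.LinkCode (u / Γ.bound / Γ.bound) (u / Γ.bound % Γ.bound)
  (u % Γ.bound) (v / Γ.bound / Γ.bound) (v / Γ.bound % Γ.bound) (v % Γ.bound)

theorem code_eq_iff {x : Γ.Node} {u : Fin Γ.order} : Γ.code x = u ↔
    x.kind = u / Γ.bound / Γ.bound ∧ x.major = u / Γ.bound % Γ.bound ∧
      x.minor = u % Γ.bound := by
  rw [← Fin.val_inj, code_val]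
  constructor
  · intro h
    rw [← h, triple_div_div x.major_lt x.minor_lt, triple_div_mod x.major_lt x.minor_lt,
      triple_mod x.minor_lt]
    exact ⟨rfl, rfl, rfl⟩
  · rintro ⟨h₁, h₂, h₃⟩
    rw [h₁, h₂, h₃, triple_of_div_mod]

theorem arc_iff {u v : Fin Γ.order} :
    Γ.Arc u v ↔ ∃ x y : Γ.Node, Link x y ∧ Γ.code x = u ∧ Γ.code y = v := by
  simp only [Arc, linkCode_iff, code_eq_iff]

theorem map_code_adj {u v : Fin Γ.order} :
    (Γ.nodeGraph.map Γ.code).Adj u v ↔ Γ.Arc u v ∨ Γ.Arc v u := by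
  rw [SimpleGraph.map_adj, arc_iff, arc_iff]
  constructor
  · rintro ⟨x, y, h | h, hx, hy⟩
    · exact Or.inl ⟨x, y, h, hx, hy⟩
    · exact Or.inr ⟨y, x, h, hy, hx⟩
  · rintro (⟨x, y, h, hx, hy⟩ | ⟨x, y, h, hx, hy⟩)
    · exact ⟨x, y, Or.inl h, hx, hy⟩
    · exact ⟨y, x, Or.inr h, hy, hx⟩

/-! ### Pinned codes and the action of a transposition -/

variable (Γ)

/-- The coded graph of a game. -/
def codedGraph : SimpleGraph (Fin Γ.order) := Γ.nodeGraph.map Γ.code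

/-- The coded graph of a game, bundled with its order. -/
def finGraph : FinGraph := ⟨Γ.order, Γ.codedGraph⟩

/-- The codes whose images are prescribed. -/
def Pinned (u : ℕ) : Prop := ¬(u / Γ.bound / Γ.bound = 1 ∨ u / Γ.bound / Γ.bound = 2)

open Classical in
/-- The action of a transposition of players on the codes of vertices. -/
def pin (i j u : ℕ) : ℕ :=
  if Γ.Pinned u then triple Γ.bound (u / Γ.bound / Γ.bound)
    (Equiv.swap i j (u / Γ.bound % Γ.bound)) (u % Γ.bound)
  else u

variable {Γ}

theorem bound_pos : 0 < Γ.bound := Nat.succ_pos _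

theorem swap_lt {i j a n : ℕ} (hi : i < n) (hj : j < n) (ha : a < n) : Equiv.swap i j a < n := by
  rw [Equiv.swap_apply_def]
  split_ifs <;> assumption

theorem pin_lt {i j : ℕ} (hi : i < Γ.bound) (hj : j < Γ.bound) {u : ℕ} (hu : u < Γ.order) : Γ.pin i j u < Γ.order := by
  unfold pin
  split_ifs
  · refine triple_lt ?_ (swap_lt hi hj (Nat.mod_lt _ bound_pos)) (Nat.mod_lt _ bound_pos)
    rw [Nat.div_div_eq_div_mul]
    exact Nat.div_lt_of_lt_mul hu
  · exact hu

theorem pinned_pin {i j : ℕ} (hi : i < Γ.bound) (hj : j < Γ.bound) (u : ℕ) : Γ.Pinned (Γ.pin i j u) ↔ Γ.Pinned u := by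
  by_cases h : Γ.Pinned u
  · rw [pin, if_pos h, Pinned, Pinned, triple_div_div (swap_lt hi hj (Nat.mod_lt _ bound_pos))
      (Nat.mod_lt _ bound_pos)]
  · rw [pin, if_neg h]

theorem pin_pin {i j : ℕ} (hi : i < Γ.bound) (hj : j < Γ.bound) (u : ℕ) : Γ.pin i j (Γ.pin i j u) = u := by
  by_cases h : Γ.Pinned u
  · have h' := (pinned_pin hi hj u).2 h
    rw [pin, if_pos h']
    have ha := swap_lt hi hj (Nat.mod_lt (u / Γ.bound) bound_pos)
    have hb := Nat.mod_lt u (bound_pos (Γ := Γ))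
    rw [pin, if_pos h, triple_div_div ha hb, triple_div_mod ha hb, triple_mod hb,
      Equiv.swap_apply_self, triple_of_div_mod]
  · rw [pin, if_neg (by rwa [pinned_pin hi hj]), pin, if_neg h]

variable (Γ) in
/-- The action of a transposition of players on the vertices of the coded graph. -/
def pinFin (i j : Γ.Player) (u : Fin Γ.order) : Fin Γ.order :=
  ⟨Γ.pin i j u, pin_lt (lt_bound i.2) (lt_bound j.2) u.2⟩

theorem pinFin_involutive (i j : Γ.Player) : Involutive (Γ.pinFin i j) := fun u =>
  Fin.ext (pin_pin (lt_bound i.2) (lt_bound j.2) u)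

/-- Being pinned depends on the kind alone, so it is easy to compute. Numbers of other kinds that
code no vertex count as pinned; this does no harm, since they are isolated and `pin` permutes them.
-/
theorem pinned_code (x : Γ.Node) : Γ.Pinned (Γ.code x) ↔ x.IsPin := by
  rw [Pinned, code_val, triple_div_div x.major_lt x.minor_lt]
  cases x <;> simp [Node.kind, Node.IsPin]

theorem swap_val {n : ℕ} (i j k : Fin n) : (Equiv.swap i j k).val = Equiv.swap i.val j.val k := by
  simp only [Equiv.swap_apply_def, Fin.ext_iff]
  split_ifs <;> rfl

theorem pinFin_code (i j : Γ.Player) (x : Γ.Node) :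
    Γ.pinFin i j (Γ.code x) = Γ.code (pinNode (Equiv.swap i j) x) := by
  refine Fin.ext ?_
  change Γ.pin i j (Γ.code x) = _
  by_cases h : x.IsPin
  · rw [pin, if_pos ((pinned_code x).2 h)]
    simp only [code_val, triple_div_div x.major_lt x.minor_lt,
      triple_div_mod x.major_lt x.minor_lt, triple_mod x.minor_lt]
    cases x <;> first
      | exact h.elim
      | simp only [pinNode, Equiv.coe_fn_mk, Node.kind, Node.major, Node.minor, swap_val]
  · rw [pin, if_neg (fun h' => h ((pinned_code x).1 h'))]
    cases x <;> first
      | exact (h trivial).elim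
      | rfl

theorem induced_swap_iff (i j : Γ.Player) : Γ.Induced (Equiv.swap i j) ↔
    ∃ e : Equiv.Perm (Fin Γ.order), (∀ u v, Γ.codedGraph.Adj (e u) (e v) ↔
      Γ.codedGraph.Adj u v) ∧ ∀ v : Fin Γ.order, Γ.Pinned v → e v = Γ.pinFin i j v :=
  induced_iff_exists_perm Γ.code (pin := (pinFin_involutive i j).toPerm)
    (pinned := fun v => Γ.Pinned v) pinned_code (pinFin_code i j)

end Game

section

variable {α : Type} [Data α] {f : α → Game} {i j u v : α → ℕ}

theorem PT.bound (hf : PT f) : PT fun x => (f x).bound :=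
  hf.encode.length.add (PT.const 4)

theorem PT.order (hf : PT f) : PT fun x => (f x).order :=
  (hf.bound.mul hf.bound).mul hf.bound

theorem PT.arc (hf : PT f) (hu : PT u) (hv : PT v) : PT fun x => (f x).Arc (u x) (v x) := by
  have hB := hf.bound
  have hN := hf.numPlayers
  have hS := hf.numProfiles
  have ht := (hu.div hB).div hB
  have ha := (hu.div hB).mod hB
  have hb := hu.mod hB
  have ht' := (hv.div hB).div hB
  have ha' := (hv.div hB).mod hB
  have hb' := hv.mod hB
  have c := fun n : ℕ => PT.const (α := α) n
  refine PT.or ?_ (PT.or ?_ ?_)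
  · exact (ht.eq (c 0)).and ((ht'.eq (c 1)).and ((ha.lt hN).and ((hb.eq (c 0)).and
      ((ha'.eq ha).and (hb'.lt (hf.acts ha))))))
  · exact (ht.eq (c 1)).and ((ht'.eq (c 2)).and ((ha.lt hN).and ((ha'.lt hS).and
      ((hb'.eq (c 0)).and (hb.eq (hf.digit ha' ha))))))
  · exact (ht.eq (c 2)).and ((ht'.eq (c 3)).and ((ha.lt hS).and ((hb.eq (c 0)).and
      ((ha'.lt hN).and ((hb'.lt (hS.mul hN)).and
        (hf.samePayoff ((ha.mul hN).add ha') hb'))))))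

theorem PT.pinned (hf : PT f) (hu : PT u) : PT fun x => (f x).Pinned (u x) :=
  have ht := (hu.div hf.bound).div hf.bound
  ((ht.eq (PT.const 1)).or (ht.eq (PT.const 2))).not

theorem PT.swap (hi : PT i) (hj : PT j) (hu : PT u) :
    PT fun x => Equiv.swap (i x) (j x) (u x) :=
  (PT.ite (hu.eq hi) hj (PT.ite (hu.eq hj) hi hu)).congr fun _ => (Equiv.swap_apply_def _ _ _).symm

open Classical in
theorem PT.pin (hf : PT f) (hi : PT i) (hj : PT j) (hu : PT u) :
    PT fun x => (f x).pin (i x) (j x) (u x) :=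
  PT.ite (hf.pinned hu) (PT.triple hf.bound ((hu.div hf.bound).div hf.bound)
    (PT.swap hi hj ((hu.div hf.bound).mod hf.bound)) (hu.mod hf.bound)) hu

theorem PT.finGraph_game (hf : PT f) : PT fun x => (f x).finGraph := by
  have hg := hf.rearrange (φ := fun p : (α × ℕ) × ℕ => p.1.1) Rearranges.id.fst.fst
  have hu := PT.proj (φ := fun p : (α × ℕ) × ℕ => p.1.2) Rearranges.id.fst.snd
  have hv := PT.proj (φ := fun p : (α × ℕ) × ℕ => p.2) Rearranges.id.snd
  refine PT.finGraph (A := fun x u v => (f x).Arc u v ∨ (f x).Arc v u) hf.order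
    ((hg.arc hu hv).or (hg.arc hv hu)) (fun _ => rfl) fun x u v hu hv => ?_
  exact ((f x).finGraph.adj_coe ⟨u, hu⟩ ⟨v, hv⟩).trans Game.map_code_adj

end

end GameSym
end

noncomputable section

namespace GameSym

open Function Computability

/-! ## Restricted graph isomorphism -/

theorem flatMap_filter_eq {ι X : Type*} (l : List ι) (p : ι → Prop) [DecidablePred p]
    (f : ι → List X) :
    (l.filter p).flatMap f = l.flatMap fun i => if p i then f i else [] := by
  induction l with
  | nil => rfl
  | cons i l ih => by_cases h : p i <;> simp [h, ih]

namespace Game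

open Classical in
/-- The instance of restricted graph isomorphism for a transposition of players. -/
def restricted (Γ : Game) (p : Γ.Player × Γ.Player) : RestrictedInstance where
  source := Γ.finGraph
  target := Γ.finGraph
  constraints := ((List.finRange Γ.order).filter fun v : Fin Γ.order => Γ.Pinned v).map fun v =>
    (v, Γ.pinFin p.1 p.2 v)

variable {Γ : Game}

theorem restricted_yes_iff (i j : Γ.Player) :
    (Γ.restricted (i, j)).Yes ↔ Γ.Induced (Equiv.swap i j) := by
  classical
  rw [induced_swap_iff]
  constructor
  · rintro ⟨e, he⟩
    refine ⟨e.toEquiv, fun u v => e.map_adj_iff, fun v hv => ?_⟩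
    refine he (v, Γ.pinFin i j v) (List.mem_map.2 ⟨v, List.mem_filter.2 ⟨List.mem_finRange v, ?_⟩,
      rfl⟩)
    exact decide_eq_true hv
  · rintro ⟨e, he, hp⟩
    refine ⟨⟨e, fun {u v} => he u v⟩, fun p h => ?_⟩
    obtain ⟨v, hv, rfl⟩ := List.mem_map.1 h
    exact hp v (of_decide_eq_true (List.mem_filter.1 hv).2)

open Classical in
variable (Γ) in
/-- The codes of the instances of restricted graph isomorphism. -/
def restrictedCode (i j : ℕ) : List Γ' :=
  Γ.finGraph.encode ++ Γ.finGraph.encode ++ (((List.range Γ.order).flatMap fun v =>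
    if Γ.Pinned v then Γ'.bra :: (encodeUnary v ++ encodeUnary (Γ.pin i j v)) else []) ++ [Γ'.ket])

theorem encode_restricted (i j : Γ.Player) :
    (Γ.restricted (i, j)).encode = Γ.restrictedCode i j := by
  classical
  rw [RestrictedInstance.encode, restrictedCode, encodeList, ← finRange_flatMap]
  congr 2
  exact (List.flatMap_map _ _ _).trans (flatMap_filter_eq (List.finRange Γ.order) _ _)

open Classical in
variable (Γ) in
/-- The code of the list of instances of restricted graph isomorphism for all transpositions. -/
def restrictedListCode : List Γ' :=
  ((List.range Γ.numPlayers).flatMap fun i => (List.range Γ.numPlayers).flatMap fun j =>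
    if i < j then Γ'.bra :: Γ.restrictedCode i j else []) ++ [Γ'.ket]

theorem encodeList_restricted :
    encodeList RestrictedInstance.encode (Γ.transpositions.map Γ.restricted) =
      Γ.restrictedListCode := by
  classical
  rw [encodeList, restrictedListCode, ← finRange_flatMap, transpositions]
  simp only [List.flatMap_map, List.flatMap_assoc, flatMap_filter_eq, encode_restricted]
  congr 1
  refine List.flatMap_congr fun i _ => ?_
  rw [← finRange_flatMap]
  refine List.flatMap_congr fun j _ => ?_
  simp only [Fin.lt_def]

end Game

section

variable {α : Type} [Data α] {f : α → Game} {i j : α → ℕ}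

open Classical in
theorem PT.restrictedCode (hf : PT f) (hi : PT i) (hj : PT j) :
    PT fun x => (f x).restrictedCode (i x) (j x) := by
  have hv := PT.proj (φ := fun p : α × ℕ => p.2) Rearranges.id.snd
  have hf' := hf.rearrange (φ := fun p : α × ℕ => p.1) Rearranges.id.fst
  have hi' := hi.rearrange (φ := fun p : α × ℕ => p.1) Rearranges.id.fst
  have hj' := hj.rearrange (φ := fun p : α × ℕ => p.1) Rearranges.id.fst
  exact (hf.finGraph_game.str_of.append hf.finGraph_game.str_of).append
    ((PT.flatMap_range (f := fun x v => if (f x).Pinned v then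
      Γ'.bra :: (encodeUnary v ++ encodeUnary ((f x).pin (i x) (j x) v)) else []) hf.order
      (PT.ite (hf'.pinned hv) (PT.cons _ (hv.unary.append (hf'.pin hi' hj' hv).unary))
        PT.nil)).append (PT.const [Γ'.ket]))

open Classical in
theorem PT.restrictedListCode : PT Game.restrictedListCode := by
  have hΓ := PT.proj (φ := fun p : (Game × ℕ) × ℕ => p.1.1) Rearranges.id.fst.fst
  have hi := PT.proj (φ := fun p : (Game × ℕ) × ℕ => p.1.2) Rearranges.id.fst.snd
  have hj := PT.proj (φ := fun p : (Game × ℕ) × ℕ => p.2) Rearranges.id.snd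
  exact (PT.flatMap_range (f := fun (Γ : Game) i => (List.range Γ.numPlayers).flatMap fun j =>
      if i < j then Γ'.bra :: Γ.restrictedCode i j else []) PT.id.numPlayers
    (PT.flatMap_range (f := fun (p : Game × ℕ) j =>
      if p.2 < j then Γ'.bra :: p.1.restrictedCode p.2 j else [])
      (PT.id.numPlayers.rearrange Rearranges.id.fst)
      (PT.ite (hi.lt hj) (PT.cons _ (hΓ.restrictedCode hi hj)) PT.nil))).append
    (PT.const [Γ'.ket])

end

/-- The program produces the plain string `restrictedListCode`; the dependent type of the instances
enters only through the equality of codes. -/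
theorem polyTimeComputable_restricted : PolyTimeComputable Game.encode
    (encodeList RestrictedInstance.encode) fun Γ => Γ.transpositions.map Γ.restricted :=
  (polyTimeComputable_of_str PT.restrictedListCode).transport (fun Γ => Γ) (fun _ => rfl)
    fun _ => Game.encodeList_restricted.symm

/-! ## Reduction to graph isomorphism -/

/-- All ordered pairs are used, so that copies are numbered by quotient and remainder. Pairs with
equal entries only ask for the identity. -/
theorem Game.allPlayerPermsInduced_iff_fin {Γ : Game} : Γ.AllPlayerPermsInduced ↔
    ∀ q : Fin (Γ.numPlayers * Γ.numPlayers), Γ.Induced (Equiv.swap q.divNat q.modNat) := by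
  rw [allPlayerPermsInduced_iff_swap]
  refine ⟨fun h q => h _ _, fun h i j => ?_⟩
  have := h (finProdFinEquiv (i, j))
  have h' := finProdFinEquiv.symm_apply_apply (i, j)
  rw [finProdFinEquiv_symm_apply, Prod.mk.injEq] at h'
  rwa [h'.1, h'.2] at this

section

variable {Q n Z : ℕ}

/-- Numbering of triples. -/
def prodEquiv (Q n Z : ℕ) : (Fin Q × Fin n) × Fin Z ≃ Fin (Q * n * Z) :=
  (finProdFinEquiv.prodCongr (Equiv.refl _)).trans finProdFinEquiv

/-- A graph on triples, as a graph on an initial segment of the natural numbers. -/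
def FinGraph.ofProd (G : SimpleGraph ((Fin Q × Fin n) × Fin Z)) : FinGraph :=
  ⟨Q * n * Z, G.comap (prodEquiv Q n Z).symm⟩

def FinGraph.ofProdIso (G : SimpleGraph ((Fin Q × Fin n) × Fin Z)) : (ofProd G).graph ≃g G :=
  SimpleGraph.Iso.comap (prodEquiv Q n Z).symm G

theorem FinGraph.ofProd_iso_iff {G H : SimpleGraph ((Fin Q × Fin n) × Fin Z)} :
    Nonempty ((ofProd G).graph ≃g (ofProd H).graph) ↔ Nonempty (G ≃g H) :=
  ⟨fun ⟨e⟩ => ⟨((ofProdIso G).symm.trans e).trans (ofProdIso H)⟩,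
    fun ⟨e⟩ => ⟨((ofProdIso G).trans e).trans (ofProdIso H).symm⟩⟩

end

/-! ### A single pair of graphs for all transpositions -/

namespace Game

variable (Γ : Game)

/-- The number of ordered pairs of players. -/
def numPairs : ℕ := Γ.numPlayers * Γ.numPlayers

/-- A bound for the number of leaves at each vertex. -/
def numLeaves : ℕ := Γ.numPairs * (Γ.order + 1) + 3

/-- Copies of the graph of a game, one for each pair of players, with leaves that encode the
vertices `W q v`. -/
def gadget (W : Fin Γ.numPairs → Fin Γ.order → Fin Γ.order) :
    SimpleGraph ((Fin Γ.numPairs × Fin Γ.order) × Fin Γ.numLeaves) :=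
  leafGraph (copies Γ.codedGraph Γ.numPairs)
    (fun x => copyColor (fun v : Fin Γ.order => Γ.Pinned v) x.1 x.2 (W x.1 x.2)) Γ.numLeaves

/-- The two gadgets differ only in colours: a pinned vertex is coloured by itself in the source and
by its image under the `q`-th transposition in the target. -/
theorem gadget_iso_iff : Nonempty (Γ.gadget (fun _ v => v) ≃g
      Γ.gadget fun q => Γ.pinFin (Fin.divNat q) (Fin.modNat q)) ↔ Γ.AllPlayerPermsInduced := by
  rw [allPlayerPermsInduced_iff_fin]
  refine (leafGraph_iso_iff (fun _ => copyColor_lt _ (Fin.is_lt _) _ _)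
    (fun _ => copyColor_lt _ (Fin.is_lt _) _ _)).trans ?_
  refine Iff.trans (copies_color_iff (fun q => pinFin_involutive _ _)
    fun q v => pinned_pin (lt_bound (Fin.is_lt _)) (lt_bound (Fin.is_lt _)) _) ?_
  exact forall_congr' fun q => (induced_swap_iff _ _).symm

open Classical in
/-- The number of leaves at the vertex `v` of the `q`-th copy. -/
def leaves (w q v : ℕ) : ℕ := q * (Γ.order + 1) + (if Γ.Pinned v then w + 1 else 0) + 2

/-- The edges of the numbered gadget. -/
def GadgetArc (w : ℕ → ℕ → ℕ) (q v z q' v' z' : ℕ) : Prop :=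
  (z = 0 ∧ z' = 0 ∧ q = q' ∧ (Γ.Arc v v' ∨ Γ.Arc v' v)) ∨
  (q = q' ∧ v = v' ∧ z = 0 ∧ 1 ≤ z' ∧ z' ≤ Γ.leaves (w q v) q v) ∨
  (q = q' ∧ v = v' ∧ z' = 0 ∧ 1 ≤ z ∧ z ≤ Γ.leaves (w q v) q v)

variable {Γ}

theorem gadget_adj_iff {W : Fin Γ.numPairs → Fin Γ.order → Fin Γ.order} {w : ℕ → ℕ → ℕ}
    (hw : ∀ q v, (W q v).val = w q v) (x y : (Fin Γ.numPairs × Fin Γ.order) × Fin Γ.numLeaves) :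
    (Γ.gadget W).Adj x y ↔ Γ.GadgetArc w x.1.1 x.1.2 x.2 y.1.1 y.1.2 y.2 := by
  have h := fun u v : Fin Γ.order => (map_code_adj (Γ := Γ) (u := u) (v := v))
  obtain ⟨⟨q, v⟩, z⟩ := x
  obtain ⟨⟨q', v'⟩, z'⟩ := y
  simp only [gadget, leafGraph_adj, copies, codedGraph, h, GadgetArc, leaves, copyColor, hw,
    Prod.mk.injEq, Fin.ext_iff, and_assoc]

theorem ofProd_gadget_adj {W : Fin Γ.numPairs → Fin Γ.order → Fin Γ.order} {w : ℕ → ℕ → ℕ}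
    (hw : ∀ q v, (W q v).val = w q v) {x y : ℕ} (hx : x < Γ.numPairs * Γ.order * Γ.numLeaves)
    (hy : y < Γ.numPairs * Γ.order * Γ.numLeaves) : (FinGraph.ofProd (Γ.gadget W)).adj x y ↔
      Γ.GadgetArc w (x / Γ.numLeaves / Γ.order) (x / Γ.numLeaves % Γ.order) (x % Γ.numLeaves)
        (y / Γ.numLeaves / Γ.order) (y / Γ.numLeaves % Γ.order) (y % Γ.numLeaves) :=
  ((FinGraph.ofProd (Γ.gadget W)).adj_coe ⟨x, hx⟩ ⟨y, hy⟩).trans (gadget_adj_iff hw _ _)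

end Game

section

variable {α : Type} [Data α] {f : α → Game}

theorem PT.numPairs (hf : PT f) : PT fun x => (f x).numPairs := hf.numPlayers.mul hf.numPlayers

theorem PT.numLeaves (hf : PT f) : PT fun x => (f x).numLeaves :=
  (hf.numPairs.mul hf.order.succ).add (PT.const 3)

open Classical in
theorem PT.gadgetArc {w : α → ℕ → ℕ → ℕ} {q v z q' v' z' : α → ℕ} (hf : PT f)
    (hw : PT fun x => w x (q x) (v x)) (hq : PT q) (hv : PT v) (hz : PT z) (hq' : PT q')
    (hv' : PT v') (hz' : PT z') :
    PT fun x => (f x).GadgetArc (w x) (q x) (v x) (z x) (q' x) (v' x) (z' x) := by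
  have c := fun n : ℕ => PT.const (α := α) n
  have hl : PT fun x => (f x).leaves (w x (q x) (v x)) (q x) (v x) :=
    ((hq.mul hf.order.succ).add (PT.ite (hf.pinned hv) hw.succ (c 0))).add (c 2)
  refine PT.or ?_ (PT.or ?_ ?_)
  · exact (hz.eq (c 0)).and ((hz'.eq (c 0)).and ((hq.eq hq').and
      ((hf.arc hv hv').or (hf.arc hv' hv))))
  · exact (hq.eq hq').and ((hv.eq hv').and ((hz.eq (c 0)).and (((c 1).le hz').and (hz'.le hl))))
  · exact (hq.eq hq').and ((hv.eq hv').and ((hz'.eq (c 0)).and (((c 1).le hz).and (hz.le hl))))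

theorem PT.gadget {w : Game → ℕ → ℕ → ℕ} (hw : PT fun p : (Game × ℕ) × ℕ => w p.1.1 p.1.2 p.2)
    {W : ∀ Γ : Game, Fin Γ.numPairs → Fin Γ.order → Fin Γ.order}
    (hW : ∀ Γ q v, (W Γ q v).val = w Γ q v) :
    PT fun Γ : Game => FinGraph.ofProd (Γ.gadget (W Γ)) := by
  have hΓ := PT.proj (φ := fun p : (Game × ℕ) × ℕ => p.1.1) Rearranges.id.fst.fst
  have hu := PT.proj (φ := fun p : (Game × ℕ) × ℕ => p.1.2) Rearranges.id.fst.snd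
  have hv := PT.proj (φ := fun p : (Game × ℕ) × ℕ => p.2) Rearranges.id.snd
  have h₁ := hΓ.numLeaves
  have h₂ := hΓ.order
  -- The copy number and the vertex are decoded from the vertex number and substituted into `w` by
  -- two uses of `PT.bind`.
  have hw' := PT.bind (f := fun p : ((Game × ℕ) × ℕ) × ℕ => w p.1.1.1
      (p.1.1.2 / p.1.1.1.numLeaves / p.1.1.1.order) p.2)
    (PT.bind (f := fun p : (((Game × ℕ) × ℕ) × ℕ) × ℕ => w p.1.1.1.1 p.2 p.1.2)
      (hw.rearrange ((Rearranges.id.fst.fst.fst.fst.pair Rearranges.id.snd).pair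
        Rearranges.id.fst.snd))
      (((hu.div h₁).div h₂).rearrange Rearranges.id.fst)) ((hu.div h₁).mod h₂)
  exact PT.finGraph (A := fun Γ x y => Γ.GadgetArc (w Γ) (x / Γ.numLeaves / Γ.order)
      (x / Γ.numLeaves % Γ.order) (x % Γ.numLeaves) (y / Γ.numLeaves / Γ.order)
      (y / Γ.numLeaves % Γ.order) (y % Γ.numLeaves))
    ((PT.id.numPairs.mul PT.id.order).mul PT.id.numLeaves)
    (hΓ.gadgetArc (w := fun p => w p.1.1) hw' ((hu.div h₁).div h₂) ((hu.div h₁).mod h₂)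
      (hu.mod h₁) ((hv.div h₁).div h₂) ((hv.div h₁).mod h₂) (hv.mod h₁))
    (fun _ => rfl) fun Γ x y hx hy => Game.ofProd_gadget_adj (hW Γ) hx hy

end

theorem allPlayerPermsInduced_mem_GI : allPlayerPermsInduced ∈ GI := by
  have hΓ := PT.proj (φ := fun p : (Game × ℕ) × ℕ => p.1.1) Rearranges.id.fst.fst
  have hq := PT.proj (φ := fun p : (Game × ℕ) × ℕ => p.1.2) Rearranges.id.fst.snd
  have hv := PT.proj (φ := fun p : (Game × ℕ) × ℕ => p.2) Rearranges.id.snd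
  have h₁ := PT.gadget (w := fun _ _ v => v) hv (W := fun _ _ v => v) fun _ _ _ => rfl
  have h₂ := PT.gadget
    (w := fun Γ q v => Γ.pin (q / Γ.numPlayers) (q % Γ.numPlayers) v)
    (hΓ.pin (hq.div hΓ.numPlayers) (hq.mod hΓ.numPlayers) hv)
    (W := fun Γ q => Γ.pinFin (Fin.divNat q) (Fin.modNat q)) fun _ _ _ => rfl
  exact ⟨fun Γ => (FinGraph.ofProd (Γ.gadget fun _ v => v),
      FinGraph.ofProd (Γ.gadget fun q => Γ.pinFin (Fin.divNat q) (Fin.modNat q))),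
    (polyTimeComputable_of_str (h₁.graphPair h₂)).transport (fun Γ : Game => Γ) (fun _ => rfl)
      fun _ => rfl,
    fun Γ => (Game.gadget_iso_iff Γ).symm.trans FinGraph.ofProd_iso_iff.symm⟩

end GameSym
end

/-! ### The main theorem -/

theorem mainTheorem5 :
    GameSym.GIComplete GameSym.allPlayerPermsInduced ∧
    GameSym.GIHard GameSym.allPlayerPermsInducedTwoPlayerZeroSum ∧
    ∃ R : (Γ : GameSym.Game) → Γ.Player × Γ.Player → GameSym.RestrictedInstance,
      GameSym.PolyTimeComputable GameSym.Game.encode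
        (GameSym.encodeList GameSym.RestrictedInstance.encode)
        (fun Γ => Γ.transpositions.map (R Γ)) ∧
      (∀ (Γ : GameSym.Game) (i j : Γ.Player), i < j →
        ((R Γ (i, j)).Yes ↔ Γ.Induced (Equiv.swap i j))) ∧
      (∀ Γ : GameSym.Game,
        Γ.AllPlayerPermsInduced ↔ ∀ p ∈ Γ.transpositions, (R Γ p).Yes) :=
  ⟨⟨GameSym.allPlayerPermsInduced_mem_GI,
      GameSym.GIHard.of_reduces GameSym.graphIsomorphism_reduces⟩,
    GameSym.GIHard.of_reduces GameSym.graphIsomorphism_reduces_zeroSum,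
    GameSym.Game.restricted, GameSym.polyTimeComputable_restricted,
    fun _ i j _ => GameSym.Game.restricted_yes_iff i j, fun _ =>
      GameSym.Game.allPlayerPermsInduced_iff_transpositions.trans
        (forall₂_congr fun p _ => (GameSym.Game.restricted_yes_iff p.1 p.2).symm)⟩
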